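/- Let $\Omega,\Omega'\subset\mathbb R^n$ be bounded domains (nonempty, open, connected), let $a_1,\dots,a_N\in\mathbb R^n$ be pairwise distinct, and let $\mathcal U\subset\mathbb R^n\times\mathbb R^n$ be a bounded domain with $\overline{\Omega'\times\Omega}\subset\mathcal U$. For $j=1,\dots,N$ let $g_j:\overline{\mathcal U}\to\mathbb R$ be Hölder continuous of order $\sigma_j\in(0,1]$. Let $0<d<n$ be real, $p=n/d$, $\frac1p+\frac1{p'}=1$, let $\omega_{n-1}$ be the surface area of the unit sphere of $\mathbb R^n$, and for $x\in\Omega'$, $y\in\Omega$ put $$K(x,y)=\sum_{j=1}^N g_j(x,y)\,|x+a_j-y|^{d-n},\qquad Tf(x)=\int_\Omega K(x,y)f(y)\,dy,\quad f\in L^p(\Omega)\ \text{(real-valued)}.$$ For $x\in\Omega'$ let $$S(x)=\sum_{j:\ (x,x+a_j)\in\overline{\mathcal U}}|g_j(x,x+a_j)|^{p'},\qquad M(\mathbf g)=\sup_{x\in\Omega'}S(x),$$ and assume $M(\mathbf g)>0$. Then: (1) For every $f\in L^p(\Omega)$ the integral defining $Tf(x)$ converges absolutely for almost every $x\in\Omega'$,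 and $Tf$ is measurable on $\Omega'$. Moreover there is a constant $C$, independent of $f$, such that for every $f\in L^p(\Omega)$, $f\ne0$, $$\int_{\Omega'}\exp\left[\frac{n}{\omega_{n-1}M(\mathbf g)}\left(\frac{|Tf(x)|}{\|f\|_{L^p(\Omega)}}\right)^{p'}\right]dx\le C.$$ (2) If $\Omega^*:=\Omega'\cap\bigcap_{j=1}^N(\Omega-a_j)\neq\emptyset$ and $M(\mathbf g)$ is attained on $\Omega^*$, i.e. $S(x^*)=M(\mathbf g)$ for some $x^*\in\Omega^*$, then the constant is sharp: for every $\alpha>\frac{n}{\omega_{n-1}M(\mathbf g)}$ there is no constant $C$ such that $$\int_{\Omega'}\exp\left[\alpha\left(\frac{|Tf(x)|}{\|f\|_{L^p(\Omega)}}\right)^{p'}\right]dx\le C\qquad\text{for all } f\in L^p(\Omega),\ f\neq0.$$ -/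

import Mathlib

open MeasureTheory Set
open scoped NNReal ENNReal

noncomputable section

/-- A domain: a nonempty, connected, open set. -/
def IsDomainSet {X : Type*} [TopologicalSpace X] (S : Set X) : Prop :=
  IsOpen S ∧ IsConnected S

/-- The surface area of the unit sphere of `ℝⁿ` (the measure on the sphere induced by Lebesgue
measure through polar coordinates). -/
def sphereArea (n : ℕ) : ℝ :=
  ((volume : Measure (EuclideanSpace ℝ (Fin n))).toSphere univ).toReal

/-- The kernel `K(x,y) = ∑ⱼ gⱼ(x,y) |x + aⱼ - y| ^ (d - n)`. -/
def potentialKernel {n N : ℕ} (d : ℝ) (a : Fin N → EuclideanSpace ℝ (Fin n))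
    (g : Fin N → EuclideanSpace ℝ (Fin n) × EuclideanSpace ℝ (Fin n) → ℝ)
    (x y : EuclideanSpace ℝ (Fin n)) : ℝ :=
  ∑ j, g j (x, y) * ‖x + a j - y‖ ^ (d - (n : ℝ))

/-- The operator `Tf(x) = ∫_Ω K(x,y) f(y) dy`. -/
def potentialOp {n N : ℕ} (d : ℝ) (a : Fin N → EuclideanSpace ℝ (Fin n))
    (g : Fin N → EuclideanSpace ℝ (Fin n) × EuclideanSpace ℝ (Fin n) → ℝ)
    (Ω : Set (EuclideanSpace ℝ (Fin n))) (f : EuclideanSpace ℝ (Fin n) → ℝ)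
    (x : EuclideanSpace ℝ (Fin n)) : ℝ :=
  ∫ y in Ω, potentialKernel d a g x y * f y

/-- The `L^p` norm of `f` on `Ω`. -/
def lpNormOn {n : ℕ} (p : ℝ) (Ω : Set (EuclideanSpace ℝ (Fin n)))
    (f : EuclideanSpace ℝ (Fin n) → ℝ) : ℝ :=
  (eLpNorm f (ENNReal.ofReal p) (volume.restrict Ω)).toReal

/-- `∑ⱼ |gⱼ(x, x + aⱼ)| ^ q`, the sum running over the `j` for which `(x, x + aⱼ)` lies in the
set `V` (the closure of `U` below) on which the `gⱼ` are defined. -/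
def shiftedSum {n N : ℕ} (q : ℝ) (a : Fin N → EuclideanSpace ℝ (Fin n))
    (g : Fin N → EuclideanSpace ℝ (Fin n) × EuclideanSpace ℝ (Fin n) → ℝ)
    (V : Set (EuclideanSpace ℝ (Fin n) × EuclideanSpace ℝ (Fin n)))
    (x : EuclideanSpace ℝ (Fin n)) : ℝ :=
  ∑ j, V.indicator (fun z => |g j z| ^ q) (x, x + a j)

/-- `M(g)`, the supremum over `x ∈ Ω'` of the sums above. -/
def supShiftedSum {n N : ℕ} (q : ℝ) (a : Fin N → EuclideanSpace ℝ (Fin n))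
    (g : Fin N → EuclideanSpace ℝ (Fin n) × EuclideanSpace ℝ (Fin n) → ℝ)
    (V : Set (EuclideanSpace ℝ (Fin n) × EuclideanSpace ℝ (Fin n)))
    (Ω' : Set (EuclideanSpace ℝ (Fin n))) : ℝ :=
  sSup (shiftedSum q a g V '' Ω')

/-- `Ω* = Ω' ∩ ⋂ⱼ (Ω - aⱼ)`. -/
def starSet {n N : ℕ} (a : Fin N → EuclideanSpace ℝ (Fin n))
    (Ω Ω' : Set (EuclideanSpace ℝ (Fin n))) : Set (EuclideanSpace ℝ (Fin n)) :=
  Ω' ∩ ⋂ j, (fun y => y - a j) '' Ω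

/-- `∫_{Ω'} exp[α (|Tf| / ‖f‖_p) ^ q] dx`, with values in `[0, ∞]`. -/
def expIntegral {n N : ℕ} (d p q α : ℝ) (a : Fin N → EuclideanSpace ℝ (Fin n))
    (g : Fin N → EuclideanSpace ℝ (Fin n) × EuclideanSpace ℝ (Fin n) → ℝ)
    (Ω Ω' : Set (EuclideanSpace ℝ (Fin n))) (f : EuclideanSpace ℝ (Fin n) → ℝ) : ℝ≥0∞ :=
  ∫⁻ x in Ω', ENNReal.ofReal
    (Real.exp (α * (|potentialOp d a g Ω f x| / lpNormOn p Ω f) ^ q))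

end

/-! Write q for p'. Upper bound. Normalize ‖f‖_p = 1, put u(x) = ∫ |K(x,y)| |f(y)| dy and A =
ω_{n-1} M(g) / n, and let t_m be the measure of the level set {u^q ≥ A m}. The exponential integral
is at most a constant times ∑ e^m t_m, so with T_m = log(t₀ / t_m) + b the task is to bound ∑ e^(m -
T_m).

The constant A comes from the poles x + a_j of the kernel. They are separated and (d - n) q = -n, so
near the j-th pole |K|^q is |g_j(x, x + a_j)|^q |x + a_j - y|^(-n), up to an error that Hölder
continuity makes integrable. Outside balls of volume about t around the poles, |K|^q therefore
integrates to at most A log(t₀ / t) + B (`setLIntegral_kernelMajorant_le`).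

To use this, f is split along its top sets, sets of prescribed measure that carry its largest
values. Let φ be the mass of f^p on the top set of measure t_{m₁}. Averaging u over the level set of
m₂ ≥ m₁ gives (`potential_two_scale`) m₂^(1/q) ≤ T_{m₁}^(1/q) (1 - φ)^(1/p) + D (T_{m₂} - T_{m₁} +
1)^(1/q) φ^(1/p). For m₁ = m₂ = m this yields m ≤ T_m + O(1), and it forces φ T_m = O(k) whenever
T_m ≤ m + k. Fed back with m₁ < m₂, this leaves only O(k) levels with T_m ≤ m + k
(`exists_finset_levels`), and the sum is dominated by ∑ k e^(-k).

Sharpness. At a maximum point z of S the test functions are the equality case of Hölder's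
inequality: ∑ c_j |c_j|^(q-2) |z + a_j - y|^(-d) with c_j = g_j(z, z + a_j), cut off to annuli τ ≤
|z + a_j - y| < ρ. With Λ = log(ρ / τ), the quantity (|Tf| / ‖f‖)^q is nearly ω_{n-1} M(g) Λ on a
ball about z of volume comparable to e^(-nΛ). Any larger exponent makes the integral blow up as Λ →
∞. -/

/-! ### Radial integrals of powers of the distance. -/

lemma sphereArea_pos {n : ℕ} (hn : 0 < n) : 0 < sphereArea n := by
  have : Nonempty (Fin n) := ⟨⟨0, hn⟩⟩
  unfold sphereArea
  rw [ENNReal.toReal_pos_iff]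
  have : Nontrivial (EuclideanSpace ℝ (Fin n)) := inferInstance
  exact ⟨Measure.measure_univ_pos.2 (Measure.toSphere_ne_zero _), measure_lt_top _ _⟩

lemma ofReal_sphereArea (n : ℕ) : ENNReal.ofReal (sphereArea n) =
    (volume : Measure (EuclideanSpace ℝ (Fin n))).toSphere univ :=
  ENNReal.ofReal_toReal (measure_ne_top _ _)

/-- Integration of radial functions in polar coordinates. -/
lemma lintegral_radial {n : ℕ} (hn : 0 < n) {f : ℝ → ℝ≥0∞} (hf : Measurable f) :
    ∫⁻ x : EuclideanSpace ℝ (Fin n), f ‖x‖ =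
      ENNReal.ofReal (sphereArea n) * ∫⁻ r in Ioi (0 : ℝ), ENNReal.ofReal (r ^ (n - 1)) * f r := by
  have : Nonempty (Fin n) := ⟨⟨0, hn⟩⟩
  set μ : Measure (EuclideanSpace ℝ (Fin n)) := volume
  have hdim : Module.finrank ℝ (EuclideanSpace ℝ (Fin n)) = n := by simp
  calc
    ∫⁻ x, f ‖x‖ ∂μ = ∫⁻ x : ({(0)}ᶜ : Set (EuclideanSpace ℝ (Fin n))), f ‖x.1‖
        ∂(μ.comap (↑)) := by
      rw [lintegral_subtype_comap (measurableSet_singleton _).compl fun x ↦ f (‖x‖),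
        restrict_compl_singleton]
    _ = ∫⁻ x, f x.2 ∂μ.toSphere.prod (.volumeIoiPow (n - 1)) := by
      have h := μ.measurePreserving_homeomorphUnitSphereProd.lintegral_comp_emb
        (Homeomorph.measurableEmbedding _) (f ∘ Subtype.val ∘ Prod.snd)
      rw [hdim] at h
      simpa using h
    _ = μ.toSphere univ * ∫⁻ x : Ioi (0 : ℝ), f x ∂.volumeIoiPow (n - 1) := by
      rw [lintegral_prod _ (by fun_prop)]
      simp [mul_comm]
    _ = _ := by
      rw [ofReal_sphereArea, Measure.volumeIoiPow, lintegral_withDensity_eq_lintegral_mul _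
        (by fun_prop) (by fun_prop)]
      congr 1
      exact lintegral_subtype_comap measurableSet_Ioi
        fun r : ℝ => ENNReal.ofReal (r ^ (n - 1)) * f r

/-- The exponent -n is critical: in polar coordinates the integrand becomes 1/s. This is the source
of every logarithm below and of the factor ω_{n-1} in the sharp constant. -/
lemma lintegral_annulus_rpow_neg {n : ℕ} (hn : 0 < n) {r R : ℝ} (hr : 0 < r) (hrR : r ≤ R)
    (c : EuclideanSpace ℝ (Fin n)) :
    ∫⁻ z in {z : EuclideanSpace ℝ (Fin n) | r ≤ ‖c - z‖ ∧ ‖c - z‖ < R},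
      ENNReal.ofReal (‖c - z‖ ^ (-(n : ℝ))) = ENNReal.ofReal (sphereArea n * Real.log (R / r)) := by
  have hm : MeasurableSet {z : EuclideanSpace ℝ (Fin n) | r ≤ ‖c - z‖ ∧ ‖c - z‖ < R} :=
    (measurableSet_le measurable_const (measurable_const.sub measurable_id).norm).inter
      (measurableSet_lt (measurable_const.sub measurable_id).norm measurable_const)
  have key := lintegral_radial hn (f := (Ico r R).indicator fun s => ENNReal.ofReal (s ^ (-(n : ℝ))))
    (Measurable.indicator (by fun_prop) measurableSet_Ico)
  rw [← lintegral_indicator hm]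
  have h1 : ∀ z : EuclideanSpace ℝ (Fin n), ({z : EuclideanSpace ℝ (Fin n) | r ≤ ‖c - z‖ ∧ ‖c - z‖ < R}).indicator
      (fun z => ENNReal.ofReal (‖c - z‖ ^ (-(n : ℝ)))) z =
      (Ico r R).indicator (fun s => ENNReal.ofReal (s ^ (-(n : ℝ)))) ‖c - z‖ := by
    intro z; simp [indicator, Set.mem_Ico]
  simp_rw [h1]
  rw [lintegral_sub_left_eq_self (fun z => indicator _ _ ‖z‖) c, key]
  rw [ENNReal.ofReal_mul (sphereArea_pos hn).le]
  congr 1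
  have h2 : ∀ s ∈ Ioi (0:ℝ), ENNReal.ofReal (s ^ (n - 1)) *
      (Ico r R).indicator (fun s => ENNReal.ofReal (s ^ (-(n : ℝ)))) s =
      (Ico r R).indicator (fun s => ENNReal.ofReal (s⁻¹)) s := by
    intro s hs
    have hs : 0 < s := hs
    by_cases h : s ∈ Ico r R
    · simp only [indicator_of_mem h]
      rw [← ENNReal.ofReal_mul (by positivity)]
      congr 1
      rw [Real.rpow_neg hs.le, Real.rpow_natCast]
      obtain ⟨k, rfl⟩ : ∃ k, n = k + 1 := ⟨n - 1, by omega⟩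
      simp [pow_succ]
      field_simp
    · simp [indicator_of_notMem h]
  rw [setLIntegral_congr_fun measurableSet_Ioi h2, lintegral_indicator measurableSet_Ico,
    Measure.restrict_restrict measurableSet_Ico, Set.inter_eq_left.2 (fun s hs => mem_Ioi.2 (hr.trans_le hs.1)),
    ← integral_inv_of_pos hr (hr.trans_le hrR), intervalIntegral.integral_of_le hrR,
    Measure.restrict_congr_set Ico_ae_eq_Ioc, ofReal_integral_eq_lintegral_ofReal]
  · have : IntervalIntegrable (fun x : ℝ => x⁻¹) volume r R :=
      intervalIntegral.intervalIntegrable_inv (fun x hx => by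
        rw [uIcc_of_le hrR] at hx; exact (hr.trans_le hx.1).ne') continuousOn_id
    exact this.1
  · filter_upwards [ae_restrict_mem measurableSet_Ioc] with y hy
    exact inv_nonneg.2 (hr.trans hy.1).le

lemma lintegral_ball_rpow {n : ℕ} (hn : 0 < n) {β R : ℝ} (hβ : 0 < β) (hR : 0 < R)
    (c : EuclideanSpace ℝ (Fin n)) :
    ∫⁻ z in {z : EuclideanSpace ℝ (Fin n) | ‖c - z‖ < R},
      ENNReal.ofReal (‖c - z‖ ^ (β - n)) = ENNReal.ofReal (sphereArea n * (R ^ β / β)) := by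
  have hm : MeasurableSet {z : EuclideanSpace ℝ (Fin n) | ‖c - z‖ < R} :=
      (measurableSet_lt (measurable_const.sub measurable_id).norm measurable_const)
  have key := lintegral_radial hn (f := (Iio R).indicator fun s => ENNReal.ofReal (s ^ (β - n)))
    (Measurable.indicator (by fun_prop) measurableSet_Iio)
  rw [← lintegral_indicator hm]
  have h1 : ∀ z : EuclideanSpace ℝ (Fin n), ({z : EuclideanSpace ℝ (Fin n) | ‖c - z‖ < R}).indicator
      (fun z => ENNReal.ofReal (‖c - z‖ ^ (β - n))) z =
      (Iio R).indicator (fun s => ENNReal.ofReal (s ^ (β - n))) ‖c - z‖ := by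
    intro z; simp [indicator]
  simp_rw [h1]
  rw [lintegral_sub_left_eq_self (fun z => indicator _ _ ‖z‖) c, key]
  rw [ENNReal.ofReal_mul (sphereArea_pos hn).le]
  congr 1
  have h2 : ∀ s ∈ Ioi (0:ℝ), ENNReal.ofReal (s ^ (n - 1)) *
      (Iio R).indicator (fun s => ENNReal.ofReal (s ^ (β - n))) s =
      (Iio R).indicator (fun s => ENNReal.ofReal (s ^ (β - 1))) s := by
    intro s hs
    have hs : 0 < s := hs
    by_cases h : s ∈ Iio R
    · simp only [indicator_of_mem h]
      rw [← ENNReal.ofReal_mul (by positivity)]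
      congr 1
      rw [← Real.rpow_natCast, ← Real.rpow_add hs, Nat.cast_sub hn]
      congr 1; push_cast; ring
    · simp [indicator_of_notMem h]
  have hint : IntervalIntegrable (fun x : ℝ => x ^ (β - 1)) volume 0 R :=
    intervalIntegral.intervalIntegrable_rpow' (by linarith)
  rw [setLIntegral_congr_fun measurableSet_Ioi h2, lintegral_indicator measurableSet_Iio,
    Measure.restrict_restrict measurableSet_Iio, Set.inter_comm, Ioi_inter_Iio,
    Measure.restrict_congr_set Ioo_ae_eq_Ioc, ← ofReal_integral_eq_lintegral_ofReal hint.1,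
    ← intervalIntegral.integral_of_le hR.le, integral_rpow (Or.inl (by linarith))]
  · simp [Real.zero_rpow hβ.ne']
  · filter_upwards [ae_restrict_mem measurableSet_Ioc] with y hy
    exact Real.rpow_nonneg hy.1.le _

/-- The Riesz kernel `|z - c| ^ (β - n)` on a set of finite measure. -/
lemma setLIntegral_rpow_le {n : ℕ} (hn : 0 < n) {β r : ℝ} (hβ : 0 < β) (hβn : β ≤ n) (hr : 0 < r)
    (c : EuclideanSpace ℝ (Fin n)) (H : Set (EuclideanSpace ℝ (Fin n))) :
    ∫⁻ z in H, ENNReal.ofReal (‖c - z‖ ^ (β - n)) ≤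
      ENNReal.ofReal (sphereArea n * (r ^ β / β)) + ENNReal.ofReal (r ^ (β - n)) * volume H := by
  have hm : MeasurableSet {z : EuclideanSpace ℝ (Fin n) | ‖c - z‖ < r} :=
    measurableSet_lt (by fun_prop) measurable_const
  rw [← lintegral_ball_rpow hn hβ hr c, ← lintegral_inter_add_sdiff _ H hm]
  refine add_le_add (lintegral_mono_set inter_subset_right) ?_
  calc _ ≤ ∫⁻ z in H \ {z | ‖c - z‖ < r}, ENNReal.ofReal (r ^ (β - n)) := by
        refine setLIntegral_mono measurable_const fun z hz => ENNReal.ofReal_le_ofReal ?_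
        exact Real.rpow_le_rpow_of_nonpos hr (not_lt.1 hz.2) (by linarith)
    _ ≤ _ := by
        rw [setLIntegral_const]
        gcongr
        exact sdiff_subset

/-- Beyond radius R the integrand is at most R^(-n), so the far part costs R^(-n) |H|, which is
bounded once |H| is of order R^n. Only the measure of H matters, not its shape. -/
lemma setLIntegral_rpow_neg_le {n : ℕ} (hn : 0 < n) {r R : ℝ} (hr : 0 < r) (hrR : r ≤ R)
    (c : EuclideanSpace ℝ (Fin n)) {H : Set (EuclideanSpace ℝ (Fin n))}
    (hH : ∀ z ∈ H, r ≤ ‖c - z‖) :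
    ∫⁻ z in H, ENNReal.ofReal (‖c - z‖ ^ (-(n : ℝ))) ≤
      ENNReal.ofReal (sphereArea n * Real.log (R / r)) +
        ENNReal.ofReal (R ^ (-(n : ℝ))) * volume H := by
  have hm : MeasurableSet {z : EuclideanSpace ℝ (Fin n) | ‖c - z‖ < R} :=
    measurableSet_lt (by fun_prop) measurable_const
  rw [← lintegral_annulus_rpow_neg hn hr hrR c, ← lintegral_inter_add_sdiff _ H hm]
  refine add_le_add (lintegral_mono_set fun z hz => ⟨hH z hz.1, hz.2⟩) ?_
  calc _ ≤ ∫⁻ z in H \ {z | ‖c - z‖ < R}, ENNReal.ofReal (R ^ (-(n : ℝ))) := by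
        refine setLIntegral_mono measurable_const fun z hz => ENNReal.ofReal_le_ofReal ?_
        exact Real.rpow_le_rpow_of_nonpos (hr.trans_le hrR) (not_lt.1 hz.2) (by simp)
    _ ≤ _ := by
        rw [setLIntegral_const]
        gcongr
        exact sdiff_subset

/-! ### Sets carrying the largest values of a function. -/

section Selection

variable {Y : Type*} [MeasurableSpace Y] {ν : Measure Y} [IsFiniteMeasure ν]

/-- The distribution function of a finite measure without atoms is continuous. -/
lemma continuous_measureReal_Iic (m : Measure ℝ) [IsFiniteMeasure m] [NullSingletonClass m] :
    Continuous fun r => m.real (Iic r) := by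
  have h1 : (fun r => m.real (Iic r)) = fun r => ∫ x, (Iic r).indicator (fun _ => (1 : ℝ)) x ∂m := by
    ext r
    rw [integral_indicator measurableSet_Iic]
    simp
  rw [h1, continuous_iff_continuousAt]
  intro r
  refine continuousAt_of_dominated (bound := fun _ => 1) ?_ ?_ (integrable_const _) ?_
  · exact Filter.Eventually.of_forall fun r =>
      (measurable_const.indicator measurableSet_Iic).aestronglyMeasurable
  · refine Filter.Eventually.of_forall fun r => Filter.Eventually.of_forall fun x => ?_
    by_cases h : x ∈ Iic r <;> simp [h]
  · have : ∀ᵐ x ∂m, x ≠ r := by simp [ae_iff]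
    filter_upwards [this] with x hx
    rcases lt_or_gt_of_ne hx with h | h
    · refine continuousAt_const (y := (1 : ℝ)) |>.congr ?_
      filter_upwards [lt_mem_nhds h] with r' hr'
      simp [hr'.le]
    · refine continuousAt_const (y := (0 : ℝ)) |>.congr ?_
      filter_upwards [gt_mem_nhds h] with r' hr'
      simp [hr']

/-- Intermediate values of a finite measure all of whose level sets of `ρ` are null. -/
lemma exists_measurableSet_between {ρ : Y → ℝ} (hρ : Measurable ρ)
    (hρ0 : ∀ r, ν {y | ρ y = r} = 0) {A B : Set Y} (hA : MeasurableSet A) (hB : MeasurableSet B)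
    (hAB : A ⊆ B) {t : ℝ≥0∞} (hAt : ν A ≤ t) (htB : t ≤ ν B) :
    ∃ F, MeasurableSet F ∧ A ⊆ F ∧ F ⊆ B ∧ ν F = t := by
  rcases hAt.eq_or_lt with h | hAt
  · exact ⟨A, hA, subset_rfl, hAB, h⟩
  rcases htB.eq_or_lt with h | htB
  · exact ⟨B, hB, hAB, subset_rfl, h.symm⟩
  have htt : t ≠ ∞ := (htB.trans (measure_lt_top _ _)).ne
  -- Since the level sets of ρ are null, the image under ρ of ν restricted to B \ A has no atoms.
  -- Its distribution function is then continuous, and the intermediate value theorem yields the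
  -- threshold r at which {ρ ≤ r} supplies the missing measure t - ν A.
  set m : Measure ℝ := (ν.restrict (B \ A)).map ρ with hm
  have hmr : ∀ r, m (Iic r) = ν ((B \ A) ∩ {y | ρ y ≤ r}) := fun r => by
    rw [hm, Measure.map_apply hρ measurableSet_Iic, Measure.restrict_apply (hρ measurableSet_Iic),
      inter_comm]
    rfl
  have hna : NullSingletonClass m := ⟨fun r => by
    rw [hm, Measure.map_apply hρ (measurableSet_singleton _)]
    exact le_antisymm ((Measure.restrict_apply_le _ _).trans (hρ0 r).le) bot_le⟩
  have hmu : m univ = ν (B \ A) := by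
    rw [hm, Measure.map_apply hρ MeasurableSet.univ]; simp
  have hsum : ν (B \ A) + ν A = ν B := by
    rw [add_comm, ← measure_union disjoint_sdiff_right (hB.diff hA), union_sdiff_cancel hAB]
  have hlt : t - ν A < m univ := by
    rw [hmu]
    refine ENNReal.sub_lt_of_lt_add hAt.le ?_
    rwa [hsum]
  obtain ⟨r₂, hr₂⟩ := ((tendsto_measure_Iic_atTop m).eventually_const_lt hlt).exists
  have hpos : 0 < t - ν A := tsub_pos_of_lt hAt
  obtain ⟨r₁, hr₁⟩ : ∃ r, m (Iic r) < t - ν A := by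
    have h1 : ⋂ r : ℝ, Iic r = (∅ : Set ℝ) := by
      ext x; simpa using ⟨x - 1, by linarith⟩
    have h2 := tendsto_measure_iInter_atBot (μ := m) (s := fun r : ℝ => Iic r)
      (fun r => measurableSet_Iic.nullMeasurableSet) (fun _ _ h => Iic_subset_Iic.2 h)
      ⟨0, measure_ne_top _ _⟩
    rw [h1, measure_empty] at h2
    exact (h2.eventually_lt_const hpos).exists
  have hne : t - ν A ≠ ∞ := ENNReal.sub_ne_top htt
  obtain ⟨r, hr⟩ := mem_range_of_exists_le_of_exists_ge (continuous_measureReal_Iic m)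
    (c := (t - ν A).toReal) ⟨r₁, ENNReal.toReal_mono hne hr₁.le⟩
    ⟨r₂, ENNReal.toReal_mono (measure_ne_top _ _) hr₂.le⟩
  have hr' : m (Iic r) = t - ν A := by
    simp only [measureReal_def] at hr
    rw [ENNReal.toReal_eq_toReal_iff' (measure_ne_top _ _) hne] at hr
    exact hr
  refine ⟨A ∪ ((B \ A) ∩ {y | ρ y ≤ r}), hA.union ((hB.diff hA).inter (hρ measurableSet_Iic)),
    subset_union_left, union_subset hAB (inter_subset_left.trans sdiff_subset), ?_⟩
  rw [measure_union _ ((hB.diff hA).inter (measurableSet_le hρ measurable_const)), ← hmr, hr',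
    add_tsub_cancel_of_le hAt.le]
  exact disjoint_sdiff_right.mono_right inter_subset_left

/-- A superlevel set of prescribed measure. -/
lemma exists_superlevel {ρ : Y → ℝ} (hρ : Measurable ρ)
    (hρ0 : ∀ r, ν {y | ρ y = r} = 0) {f : Y → ℝ≥0∞} (hf : Measurable f) (t : ℝ≥0∞) :
    ∃ F, MeasurableSet F ∧ ∃ h : ℝ≥0∞, ν F ≤ t ∧ (∀ y ∉ F, f y ≤ h) ∧ (∀ y ∈ F, h ≤ f y) ∧
      (h = 0 ∨ ν F = t) := by
  by_cases htu : ν univ ≤ t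
  · exact ⟨univ, MeasurableSet.univ, 0, htu, by simp, by simp, Or.inl rfl⟩
  push Not at htu
  -- At the critical height h = inf S the set {h < f} has measure at most t and {h ≤ f} at least t.
  -- A set of measure exactly t fits between them.
  set S : Set ℝ≥0∞ := {h | ν {y | h < f y} ≤ t} with hS
  have hSne : S.Nonempty := ⟨∞, by simp [hS]⟩
  set h := sInf S with hh
  have h1 : ν {y | h < f y} ≤ t := by
    obtain ⟨v, hv, hvt, hvS⟩ := exists_seq_tendsto_sInf hSne (OrderBot.bddBelow S)
    have : {y | h < f y} = ⋃ i, {y | v i < f y} := by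
      ext y
      simp only [mem_ofPred_eq, mem_iUnion]
      constructor
      · intro hy
        exact (hvt.eventually_lt_const hy).exists
      · rintro ⟨i, hi⟩
        exact (sInf_le (hvS i)).trans_lt hi
    rw [this, Monotone.measure_iUnion]
    · exact iSup_le fun i => hvS i
    · intro i j hij y hy
      exact (hv hij).trans_lt hy
  have h2 : t ≤ ν {y | h ≤ f y} := by
    rcases eq_or_ne h 0 with h0 | h0
    · simpa [h0] using htu.le
    obtain ⟨v, hv, hvm, hvt⟩ := exists_seq_strictMono_tendsto' (bot_lt_iff_ne_bot.2 h0)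
    have : {y | h ≤ f y} = ⋂ i, {y | v i < f y} := by
      ext y
      simp only [mem_ofPred_eq, mem_iInter]
      constructor
      · intro hy i
        exact (hvm i).2.trans_le hy
      · intro hy
        exact le_of_tendsto' hvt fun i => (hy i).le
    rw [this, Antitone.measure_iInter]
    · refine le_iInf fun i => ?_
      by_contra hcon
      exact absurd (sInf_le (show v i ∈ S from (not_le.1 hcon).le)) (not_le.2 (hvm i).2)
    · intro i j hij y hy
      exact (hv.monotone hij).trans_lt hy
    · exact fun i => (measurableSet_lt measurable_const hf).nullMeasurableSet
    · exact ⟨0, measure_ne_top _ _⟩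
  obtain ⟨F, hF, hF1, hF2, hF3⟩ := exists_measurableSet_between hρ hρ0
    (measurableSet_lt measurable_const hf) (measurableSet_le measurable_const hf)
    (fun y (hy : h < f y) => hy.le) h1 h2
  exact ⟨F, hF, h, hF3.le, fun y hy => not_lt.1 fun hy' => hy (hF1 hy'), fun y hy => hF2 hy,
    Or.inr hF3⟩

/-- A set of measure at most `t` carrying the largest values of `f`. -/
def IsTopSet (ν : Measure Y) (p : ℝ) (f : Y → ℝ≥0∞) (t : ℝ≥0∞) (F : Set Y) (h : ℝ≥0∞) : Prop :=
  MeasurableSet F ∧ ν F ≤ t ∧ (∀ y ∉ F, f y ≤ h) ∧ h ^ p * t ≤ ∫⁻ y in F, f y ^ p ∂ν ∧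
    ∀ F', MeasurableSet F' → ν F' ≤ t → ∫⁻ y in F', f y ^ p ∂ν ≤ ∫⁻ y in F, f y ^ p ∂ν

/-- Bathtub principle. Replacing F \ F' by F' \ F cannot raise the integral: f ≥ h on the former and
f ≤ h on the latter, whose measure is no larger when F has full measure t; if h = 0 the latter
contributes nothing. The function ρ serves to cut level sets of f of positive measure. -/
lemma exists_isTopSet {ρ : Y → ℝ} (hρ : Measurable ρ)
    (hρ0 : ∀ r, ν {y | ρ y = r} = 0) {f : Y → ℝ≥0∞} (hf : Measurable f) {p : ℝ} (hp : 0 < p)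
    (t : ℝ≥0∞) : ∃ F h, IsTopSet ν p f t F h := by
  obtain ⟨F, hF, h, hFt, hout, hin, hh⟩ := exists_superlevel hρ hρ0 hf t
  have hcst : ∀ W, MeasurableSet W → W ⊆ F → h ^ p * ν W ≤ ∫⁻ y in W, f y ^ p ∂ν := by
    intro W hW hWF
    rw [← setLIntegral_const]
    exact setLIntegral_mono' hW fun y hy => ENNReal.rpow_le_rpow (hin y (hWF hy)) hp.le
  refine ⟨F, h, hF, hFt, hout, ?_, fun F' hF' hF't => ?_⟩
  · rcases hh with rfl | hh
    · simp [ENNReal.zero_rpow_of_pos hp]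
    · rw [← hh]; exact hcst F hF subset_rfl
  · rw [← lintegral_inter_add_sdiff _ F' hF, ← lintegral_inter_add_sdiff _ F hF', inter_comm F F']
    gcongr 1
    calc ∫⁻ y in F' \ F, f y ^ p ∂ν ≤ ∫⁻ y in F' \ F, h ^ p ∂ν :=
          setLIntegral_mono' (hF'.diff hF) fun y hy => ENNReal.rpow_le_rpow (hout y hy.2) hp.le
      _ = h ^ p * ν (F' \ F) := setLIntegral_const _ _
      _ ≤ h ^ p * ν (F \ F') := by
          rcases hh with rfl | hh
          · simp [ENNReal.zero_rpow_of_pos hp]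
          · gcongr 1
            have h1 := measure_inter_add_sdiff (μ := ν) F' hF
            have h2 := measure_inter_add_sdiff (μ := ν) F hF'
            rw [inter_comm F F'] at h2
            have h3 : ν (F' ∩ F) + ν (F' \ F) ≤ ν (F' ∩ F) + ν (F \ F') := by
              rw [h1, h2, hh]; exact hF't
            exact (ENNReal.add_le_add_iff_left (measure_ne_top _ _)).1 h3
      _ ≤ _ := hcst _ (hF.diff hF') sdiff_subset

end Selection

/-! ### Splitting a potential at two scales. -/

section TwoScale

variable {X Y : Type*} [MeasurableSpace X] [MeasurableSpace Y] {μ : Measure X} {ν : Measure Y}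

lemma setLIntegral_mul_le_holder {p q : ℝ} (hpq : p.HolderConjugate q) {κ f : Y → ℝ≥0∞}
    (hκ : Measurable κ) (hf : Measurable f) (S : Set Y) :
    ∫⁻ y in S, κ y * f y ∂ν ≤
      (∫⁻ y in S, κ y ^ q ∂ν) ^ (1 / q) * (∫⁻ y in S, f y ^ p ∂ν) ^ (1 / p) :=
  ENNReal.lintegral_mul_le_Lp_mul_Lq _ hpq.symm hκ.aemeasurable hf.aemeasurable

lemma setLIntegral_le_holder {p q : ℝ} (hpq : p.HolderConjugate q) {f : Y → ℝ≥0∞}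
    (hf : Measurable f) (S : Set Y) :
    ∫⁻ y in S, f y ∂ν ≤ ν S ^ (1 / q) * (∫⁻ y in S, f y ^ p ∂ν) ^ (1 / p) := by
  simpa using setLIntegral_mul_le_holder (ν := ν) hpq (κ := fun _ => 1) measurable_const hf S

/-- Averaging over a set on which the potential is large. -/
lemma le_of_le_potential [SFinite μ] [SFinite ν] {p q : ℝ} (hpq : p.HolderConjugate q)
    {k : X → Y → ℝ≥0∞} (hk : Measurable (Function.uncurry k)) {f : Y → ℝ≥0∞} (hf : Measurable f)
    {C R s : ℝ≥0∞} {E : Set X} (hE : MeasurableSet E) (hE0 : μ E ≠ 0) (hEt : μ E ≠ ∞)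
    (hC : ∀ y, ∫⁻ x in E, k x y ∂μ ≤ C * μ E ^ (1 / p))
    (hs : ∀ x ∈ E, s ≤ ∫⁻ y, k x y * f y ∂ν) {F : Set Y} (hF : MeasurableSet F) (hFt : ν F ≤ μ E)
    (hR : ∀ x ∈ E, ∫⁻ y in Fᶜ, k x y * f y ∂ν ≤ R) :
    s ≤ C * (∫⁻ y in F, f y ^ p ∂ν) ^ (1 / p) + R := by
  have hkf : Measurable (Function.uncurry fun x y => k x y * f y) :=
    hk.mul (hf.comp measurable_snd)
  set φ := (∫⁻ y in F, f y ^ p ∂ν) ^ (1 / p)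
  have h1 : s * μ E ≤ ∫⁻ x in E, ∫⁻ y, k x y * f y ∂ν ∂μ := by
    rw [← setLIntegral_const]
    exact setLIntegral_mono' hE hs
  have h2 : ∫⁻ x in E, ∫⁻ y, k x y * f y ∂ν ∂μ =
      ∫⁻ x in E, ∫⁻ y in F, k x y * f y ∂ν ∂μ + ∫⁻ x in E, ∫⁻ y in Fᶜ, k x y * f y ∂ν ∂μ := by
    have hm : Measurable fun x => ∫⁻ y in F, k x y * f y ∂ν := hkf.lintegral_prod_right'
    rw [← lintegral_add_left hm]
    congr 1 with x
    exact (lintegral_add_compl _ hF).symm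
  -- On F the kernel is integrated in x first. Hölder for f on F, with ν F ≤ μ E, supplies μ E ^
  -- (1/q), which completes μ E ^ (1/p) to a full power.
  have h3 : ∫⁻ x in E, ∫⁻ y in F, k x y * f y ∂ν ∂μ ≤ C * φ * μ E := by
    rw [lintegral_lintegral_swap hkf.aemeasurable]
    calc ∫⁻ y in F, ∫⁻ x in E, k x y * f y ∂μ ∂ν
        = ∫⁻ y in F, (∫⁻ x in E, k x y ∂μ) * f y ∂ν := by
          congr 1 with y
          have hm : Measurable fun x => k x y := hk.comp (measurable_id.prodMk measurable_const)
          rw [lintegral_mul_const _ hm]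
      _ ≤ ∫⁻ y in F, C * μ E ^ (1 / p) * f y ∂ν := by
          gcongr with y; exact hC y
      _ = C * μ E ^ (1 / p) * ∫⁻ y in F, f y ∂ν := lintegral_const_mul _ hf
      _ ≤ C * μ E ^ (1 / p) * (μ E ^ (1 / q) * φ) := by
          gcongr
          refine (setLIntegral_le_holder hpq hf F).trans ?_
          gcongr
          exact one_div_nonneg.2 hpq.symm.nonneg
      _ = C * φ * (μ E ^ (1 / p) * μ E ^ (1 / q)) := by ring
      _ = C * φ * μ E := by
          rw [← ENNReal.rpow_add _ _ hE0 hEt]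
          have : 1 / p + 1 / q = 1 := by simpa using hpq.inv_add_inv_eq_one
          rw [this, ENNReal.rpow_one]
  have h4 : ∫⁻ x in E, ∫⁻ y in Fᶜ, k x y * f y ∂ν ∂μ ≤ R * μ E := by
    rw [← setLIntegral_const]
    exact setLIntegral_mono' hE hR
  have h5 : s * μ E ≤ (C * φ + R) * μ E := by
    rw [add_mul]; exact h1.trans (h2 ▸ add_le_add h3 h4)
  exact (ENNReal.mul_le_mul_iff_left hE0 hEt).1 h5

/-- The contribution of the complement of a top set, split at two scales. -/
lemma setLIntegral_compl_topSet_le {p q : ℝ} (hpq : p.HolderConjugate q) {κ f : Y → ℝ≥0∞}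
    (hκ : Measurable κ) (hf : Measurable f) {C t₁ t₂ h₁ h₂ : ℝ≥0∞} {F₁ F₂ G₁ G₂ : Set Y}
    (hF₁ : IsTopSet ν p f t₁ F₁ h₁) (hF₂ : IsTopSet ν p f t₂ F₂ h₂) (ht : t₂ ≤ t₁)
    (hGm₁ : MeasurableSet G₁) (hGm₂ : MeasurableSet G₂)
    (hG₁ : ∫⁻ y in G₁, κ y ∂ν ≤ C * t₁ ^ (1 / p)) (hG₂ : ∫⁻ y in G₂, κ y ∂ν ≤ C * t₂ ^ (1 / p)) :
    ∫⁻ y in F₂ᶜ, κ y * f y ∂ν ≤ 2 * C * (∫⁻ y in F₁, f y ^ p ∂ν) ^ (1 / p) +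
      (∫⁻ y in G₁ᶜ, κ y ^ q ∂ν) ^ (1 / q) * (∫⁻ y in F₁ᶜ, f y ^ p ∂ν) ^ (1 / p) +
      (∫⁻ y in F₁ \ G₂, κ y ^ q ∂ν) ^ (1 / q) * (∫⁻ y in F₁, f y ^ p ∂ν) ^ (1 / p) := by
  have hp := hpq.pos
  have hq := hpq.symm.pos
  -- Off a top set f is at most its threshold h, and h t^(1/p) is controlled by the mass of f on the
  -- top set. The L¹ bound for κ near its singularities then suffices.
  have hlow : ∀ {t h : ℝ≥0∞} {F G : Set Y}, IsTopSet ν p f t F h → MeasurableSet G →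
      ∫⁻ y in G, κ y ∂ν ≤ C * t ^ (1 / p) →
      ∫⁻ y in Fᶜ ∩ G, κ y * f y ∂ν ≤ C * (∫⁻ y in F, f y ^ p ∂ν) ^ (1 / p) := by
    intro t h F G hF hGm hG
    calc ∫⁻ y in Fᶜ ∩ G, κ y * f y ∂ν ≤ ∫⁻ y in Fᶜ ∩ G, κ y * h ∂ν := by
          refine setLIntegral_mono' (hF.1.compl.inter hGm) fun y hy => ?_
          gcongr
          exact hF.2.2.1 y hy.1
      _ ≤ ∫⁻ y in G, κ y * h ∂ν := lintegral_mono_set inter_subset_right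
      _ = (∫⁻ y in G, κ y ∂ν) * h := lintegral_mul_const _ hκ
      _ ≤ C * t ^ (1 / p) * h := by gcongr
      _ = C * (h ^ p * t) ^ (1 / p) := by
          rw [ENNReal.mul_rpow_of_nonneg _ _ (by positivity), ← ENNReal.rpow_mul,
            mul_one_div_cancel hp.ne', ENNReal.rpow_one]
          ring
      _ ≤ _ := by
          gcongr
          exact hF.2.2.2.1
  -- The first two pieces are estimated by `hlow`, at scales 2 and 1. The third pairs the main mass
  -- of κ ^ q with what f has left outside F₁; the fourth meets only the part of κ ^ q between the
  -- two scales. The last two use Hölder.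
  have hsub : F₂ᶜ ⊆ (((F₂ᶜ ∩ G₂) ∪ (F₁ᶜ ∩ G₁)) ∪ (F₁ᶜ ∩ G₁ᶜ)) ∪ (F₁ \ G₂) := by
    intro y hy
    by_cases h1 : y ∈ F₁ <;> by_cases h2 : y ∈ G₁ <;> by_cases h3 : y ∈ G₂ <;> simp_all
  have hφ : ∫⁻ y in F₂, f y ^ p ∂ν ≤ ∫⁻ y in F₁, f y ^ p ∂ν :=
    hF₁.2.2.2.2 F₂ hF₂.1 (hF₂.2.1.trans ht)
  calc ∫⁻ y in F₂ᶜ, κ y * f y ∂ν ≤ ∫⁻ y in F₂ᶜ ∩ G₂, κ y * f y ∂ν +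
        ∫⁻ y in F₁ᶜ ∩ G₁, κ y * f y ∂ν + ∫⁻ y in F₁ᶜ ∩ G₁ᶜ, κ y * f y ∂ν +
        ∫⁻ y in F₁ \ G₂, κ y * f y ∂ν := by
        refine (lintegral_mono_set hsub).trans ((lintegral_union_le _ _ _).trans ?_)
        gcongr
        refine (lintegral_union_le _ _ _).trans ?_
        gcongr
        exact lintegral_union_le _ _ _
    _ ≤ C * (∫⁻ y in F₁, f y ^ p ∂ν) ^ (1 / p) + C * (∫⁻ y in F₁, f y ^ p ∂ν) ^ (1 / p) +
        (∫⁻ y in G₁ᶜ, κ y ^ q ∂ν) ^ (1 / q) * (∫⁻ y in F₁ᶜ, f y ^ p ∂ν) ^ (1 / p) +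
        (∫⁻ y in F₁ \ G₂, κ y ^ q ∂ν) ^ (1 / q) * (∫⁻ y in F₁, f y ^ p ∂ν) ^ (1 / p) := by
        gcongr ?_ + ?_ + ?_ + ?_
        · refine (hlow hF₂ hGm₂ hG₂).trans ?_
          gcongr
        · exact hlow hF₁ hGm₁ hG₁
        · refine (setLIntegral_mul_le_holder hpq hκ hf _).trans ?_
          gcongr
          · exact inter_subset_right
          · exact inter_subset_left
        · refine (setLIntegral_mul_le_holder hpq hκ hf _).trans ?_
          gcongr
          exact sdiff_subset
    _ = _ := by ring

end TwoScale

/-! ### The discrete Adams–Garsia–Moser lemma. -/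

section Moser

lemma rpow_holder_two {p q : ℝ} (hpq : p.HolderConjugate q) {a b c e : ℝ} (ha : 0 ≤ a)
    (hb : 0 ≤ b) (hc : 0 ≤ c) (he : 0 ≤ e) :
    a ^ (1 / q) * b ^ (1 / p) + c ^ (1 / q) * e ^ (1 / p) ≤
      (a + c) ^ (1 / q) * (b + e) ^ (1 / p) := by
  have hp := hpq.pos.ne'
  have hq := hpq.symm.pos.ne'
  have h := Real.inner_le_Lp_mul_Lq_of_nonneg (Finset.univ : Finset (Fin 2)) hpq.symm
    (f := ![a ^ (1 / q), c ^ (1 / q)]) (g := ![b ^ (1 / p), e ^ (1 / p)])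
    (by intro i _; fin_cases i <;> simp <;> positivity)
    (by intro i _; fin_cases i <;> simp <;> positivity)
  simpa [Fin.sum_univ_two, ← Real.rpow_mul, ha, hb, hc, he, hp, hq] using h

lemma le_mul_rpow_of_rpow_le {p q : ℝ} (hpq : p.HolderConjugate q) {m Z W : ℝ} (hm : 0 ≤ m)
    (hZ : 0 ≤ Z) (hW : 0 ≤ W) (h : m ^ (1 / q) ≤ Z ^ (1 / q) * W ^ (1 / p)) :
    m ≤ Z * W ^ (q - 1) := by
  have hq := hpq.symm.pos
  have h1 := Real.rpow_le_rpow (by positivity) h hq.le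
  rw [Real.mul_rpow (by positivity) (by positivity), ← Real.rpow_mul hm, ← Real.rpow_mul hZ,
    ← Real.rpow_mul hW, one_div_mul_cancel hq.ne', Real.rpow_one, Real.rpow_one] at h1
  convert h1 using 3
  have hp := hpq.pos.ne'
  have hq' := hq.ne'
  have h2 := hpq.inv_add_inv_eq_one
  field_simp at h2 ⊢
  linarith

/-- In the second term φ is replaced by φ / 2 at the expense of a larger D. Two-term Hölder then
produces the weight 1 - φ + φ / 2, which is below 1 as soon as φ > 0; this gain is what later bounds
φ. -/
lemma one_scale_bound {p q : ℝ} (hpq : p.HolderConjugate q) {D T φ m : ℝ} (hD : 0 ≤ D)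
    (hT : 0 ≤ T) (hφ : 0 ≤ φ) (hφ1 : φ ≤ 1) (hm : 0 ≤ m)
    (h : m ^ (1 / q) ≤ T ^ (1 / q) * (1 - φ) ^ (1 / p) + D * φ ^ (1 / p)) :
    m ≤ (T + (D * 2 ^ (1 / p)) ^ q) * (1 - φ / 2) ^ (q - 1) := by
  have hq := hpq.symm.pos
  have hp := hpq.pos
  refine le_mul_rpow_of_rpow_le hpq hm (by positivity) (by linarith) (h.trans ?_)
  have h1 := rpow_holder_two hpq hT (b := 1 - φ) (by linarith) (c := (D * 2 ^ (1 / p)) ^ q)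
    (by positivity) (e := φ / 2) (by positivity)
  have h2 : ((D * 2 ^ (1 / p)) ^ q) ^ (1 / q) * (φ / 2) ^ (1 / p) = D * φ ^ (1 / p) := by
    rw [← Real.rpow_mul (by positivity), mul_one_div_cancel hq.ne', Real.rpow_one,
      Real.div_rpow hφ (by norm_num)]
    field_simp
  rw [h2] at h1
  rwa [show 1 - φ + φ / 2 = 1 - φ / 2 by ring] at h1

/-- The factor (1 - φ/2)^(q-1) ≤ e^(-(q-1)φ/2) must still leave room for m ≥ T - k below T + O(1).
Hence φ is O(k / T): at a level where T barely exceeds m, the top set carries little mass. -/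
lemma mul_le_of_one_scale {p q : ℝ} (hpq : p.HolderConjugate q) {D T φ m k : ℝ} (hD : 0 ≤ D)
    (hT : 0 ≤ T) (hφ : 0 ≤ φ) (hφ1 : φ ≤ 1) (hm : 0 ≤ m) (hk : 1 ≤ k)
    (h : m ^ (1 / q) ≤ T ^ (1 / q) * (1 - φ) ^ (1 / p) + D * φ ^ (1 / p)) (hTm : T ≤ m + k) :
    φ * T ≤ (((D * 2 ^ (1 / p)) ^ q + 1) / ((q - 1) / 2) + 1) * k := by
  have h1 := one_scale_bound hpq hD hT hφ hφ1 hm h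
  have hq1 : 0 < q - 1 := by linarith [hpq.symm.lt]
  set D' := (D * 2 ^ (1 / p)) ^ q with hD'
  have hD0 : 0 ≤ D' := by positivity
  set r := (q - 1) / 2 with hr
  have hr0 : 0 < r := by positivity
  have hk0 : 0 ≤ (D' + 1) / r * k := by positivity
  rcases le_or_gt T k with hTk | hTk
  · nlinarith
  have h2 : (1 - φ / 2) ^ (q - 1) ≤ Real.exp (-(r * φ)) := by
    have := Real.rpow_le_rpow (by linarith) (Real.one_sub_le_exp_neg (φ / 2)) hq1.le
    rw [← Real.exp_mul] at this
    convert this using 2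
    rw [hr]; ring
  have h3 : T - k ≤ (T + D') * Real.exp (-(r * φ)) :=
    (by linarith : T - k ≤ m).trans (h1.trans (by gcongr))
  have h4 : (T - k) * (1 + r * φ) ≤ T + D' := by
    calc (T - k) * (1 + r * φ) ≤ (T - k) * Real.exp (r * φ) := by
          refine mul_le_mul_of_nonneg_left ?_ (by linarith)
          linarith [Real.add_one_le_exp (r * φ)]
      _ ≤ (T + D') * Real.exp (-(r * φ)) * Real.exp (r * φ) := by gcongr
      _ = T + D' := by rw [mul_assoc, ← Real.exp_add]; simp
  have h5 : r * (φ * T) ≤ (D' + 1 + r) * k := by nlinarith [mul_nonneg hr0.le (by linarith : 0 ≤ k)]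
  have h6 : ((D' + 1) / r + 1) * k = (D' + 1 + r) * k / r := by field_simp
  rw [h6, le_div_iff₀ hr0]
  linarith

/-- The weights in Hölder's inequality are chosen so that Δ + 1 enters with coefficient 1/2. The
price is the factor (1 - φ + D'φ)^(q-1), which is 1 + O(k / T) because φ T = O(k). Comparison with T
+ Δ - k ≤ m then leaves Δ = O(k). -/
lemma gap_le_of_two_scale {p q : ℝ} (hpq : p.HolderConjugate q) {D T Δ φ m k C : ℝ} (hD : 0 ≤ D)
    (hT : 0 < T) (hΔ : 0 ≤ Δ) (hφ : 0 ≤ φ) (hφ1 : φ ≤ 1) (hm : 0 ≤ m) (hk : 1 ≤ k) (hC : 0 ≤ C)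
    (h : m ^ (1 / q) ≤ T ^ (1 / q) * (1 - φ) ^ (1 / p) + D * (Δ + 1) ^ (1 / q) * φ ^ (1 / p))
    (hTm : T + Δ ≤ m + k) (hφT : φ * T ≤ C * k)
    (hTk : 8 * ((q - 1) * (D * 2 ^ (1 / q)) ^ p * C) * k ≤ T) :
    Δ ≤ 8 * (1 + (q - 1) * (D * 2 ^ (1 / q)) ^ p * C) * k := by
  have hq := hpq.symm.pos
  have hp := hpq.pos
  have hq1 : 0 < q - 1 := by linarith [hpq.symm.lt]
  set D' := (D * 2 ^ (1 / q)) ^ p with hD'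
  have hD0 : 0 ≤ D' := by positivity
  have h1 : m ≤ (T + (Δ + 1) / 2) * (1 - φ + D' * φ) ^ (q - 1) := by
    refine le_mul_rpow_of_rpow_le hpq hm (by positivity) (by nlinarith) (h.trans ?_)
    have h1 := rpow_holder_two hpq hT.le (b := 1 - φ) (by linarith) (c := (Δ + 1) / 2)
      (by positivity) (e := D' * φ) (by positivity)
    have h2 : ((Δ + 1) / 2) ^ (1 / q) * (D' * φ) ^ (1 / p) =
        D * (Δ + 1) ^ (1 / q) * φ ^ (1 / p) := by
      rw [Real.mul_rpow hD0 hφ, hD', ← Real.rpow_mul (by positivity), mul_one_div_cancel hp.ne',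
        Real.rpow_one, Real.div_rpow (by positivity) (by norm_num)]
      field_simp
    rwa [h2] at h1
  set c := (q - 1) * D' * C with hc
  have hc0 : 0 ≤ c := by positivity
  have h2 : (1 - φ + D' * φ) ^ (q - 1) ≤ 1 + 2 * (c * k / T) := by
    have hX1 : c * k / T ≤ 1 := by
      rw [div_le_one hT]
      nlinarith [mul_nonneg hc0 (by linarith : 0 ≤ k)]
    have hX0 : 0 ≤ c * k / T := by positivity
    have h3 : 1 - φ + D' * φ ≤ Real.exp (D' * φ) := by
      linarith [Real.add_one_le_exp (D' * φ)]
    have h4 := Real.rpow_le_rpow (by nlinarith) h3 hq1.le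
    rw [← Real.exp_mul] at h4
    have h5 : D' * φ * (q - 1) ≤ c * k / T := by
      rw [le_div_iff₀ hT, hc]
      calc D' * φ * (q - 1) * T = (q - 1) * D' * (φ * T) := by ring
        _ ≤ (q - 1) * D' * (C * k) := by gcongr
        _ = _ := by ring
    have h6 := Real.abs_exp_sub_one_le (x := c * k / T) (by rwa [abs_of_nonneg hX0])
    rw [abs_of_nonneg hX0] at h6
    have h7 := Real.exp_le_exp.2 h5
    linarith [le_abs_self (Real.exp (c * k / T) - 1)]
  have h3 : T + Δ - k ≤ (T + (Δ + 1) / 2) * (1 + 2 * (c * k / T)) :=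
    (by linarith : T + Δ - k ≤ m).trans (h1.trans (by gcongr))
  have h4 : (T + (Δ + 1) / 2) * (1 + 2 * (c * k / T)) =
      T + (Δ + 1) / 2 + 2 * (c * k) + (Δ + 1) * (c * k / T) := by field_simp; ring
  -- The lower bound on T is needed here: the cross term takes at most 1/8 of Δ + 1, so a positive
  -- share of Δ survives on the left.
  have h5 : c * k / T ≤ 1 / 8 := by
    rw [div_le_iff₀ hT]; linarith
  have h6 : (Δ + 1) * (c * k / T) ≤ (Δ + 1) * (1 / 8) := by gcongr
  have h7 : 0 ≤ c * k := by positivity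
  have h8 : 8 * (1 + c) * k = 8 * k + 8 * (c * k) := by ring
  rw [h8]
  linarith

/-- The levels at which `T m` exceeds `m` by at most `k` number at most a multiple of `k`. -/
lemma exists_finset_levels {p q : ℝ} (hpq : p.HolderConjugate q) {D : ℝ} (hD : 0 ≤ D) :
    ∃ N : ℕ, ∀ (S : Set ℕ) (T φ : ℕ → ℝ), (∀ m, 0 < T m) → (∀ m, 0 ≤ φ m ∧ φ m ≤ 1) →
      (∀ m₁ m₂, m₁ ≤ m₂ → m₂ ∈ S → T m₁ ≤ T m₂ ∧ (m₂ : ℝ) ^ (1 / q) ≤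
        T m₁ ^ (1 / q) * (1 - φ m₁) ^ (1 / p) +
          D * (T m₂ - T m₁ + 1) ^ (1 / q) * φ m₁ ^ (1 / p)) →
      ∀ k : ℕ, 1 ≤ k → ∃ F : Finset ℕ, {m ∈ S | T m ≤ m + k} ⊆ F ∧ F.card ≤ N * k := by
  have hq := hpq.symm.pos
  have hp := hpq.pos
  have hq1 : 0 < q - 1 := by linarith [hpq.symm.lt]
  set D' := (D * 2 ^ (1 / p)) ^ q with hD'
  have hD0 : 0 ≤ D' := by positivity
  set C₁ := (D' + 1) / ((q - 1) / 2) + 1 with hC₁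
  have hC₁0 : 0 ≤ C₁ := by positivity
  set C₂ := (q - 1) * (D * 2 ^ (1 / q)) ^ p * C₁ with hC₂
  have hC₂0 : 0 ≤ C₂ := by positivity
  -- The first summand counts the levels with T m ≤ 8 C₂ k, which lie below (8 C₂ + D') k because m
  -- ≤ T m + D'. The second counts an interval starting at the first remaining level. The extra ones
  -- are absorbed by k ≥ 1.
  refine ⟨⌈8 * C₂ + D'⌉₊ + 1 + (⌈1 + 8 * (1 + C₂) + D'⌉₊ + 1), fun S T φ hT hφ H k hk => ?_⟩
  have hk' : (1 : ℝ) ≤ k := by exact_mod_cast hk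
  have h1 : ∀ m ∈ S, (m : ℝ) ^ (1 / q) ≤
      T m ^ (1 / q) * (1 - φ m) ^ (1 / p) + D * φ m ^ (1 / p) := fun m hm => by
    simpa using (H m m le_rfl hm).2
  have hup : ∀ m ∈ S, (m : ℝ) ≤ T m + D' := fun m hm => by
    refine (one_scale_bound hpq hD (hT m).le (hφ m).1 (hφ m).2 m.cast_nonneg (h1 m hm)).trans ?_
    refine mul_le_of_le_one_right (by have := hT m; positivity) ?_
    exact Real.rpow_le_one (by linarith [(hφ m).2]) (by linarith [(hφ m).1]) hq1.le
  have hceil : ∀ c : ℝ, 0 ≤ c → ∀ m : ℕ, (m : ℝ) ≤ c * k → m ≤ ⌈c⌉₊ * k := fun c hc m hm => by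
    have : (m : ℝ) ≤ (⌈c⌉₊ * k : ℕ) := by
      push_cast
      refine hm.trans ?_
      gcongr
      exact Nat.le_ceil c
    exact_mod_cast this
  have hsmall : ∀ m ∈ S, T m ≤ 8 * C₂ * k → m ∈ Finset.range (⌈8 * C₂ + D'⌉₊ * k + 1) := by
    intro m hm hTm
    rw [Finset.mem_range, Nat.lt_succ_iff]
    refine hceil _ (by positivity) _ ?_
    nlinarith [hup m hm]
  by_cases hne : ({m ∈ S | T m ≤ m + k ∧ 8 * C₂ * k < T m}).Nonempty
  -- From the least remaining level m₁ on, the gap T m - T m₁ is O(k) by `gap_le_of_two_scale`.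
  -- Hence m ≤ T m + D' ≤ T m₁ + O(k) ≤ m₁ + O(k).
  · set m₁ := sInf {m ∈ S | T m ≤ m + k ∧ 8 * C₂ * k < T m} with hm₁
    obtain ⟨hm₁S, hm₁k, hm₁T⟩ := Nat.sInf_mem hne
    rw [← hm₁] at hm₁S hm₁k hm₁T
    refine ⟨Finset.range (⌈8 * C₂ + D'⌉₊ * k + 1) ∪
      Finset.Icc m₁ (m₁ + ⌈1 + 8 * (1 + C₂) + D'⌉₊ * k), ?_, ?_⟩
    · rintro m ⟨hmS, hmk⟩
      rw [Finset.coe_union]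
      rcases le_or_gt (T m) (8 * C₂ * k) with hs | hs
      · exact Or.inl (hsmall m hmS hs)
      · right
        have hle : m₁ ≤ m := Nat.sInf_le ⟨hmS, hmk, hs⟩
        obtain ⟨hmono, hineq⟩ := H m₁ m hle hmS
        have hφT := mul_le_of_one_scale hpq hD (hT m₁).le (hφ m₁).1 (hφ m₁).2 m₁.cast_nonneg hk'
          (h1 m₁ hm₁S) hm₁k
        have hgap := gap_le_of_two_scale hpq hD (hT m₁) (sub_nonneg.2 hmono) (hφ m₁).1 (hφ m₁).2
          m.cast_nonneg hk' hC₁0 hineq (by linarith) hφT hm₁T.le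
        rw [← hC₂] at hgap
        have h3 : m - m₁ ≤ ⌈1 + 8 * (1 + C₂) + D'⌉₊ * k := by
          refine hceil _ (by positivity) _ ?_
          rw [Nat.cast_sub hle]
          nlinarith [hup m hmS]
        rw [Finset.coe_Icc]
        exact ⟨hle, by omega⟩
    · refine (Finset.card_union_le _ _).trans ?_
      rw [Finset.card_range, Nat.card_Icc]
      generalize ⌈8 * C₂ + D'⌉₊ = a
      generalize ⌈1 + 8 * (1 + C₂) + D'⌉₊ = b
      have : m₁ + b * k + 1 - m₁ = b * k + 1 := by omega
      rw [this]
      nlinarith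
  · refine ⟨Finset.range (⌈8 * C₂ + D'⌉₊ * k + 1), ?_, ?_⟩
    · rintro m ⟨hmS, hmk⟩
      refine hsmall m hmS (not_lt.1 fun h => hne ⟨m, hmS, hmk, h⟩)
    · rw [Finset.card_range]
      generalize ⌈8 * C₂ + D'⌉₊ = a
      nlinarith [Nat.zero_le (⌈1 + 8 * (1 + C₂) + D'⌉₊ * k)]

/-- A discrete form of the Adams–Garsia–Moser lemma. -/
lemma exists_tsum_exp_le {p q : ℝ} (hpq : p.HolderConjugate q) {D : ℝ} (hD : 0 ≤ D) :
    ∃ C : ℝ≥0, ∀ (S : Set ℕ) (T φ : ℕ → ℝ), (∀ m, 0 < T m) → (∀ m, 0 ≤ φ m ∧ φ m ≤ 1) →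
      (∀ m₁ m₂, m₁ ≤ m₂ → m₂ ∈ S → T m₁ ≤ T m₂ ∧ (m₂ : ℝ) ^ (1 / q) ≤
        T m₁ ^ (1 / q) * (1 - φ m₁) ^ (1 / p) +
          D * (T m₂ - T m₁ + 1) ^ (1 / q) * φ m₁ ^ (1 / p)) →
      ∑' m : ℕ, S.indicator (fun m => ENNReal.ofReal (Real.exp (m - T m))) m ≤ C := by
  have hq := hpq.symm.pos
  have hp := hpq.pos
  have hq1 : 0 < q - 1 := by linarith [hpq.symm.lt]
  obtain ⟨N, hN⟩ := exists_finset_levels hpq hD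
  set D' := (D * 2 ^ (1 / p)) ^ q with hD'
  have hD0 : 0 ≤ D' := by positivity
  have hsum : Summable fun k : ℕ => Real.exp (D' + 1) * N * ((k : ℝ) ^ 1 * Real.exp (-(1 : ℝ)) ^ k) := by
    refine Summable.mul_left _ (summable_pow_mul_geometric_of_norm_lt_one 1 ?_)
    rw [Real.norm_eq_abs, abs_of_pos (Real.exp_pos _), Real.exp_lt_one_iff]
    norm_num
  set b : ℕ → ℝ := fun k => Real.exp (D' + 1) * N * ((k : ℝ) ^ 1 * Real.exp (-(1 : ℝ)) ^ k) with hb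
  refine ⟨(∑' k, b k).toNNReal, fun S T φ hT hφ H => ?_⟩
  have h1 : ∀ m ∈ S, (m : ℝ) ≤ T m + D' := fun m hm => by
    refine (one_scale_bound hpq hD (hT m).le (hφ m).1 (hφ m).2 m.cast_nonneg
      (by simpa using (H m m le_rfl hm).2)).trans ?_
    refine mul_le_of_le_one_right (by have := hT m; positivity) ?_
    exact Real.rpow_le_one (by linarith [(hφ m).2]) (by linarith [(hφ m).1]) hq1.le
  -- Level m is charged to k = max 1 ⌈T m - m⌉. If k > 1, then k < T m - m + 1; if k = 1, the bound
  -- m ≤ T m + D' is used instead. In both cases e^(m - T m) ≤ c k.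
  set c : ℕ → ℝ≥0∞ := fun k => if k = 0 then 0 else ENNReal.ofReal (Real.exp (D' + 1 - k)) with hc
  set E : ℕ → Set ℕ := fun k => {m ∈ S | T m ≤ m + k} with hE
  have h2 : ∀ m, S.indicator (fun m => ENNReal.ofReal (Real.exp (m - T m))) m ≤
      ∑' k, (E k).indicator (fun _ => c k) m := by
    intro m
    by_cases hm : m ∈ S
    · rw [indicator_of_mem hm]
      set k := max 1 ⌈T m - m⌉₊ with hk
      have hk1 : 1 ≤ k := le_max_left _ _
      have hkm : m ∈ E k := ⟨hm, by
        have h3 : T m - m ≤ ⌈T m - m⌉₊ := Nat.le_ceil _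
        have h4 : ((⌈T m - m⌉₊ : ℕ) : ℝ) ≤ k := by exact_mod_cast le_max_right _ _
        linarith⟩
      refine le_trans ?_ (ENNReal.le_tsum k)
      have hk0 : k ≠ 0 := by omega
      simp only [indicator_of_mem hkm, hc, if_neg hk0]
      refine ENNReal.ofReal_le_ofReal (Real.exp_le_exp.2 ?_)
      rcases le_or_gt ⌈T m - m⌉₊ 1 with h5 | h5
      · have : k = 1 := max_eq_left h5
        rw [this]; push_cast; linarith [h1 m hm]
      · have : k = ⌈T m - m⌉₊ := max_eq_right h5.le
        have h6 : 0 < T m - m := by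
          by_contra hcon
          rw [Nat.ceil_eq_zero.2 (not_lt.1 hcon)] at h5
          omega
        have h7 := Nat.ceil_lt_add_one h6.le
        rw [← this] at h7
        linarith
    · rw [indicator_of_notMem hm]; exact bot_le
  calc _ ≤ ∑' m, ∑' k, (E k).indicator (fun _ => c k) m := ENNReal.tsum_le_tsum h2
    _ = ∑' k, ∑' m, (E k).indicator (fun _ => c k) m := ENNReal.tsum_comm
    _ ≤ ∑' k, ENNReal.ofReal (b k) := by
        refine ENNReal.tsum_le_tsum fun k => ?_
        rcases Nat.eq_zero_or_pos k with rfl | hk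
        · simp [hc]
        obtain ⟨F, hF, hFc⟩ := hN S T φ hT hφ H k hk
        calc ∑' m, (E k).indicator (fun _ => c k) m
            ≤ ∑' m, (F : Set ℕ).indicator (fun _ => c k) m :=
              ENNReal.tsum_le_tsum fun m => indicator_le_indicator_of_subset hF (fun _ => bot_le) m
          _ = ∑ m ∈ F, c k := (sum_eq_tsum_indicator _ _).symm
          _ = F.card * c k := by simp
          _ ≤ (N * k : ℕ) * c k := by gcongr
          _ = ENNReal.ofReal (b k) := by
              simp only [hc, hk.ne', if_false, hb]
              rw [← ENNReal.ofReal_natCast, ← ENNReal.ofReal_mul (by positivity)]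
              congr 1
              rw [← Real.exp_nat_mul, sub_eq_add_neg, Real.exp_add]
              push_cast
              ring_nf
    _ = ((∑' k, b k).toNNReal : ℝ≥0∞) := by
        rw [← ENNReal.ofReal_tsum_of_nonneg (fun k => by positivity) hsum]
        rfl

end Moser

/-! ### From kernel estimates to summable level sets. -/

section Levels

variable {X Y : Type*} [MeasurableSpace X] [MeasurableSpace Y] {μ : Measure X} {ν : Measure Y}

/-- The two-scale inequality for the level sets of a potential. -/
lemma potential_two_scale [IsFiniteMeasure μ] [IsFiniteMeasure ν] {p q : ℝ}
    (hpq : p.HolderConjugate q) {k : X → Y → ℝ≥0∞} (hk : Measurable (Function.uncurry k))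
    {C s t₁ t₂ a b : ℝ} (hC : 0 ≤ C) (ha : 0 ≤ a) (hb : 0 ≤ b)
    {f : Y → ℝ≥0∞} (hf : Measurable f) (hf1 : ∫⁻ y, f y ^ p ∂ν = 1)
    {E : Set X} (hE : MeasurableSet E) (hEt : μ E = ENNReal.ofReal t₂)
    (ht₂ : 0 < t₂) (ht : t₂ ≤ t₁)
    (hsE : ∀ x ∈ E, ENNReal.ofReal s ≤ ∫⁻ y, k x y * f y ∂ν)
    (h1 : ∀ y, ∫⁻ x in E, k x y ∂μ ≤ ENNReal.ofReal C * μ E ^ (1 / p))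
    {G₁ G₂ : X → Set Y} (hG₁ : ∀ x, MeasurableSet (G₁ x)) (hG₂ : ∀ x, MeasurableSet (G₂ x))
    (h2₁ : ∀ x, ∫⁻ y in G₁ x, k x y ∂ν ≤ ENNReal.ofReal C * ENNReal.ofReal t₁ ^ (1 / p))
    (h2₂ : ∀ x, ∫⁻ y in G₂ x, k x y ∂ν ≤ ENNReal.ofReal C * ENNReal.ofReal t₂ ^ (1 / p))
    (h3 : ∀ x, ∫⁻ y in (G₁ x)ᶜ, k x y ^ q ∂ν ≤ ENNReal.ofReal a)
    {F₁ F₂ : Set Y} {e₁ e₂ : ℝ≥0∞}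
    (hF₁ : IsTopSet ν p f (ENNReal.ofReal t₁) F₁ e₁)
    (hF₂ : IsTopSet ν p f (ENNReal.ofReal t₂) F₂ e₂)
    (h4 : ∀ x, ∫⁻ y in F₁ \ G₂ x, k x y ^ q ∂ν ≤ ENNReal.ofReal b) :
    s ≤ a ^ (1 / q) * (1 - (∫⁻ y in F₁, f y ^ p ∂ν).toReal) ^ (1 / p) +
      (3 * C + b ^ (1 / q)) * (∫⁻ y in F₁, f y ^ p ∂ν).toReal ^ (1 / p) := by
  have hp := hpq.pos
  have hq := hpq.symm.pos
  have hle1 : ∫⁻ y in F₁, f y ^ p ∂ν ≤ 1 := hf1 ▸ setLIntegral_le_lintegral _ _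
  have hne : ∫⁻ y in F₁, f y ^ p ∂ν ≠ ∞ := ne_top_of_le_ne_top ENNReal.one_ne_top hle1
  set φ := (∫⁻ y in F₁, f y ^ p ∂ν).toReal with hφ
  have hφ' : ∫⁻ y in F₁, f y ^ p ∂ν = ENNReal.ofReal φ := (ENNReal.ofReal_toReal hne).symm
  have hφ0 : 0 ≤ φ := ENNReal.toReal_nonneg
  have hφ1 : φ ≤ 1 := by
    have := ENNReal.toReal_mono ENNReal.one_ne_top hle1
    simpa using this
  have hcompl : ∫⁻ y in F₁ᶜ, f y ^ p ∂ν = ENNReal.ofReal (1 - φ) := by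
    have h := lintegral_add_compl (μ := ν) (fun y => f y ^ p) hF₁.1
    rw [hf1, hφ'] at h
    rw [ENNReal.ofReal_sub _ hφ0, ENNReal.ofReal_one, ← h]
    exact (ENNReal.add_sub_cancel_left ENNReal.ofReal_ne_top).symm
  have hφ2 : ∫⁻ y in F₂, f y ^ p ∂ν ≤ ENNReal.ofReal φ :=
    hφ' ▸ hF₁.2.2.2.2 F₂ hF₂.1 (hF₂.2.1.trans (ENNReal.ofReal_le_ofReal ht))
  have hκ : ∀ x, Measurable (k x) := fun x => hk.comp (measurable_const.prodMk measurable_id)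
  have key := le_of_le_potential hpq hk hf (C := ENNReal.ofReal C) (s := ENNReal.ofReal s) (E := E)
    (R := 2 * ENNReal.ofReal C * ENNReal.ofReal φ ^ (1 / p) +
      ENNReal.ofReal a ^ (1 / q) * ENNReal.ofReal (1 - φ) ^ (1 / p) +
      ENNReal.ofReal b ^ (1 / q) * ENNReal.ofReal φ ^ (1 / p)) hE
    (by rw [hEt]; simpa using ht₂) (by rw [hEt]; exact ENNReal.ofReal_ne_top) h1 hsE hF₂.1
    (by rw [hEt]; exact hF₂.2.1) (fun x _ => by
      refine (setLIntegral_compl_topSet_le hpq (hκ x) hf hF₁ hF₂ (ENNReal.ofReal_le_ofReal ht)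
        (hG₁ x) (hG₂ x) (h2₁ x) (h2₂ x)).trans ?_
      rw [hcompl, hφ']
      gcongr
      · exact h3 x
      · exact h4 x)
  -- Of the 3C, one C comes from the average over F₂ and two from the regions where f lies below a
  -- threshold. The mass on F₂ is at most φ since F₁ maximizes the integral among sets of measure at
  -- most t₁.
  have key2 : ENNReal.ofReal s ≤ ENNReal.ofReal (a ^ (1 / q) * (1 - φ) ^ (1 / p) +
      (3 * C + b ^ (1 / q)) * φ ^ (1 / p)) := by
    refine (key.trans (add_le_add_left (mul_le_mul_right
      (ENNReal.rpow_le_rpow hφ2 (by positivity)) _) _)).trans (le_of_eq ?_)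
    have h1φ : 0 ≤ 1 - φ := by linarith
    have h2 : (2 : ℝ≥0∞) = ENNReal.ofReal 2 := by simp
    rw [ENNReal.ofReal_rpow_of_nonneg hφ0 (by positivity),
      ENNReal.ofReal_rpow_of_nonneg h1φ (by positivity),
      ENNReal.ofReal_rpow_of_nonneg ha (by positivity),
      ENNReal.ofReal_rpow_of_nonneg hb (by positivity), h2]
    rw [← ENNReal.ofReal_mul (by positivity), ← ENNReal.ofReal_mul (by positivity),
      ← ENNReal.ofReal_mul (by positivity), ← ENNReal.ofReal_mul (by positivity),
      ← ENNReal.ofReal_mul (by positivity), ← ENNReal.ofReal_add (by positivity) (by positivity),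
      ← ENNReal.ofReal_add (by positivity) (by positivity),
      ← ENNReal.ofReal_add (by positivity) (by positivity)]
    congr 1
    ring
  rwa [ENNReal.ofReal_le_ofReal_iff (by
    have h1φ : 0 ≤ 1 - φ := by linarith
    positivity)] at key2

/-- The exponential integrability of a potential, in terms of its level sets. -/
theorem exists_tsum_levels_le [IsFiniteMeasure μ] [IsFiniteMeasure ν]
    {ρ : Y → ℝ} (hρ : Measurable ρ) (hρ0 : ∀ r, ν {y | ρ y = r} = 0) {p q : ℝ}
    (hpq : p.HolderConjugate q) {k : X → Y → ℝ≥0∞} (hk : Measurable (Function.uncurry k))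
    {A B C D t₀ : ℝ} (hA : 0 < A) (hB : 0 ≤ B) (hC : 0 ≤ C) (hD : 0 ≤ D) (ht₀ : 0 < t₀)
    (hμ : μ univ ≤ ENNReal.ofReal t₀) {G : X → ℝ → Set Y} (hG : ∀ x t, MeasurableSet (G x t))
    (h1 : ∀ E, MeasurableSet E → ∀ y, ∫⁻ x in E, k x y ∂μ ≤ ENNReal.ofReal C * μ E ^ (1 / p))
    (h2 : ∀ x t, 0 < t → ∫⁻ y in G x t, k x y ∂ν ≤ ENNReal.ofReal C * ENNReal.ofReal t ^ (1 / p))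
    (h3 : ∀ x t, 0 < t → t ≤ t₀ →
      ∫⁻ y in (G x t)ᶜ, k x y ^ q ∂ν ≤ ENNReal.ofReal (A * Real.log (t₀ / t) + B))
    (h4 : ∀ x t₁ t₂ F, 0 < t₂ → t₂ ≤ t₁ → t₁ ≤ t₀ → MeasurableSet F → ν F ≤ ENNReal.ofReal t₁ →
      ∫⁻ y in F \ G x t₂, k x y ^ q ∂ν ≤ ENNReal.ofReal (D * (Real.log (t₁ / t₂) + 1))) :
    ∃ C' : ℝ≥0, ∀ f : Y → ℝ≥0∞, Measurable f → ∫⁻ y, f y ^ p ∂ν = 1 →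
      ∑' m : ℕ, ENNReal.ofReal (Real.exp m) *
        μ {x | ENNReal.ofReal (A * m) ≤ (∫⁻ y, k x y * f y ∂ν) ^ q} ≤ C' := by
  have hp := hpq.pos
  have hq := hpq.symm.pos
  obtain ⟨C₀, hC₀⟩ := exists_tsum_exp_le hpq
    (D := 3 * C / A ^ (1 / q) + (D / A) ^ (1 / q)) (by positivity)
  -- This shift gives A log(t₀ / t) + B ≤ A T, and the 1 keeps T positive.
  set b := B / A + 1 with hb
  refine ⟨(t₀ * Real.exp b).toNNReal * C₀, fun f hf hf1 => ?_⟩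
  set u : X → ℝ≥0∞ := fun x => ∫⁻ y, k x y * f y ∂ν with hu
  have hum : Measurable u := by
    have hkf : Measurable (Function.uncurry fun x y => k x y * f y) :=
      hk.mul (hf.comp measurable_snd)
    exact hkf.lintegral_prod_right'
  set E : ℕ → Set X := fun m => {x | ENNReal.ofReal (A * m) ≤ u x ^ q} with hE
  have hEm : ∀ m, MeasurableSet (E m) := fun m => measurableSet_le measurable_const (hum.pow_const q)
  have hEanti : ∀ m₁ m₂, m₁ ≤ m₂ → E m₂ ⊆ E m₁ := fun m₁ m₂ h x hx =>
    (ENNReal.ofReal_le_ofReal (by gcongr)).trans hx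
  set t : ℕ → ℝ := fun m => (μ (E m)).toReal with ht
  have hEt : ∀ m, μ (E m) = ENNReal.ofReal (t m) := fun m =>
    (ENNReal.ofReal_toReal (measure_ne_top _ _)).symm
  set S : Set ℕ := {m | 0 < t m} with hS
  have htmono : ∀ m₁ m₂, m₁ ≤ m₂ → t m₂ ≤ t m₁ := fun m₁ m₂ h =>
    ENNReal.toReal_mono (measure_ne_top _ _) (measure_mono (hEanti m₁ m₂ h))
  have htt₀ : ∀ m, t m ≤ t₀ := fun m =>
    ENNReal.toReal_le_of_le_ofReal ht₀.le ((measure_mono (subset_univ _)).trans hμ)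
  choose F e hF using fun m => exists_isTopSet hρ hρ0 hf hp (ENNReal.ofReal (t m))
  set φ : ℕ → ℝ := fun m => (∫⁻ y in F m, f y ^ p ∂ν).toReal with hφ
  -- For t m > 0 the summand e^m t m equals t₀ e^b e^(m - T m), which is the form required by
  -- `exists_tsum_exp_le`.
  set T : ℕ → ℝ := fun m => Real.log (t₀ / t m) + b with hT
  have hlog : ∀ m, 0 ≤ Real.log (t₀ / t m) := by
    intro m
    -- For a null level the conventions t₀ / 0 = 0 and log 0 = 0 give T m = b.
    rcases (ENNReal.toReal_nonneg : 0 ≤ t m).eq_or_lt with h | h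
    · have h' : t m = 0 := h.symm
      rw [h']; simp
    · exact Real.log_nonneg ((one_le_div h).2 (htt₀ m))
  have hT0 : ∀ m, 0 < T m := fun m => by
    have : 0 ≤ B / A := by positivity
    have := hlog m
    simp only [hT, hb]; linarith
  have hφ01 : ∀ m, 0 ≤ φ m ∧ φ m ≤ 1 := fun m => ⟨ENNReal.toReal_nonneg, by
    have hle1 : ∫⁻ y in F m, f y ^ p ∂ν ≤ 1 := hf1 ▸ setLIntegral_le_lintegral _ _
    have := ENNReal.toReal_mono ENNReal.one_ne_top hle1
    simpa using this⟩
  have main := hC₀ S T φ hT0 hφ01 ?_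
  · calc ∑' m : ℕ, ENNReal.ofReal (Real.exp m) * μ (E m)
        = ∑' m : ℕ, ENNReal.ofReal (t₀ * Real.exp b) *
            S.indicator (fun m => ENNReal.ofReal (Real.exp (m - T m))) m := by
          congr 1 with m
          rw [hEt m]
          by_cases hm : m ∈ S
          · have hm' : 0 < t m := hm
            rw [indicator_of_mem hm, ← ENNReal.ofReal_mul (by positivity),
              ← ENNReal.ofReal_mul (by positivity)]
            congr 1
            have : Real.exp (m - T m) = Real.exp m * Real.exp (-b) * (t m / t₀) := by
              have h5 : t m / t₀ = Real.exp (-Real.log (t₀ / t m)) := by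
                rw [Real.exp_neg, Real.exp_log (by positivity), inv_div]
              rw [h5, ← Real.exp_add, ← Real.exp_add]
              congr 1
              simp only [hT]; ring
            rw [this, Real.exp_neg]
            field_simp
          · have hm' : t m = 0 := le_antisymm (not_lt.1 hm) ENNReal.toReal_nonneg
            rw [indicator_of_notMem hm, hm']; simp
      _ = ENNReal.ofReal (t₀ * Real.exp b) *
            ∑' m : ℕ, S.indicator (fun m => ENNReal.ofReal (Real.exp (m - T m))) m :=
          ENNReal.tsum_mul_left
      _ ≤ _ := by
          rw [ENNReal.coe_mul]
          gcongr
          exact le_of_eq rfl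
  · intro m₁ m₂ hm hm₂
    have ht₂ : 0 < t m₂ := hm₂
    have ht₁ : 0 < t m₁ := ht₂.trans_le (htmono _ _ hm)
    have hTT : T m₂ - T m₁ = Real.log (t m₁ / t m₂) := by
      simp only [hT]
      rw [Real.log_div ht₀.ne' ht₂.ne', Real.log_div ht₀.ne' ht₁.ne',
        Real.log_div ht₁.ne' ht₂.ne']
      ring
    have hΔ : 0 ≤ T m₂ - T m₁ := by
      rw [hTT]; exact Real.log_nonneg ((one_le_div ht₂).2 (htmono _ _ hm))
    refine ⟨by linarith, ?_⟩
    have h5 := potential_two_scale hpq hk (s := (A * m₂) ^ (1 / q)) (t₁ := t m₁) hC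
      (a := A * Real.log (t₀ / t m₁) + B) (by have := hlog m₁; positivity)
      (b := D * (Real.log (t m₁ / t m₂) + 1)) (by rw [← hTT]; positivity) hf hf1 (hEm m₂) (hEt m₂)
      ht₂ (htmono _ _ hm) (fun x hx => by
        have hx' : ENNReal.ofReal (A * m₂) ≤ u x ^ q := hx
        have := ENNReal.rpow_le_rpow hx' (z := 1 / q) (by positivity)
        rwa [ENNReal.ofReal_rpow_of_nonneg (by positivity) (by positivity), ← ENNReal.rpow_mul,
          mul_one_div_cancel hq.ne', ENNReal.rpow_one] at this) (h1 _ (hEm m₂))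
      (fun x => hG x (t m₁)) (fun x => hG x (t m₂)) (fun x => h2 x _ ht₁) (fun x => h2 x _ ht₂)
      (fun x => h3 x _ ht₁ (htt₀ m₁)) (hF m₁) (hF m₂)
      (fun x => h4 x _ _ _ ht₂ (htmono _ _ hm) (htt₀ m₁) (hF m₁).1 (hF m₁).2.1)
    rw [← hTT] at h5
    change _ ≤ _ * (1 - φ m₁) ^ (1 / p) + _ * φ m₁ ^ (1 / p) at h5
    obtain ⟨hφ0, hφ1⟩ := hφ01 m₁
    set Δ := T m₂ - T m₁
    have hA' : 0 < A ^ (1 / q) := by positivity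
    have h6 : (A * m₂) ^ (1 / q) = A ^ (1 / q) * (m₂ : ℝ) ^ (1 / q) :=
      Real.mul_rpow hA.le (by positivity)
    have h7 : (A * Real.log (t₀ / t m₁) + B) ^ (1 / q) ≤ A ^ (1 / q) * T m₁ ^ (1 / q) := by
      rw [← Real.mul_rpow hA.le (hT0 m₁).le]
      refine Real.rpow_le_rpow (by have := hlog m₁; positivity) ?_ (by positivity)
      simp only [hT, hb]
      have : A * (B / A) = B := by field_simp
      nlinarith
    have h8 : 3 * C + (D * (Δ + 1)) ^ (1 / q) ≤
        A ^ (1 / q) * ((3 * C / A ^ (1 / q) + (D / A) ^ (1 / q)) * (Δ + 1) ^ (1 / q)) := by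
      rw [Real.mul_rpow hD (by linarith), Real.div_rpow hD hA.le]
      have h9 : 1 ≤ (Δ + 1) ^ (1 / q) := Real.one_le_rpow (by linarith) (by positivity)
      have h10 : A ^ (1 / q) * ((3 * C / A ^ (1 / q) + D ^ (1 / q) / A ^ (1 / q)) *
          (Δ + 1) ^ (1 / q)) = 3 * C * (Δ + 1) ^ (1 / q) + D ^ (1 / q) * (Δ + 1) ^ (1 / q) := by
        field_simp
      rw [h10]
      nlinarith
    refine le_of_mul_le_mul_left ?_ hA'
    rw [← h6]
    refine h5.trans ?_
    have h11 : 0 ≤ (1 - φ m₁) ^ (1 / p) := Real.rpow_nonneg (by linarith) _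
    have h12 : 0 ≤ φ m₁ ^ (1 / p) := Real.rpow_nonneg hφ0 _
    calc _ ≤ A ^ (1 / q) * T m₁ ^ (1 / q) * (1 - φ m₁) ^ (1 / p) + A ^ (1 / q) *
          ((3 * C / A ^ (1 / q) + (D / A) ^ (1 / q)) * (Δ + 1) ^ (1 / q)) * φ m₁ ^ (1 / p) := by
          gcongr
      _ = _ := by ring

end Levels

/-! ### Crude bounds for the kernel near and away from its poles. -/

section Kernel

variable {n N : ℕ}

lemma volume_setOf_norm_sub_lt (hn : 0 < n) {r : ℝ} (hr : 0 < r) (c : EuclideanSpace ℝ (Fin n)) :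
    volume {z : EuclideanSpace ℝ (Fin n) | ‖c - z‖ < r} = ENNReal.ofReal (sphereArea n / n * r ^ (n : ℝ)) := by
  have h := lintegral_ball_rpow hn (β := n) (by positivity) hr c
  simp only [sub_self, Real.rpow_zero, ENNReal.ofReal_one, lintegral_one, Measure.restrict_apply,
    MeasurableSet.univ, univ_inter] at h
  rw [h]
  congr 1
  ring

/-- Cutting at a radius r with |H| of order at most r^n makes the near and the far contribution both
of order r^d. -/
lemma setLIntegral_rpow_le_of_volume_le (hn : 0 < n) {d r W : ℝ} (hd : 0 < d) (hdn : d < n)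
    (hr : 0 < r) (hW : 0 ≤ W) (c : EuclideanSpace ℝ (Fin n)) {H : Set (EuclideanSpace ℝ (Fin n))}
    (hH : volume H ≤ ENNReal.ofReal (W * r ^ (n : ℝ))) :
    ∫⁻ z in H, ENNReal.ofReal (‖c - z‖ ^ (d - n)) ≤
      ENNReal.ofReal ((sphereArea n / d + W) * r ^ d) := by
  have hω := sphereArea_pos hn
  refine (setLIntegral_rpow_le hn hd hdn.le hr c H).trans ?_
  refine (add_le_add_right (mul_le_mul_right hH _) _).trans (le_of_eq ?_)
  rw [← ENNReal.ofReal_mul (by positivity), ← ENNReal.ofReal_add (by positivity) (by positivity)]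
  congr 1
  have : r ^ d = r ^ (d - n) * r ^ (n : ℝ) := by rw [← Real.rpow_add hr]; congr 1; ring
  rw [this]
  ring

lemma measurable_potentialKernel {d : ℝ} {a : Fin N → EuclideanSpace ℝ (Fin n)} {g : Fin N → (EuclideanSpace ℝ (Fin n)) × (EuclideanSpace ℝ (Fin n)) → ℝ}
    (hg : ∀ j, Measurable (g j)) :
    Measurable (Function.uncurry fun x y => potentialKernel d a g x y) := by
  unfold potentialKernel Function.uncurry
  refine Finset.measurable_sum _ fun j _ => (hg j).mul ?_
  refine Measurable.pow_const ?_ _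
  exact ((measurable_fst.add_const (a j)).sub measurable_snd).norm

lemma abs_potentialKernel_le {d Γ : ℝ} {a : Fin N → EuclideanSpace ℝ (Fin n)} {g : Fin N → (EuclideanSpace ℝ (Fin n)) × (EuclideanSpace ℝ (Fin n)) → ℝ}
    (hΓ : ∀ j z, |g j z| ≤ Γ) (x y : EuclideanSpace ℝ (Fin n)) :
    |potentialKernel d a g x y| ≤ Γ * ∑ j, ‖x + a j - y‖ ^ (d - (n : ℝ)) := by
  unfold potentialKernel
  rw [Finset.mul_sum]
  refine (Finset.abs_sum_le_sum_abs _ _).trans (Finset.sum_le_sum fun j _ => ?_)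
  rw [abs_mul, abs_of_nonneg (Real.rpow_nonneg (norm_nonneg _) _)]
  gcongr
  exact hΓ j _

lemma enorm_potentialKernel_le {d Γ : ℝ} {a : Fin N → EuclideanSpace ℝ (Fin n)} {g : Fin N → (EuclideanSpace ℝ (Fin n)) × (EuclideanSpace ℝ (Fin n)) → ℝ}
    (hΓ0 : 0 ≤ Γ) (hΓ : ∀ j z, |g j z| ≤ Γ) (x y : EuclideanSpace ℝ (Fin n)) :
    ‖potentialKernel d a g x y‖ₑ ≤
      ENNReal.ofReal Γ * ∑ j, ENNReal.ofReal (‖x + a j - y‖ ^ (d - (n : ℝ))) := by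
  rw [← ENNReal.ofReal_sum_of_nonneg fun j _ => Real.rpow_nonneg (norm_nonneg _) _,
    ← ENNReal.ofReal_mul hΓ0, Real.enorm_eq_ofReal_abs]
  exact ENNReal.ofReal_le_ofReal (abs_potentialKernel_le hΓ x y)

lemma setLIntegral_sum_rpow_le (hn : 0 < n) {d r W Γ : ℝ} (hd : 0 < d) (hdn : d < n)
    (hr : 0 < r) (hW : 0 ≤ W) (hΓ : 0 ≤ Γ) (c : Fin N → EuclideanSpace ℝ (Fin n)) {H : Set (EuclideanSpace ℝ (Fin n))}
    (hH : volume H ≤ ENNReal.ofReal (W * r ^ (n : ℝ))) :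
    ∫⁻ z in H, ENNReal.ofReal Γ * ∑ j, ENNReal.ofReal (‖c j - z‖ ^ (d - (n : ℝ))) ≤
      ENNReal.ofReal (Γ * (N * (sphereArea n / d + W)) * r ^ d) := by
  have hω := sphereArea_pos hn
  rw [lintegral_const_mul _ (by fun_prop), lintegral_finsetSum _ (fun j _ => by fun_prop)]
  calc _ ≤ ENNReal.ofReal Γ * ∑ j : Fin N, ENNReal.ofReal ((sphereArea n / d + W) * r ^ d) := by
        gcongr with j
        exact setLIntegral_rpow_le_of_volume_le hn hd hdn hr hW (c j) hH
    _ = _ := by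
        rw [Finset.sum_const, Finset.card_univ, Fintype.card_fin, nsmul_eq_mul,
          ← ENNReal.ofReal_natCast, ← ENNReal.ofReal_mul (by positivity),
          ← ENNReal.ofReal_mul hΓ]
        congr 1
        ring

/-- Integration of the kernel in the first variable. -/
lemma lintegral_kernel_left_le (hn : 0 < n) {d Γ : ℝ} (hd : 0 < d) (hdn : d < n)
    {a : Fin N → EuclideanSpace ℝ (Fin n)} {g : Fin N → (EuclideanSpace ℝ (Fin n)) × (EuclideanSpace ℝ (Fin n)) → ℝ} (hΓ0 : 0 ≤ Γ) (hΓ : ∀ j z, |g j z| ≤ Γ)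
    {H : Set (EuclideanSpace ℝ (Fin n))} (hH : volume H ≠ ∞) (y : EuclideanSpace ℝ (Fin n)) :
    ∫⁻ x in H, ‖potentialKernel d a g x y‖ₑ ≤
      ENNReal.ofReal (Γ * (N * (sphereArea n / d + 1))) * volume H ^ (d / n) := by
  have hω := sphereArea_pos hn
  have hn' : (0 : ℝ) < n := by exact_mod_cast hn
  rcases eq_or_ne (volume H) 0 with h0 | h0
  · rw [setLIntegral_measure_zero _ _ h0]; exact bot_le
  set s := (volume H).toReal with hs
  have hs0 : 0 < s := ENNReal.toReal_pos h0 hH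
  have hHs : volume H = ENNReal.ofReal s := (ENNReal.ofReal_toReal hH).symm
  have h1 := setLIntegral_sum_rpow_le (N := N) hn hd hdn (r := s ^ (1 / (n : ℝ))) (by positivity)
    zero_le_one hΓ0 (fun j => y - a j) (H := H) (by
      rw [← Real.rpow_mul hs0.le, one_div_mul_cancel hn'.ne', Real.rpow_one, one_mul, hHs])
  rw [← Real.rpow_mul hs0.le, one_div_mul_eq_div, ENNReal.ofReal_mul (by positivity),
    ← ENNReal.ofReal_rpow_of_nonneg hs0.le (by positivity), ← hHs] at h1
  refine le_trans (lintegral_mono fun x => ?_) h1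
  refine (enorm_potentialKernel_le hΓ0 hΓ x y).trans (le_of_eq ?_)
  congr 1
  refine Finset.sum_congr rfl fun j _ => ?_
  rw [← norm_neg]
  congr 3
  abel

/-- The union of the balls of radius `t ^ (1 / n)` about the singularities. -/
def singularBalls (a : Fin N → EuclideanSpace ℝ (Fin n)) (x : EuclideanSpace ℝ (Fin n)) (t : ℝ) : Set (EuclideanSpace ℝ (Fin n)) :=
  ⋃ j, {y | ‖x + a j - y‖ < t ^ (1 / (n : ℝ))}

lemma measurableSet_singularBalls (a : Fin N → EuclideanSpace ℝ (Fin n)) (x : EuclideanSpace ℝ (Fin n)) (t : ℝ) :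
    MeasurableSet (singularBalls a x t) :=
  MeasurableSet.iUnion fun _ => measurableSet_lt (by fun_prop) measurable_const

lemma volume_singularBalls_le (hn : 0 < n) (a : Fin N → EuclideanSpace ℝ (Fin n)) (x : EuclideanSpace ℝ (Fin n)) {t : ℝ} (ht : 0 < t) :
    volume (singularBalls a x t) ≤
      ENNReal.ofReal (N * (sphereArea n / n) * (t ^ (1 / (n : ℝ))) ^ (n : ℝ)) := by
  have hω := sphereArea_pos hn
  refine (measure_iUnion_fintype_le _ _).trans (le_of_eq ?_)
  simp_rw [volume_setOf_norm_sub_lt hn (Real.rpow_pos_of_pos ht _)]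
  rw [Finset.sum_const, Finset.card_univ, Fintype.card_fin, nsmul_eq_mul,
    ← ENNReal.ofReal_natCast, ← ENNReal.ofReal_mul (by positivity), mul_assoc]

/-- This yields hypothesis `h2` of `exists_tsum_levels_le`, with d/n = 1/p. The balls have total
volume O(t), so every pole contributes O(t^(d/n)), including over the balls around the other poles.
-/
lemma setLIntegral_singularBalls_le (hn : 0 < n) {d Γ : ℝ} (hd : 0 < d) (hdn : d < n)
    {a : Fin N → EuclideanSpace ℝ (Fin n)} {g : Fin N → (EuclideanSpace ℝ (Fin n)) × (EuclideanSpace ℝ (Fin n)) → ℝ} (hΓ0 : 0 ≤ Γ) (hΓ : ∀ j z, |g j z| ≤ Γ)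
    (x : EuclideanSpace ℝ (Fin n)) {t : ℝ} (ht : 0 < t) :
    ∫⁻ y in singularBalls a x t, ‖potentialKernel d a g x y‖ₑ ≤
      ENNReal.ofReal (Γ * (N * (sphereArea n / d + N * (sphereArea n / n)))) *
        ENNReal.ofReal t ^ (d / n) := by
  have hω := sphereArea_pos hn
  have h1 := setLIntegral_sum_rpow_le (N := N) hn hd hdn (r := t ^ (1 / (n : ℝ))) (by positivity)
    (W := N * (sphereArea n / n)) (by positivity) hΓ0 (fun j => x + a j)
    (volume_singularBalls_le hn a x ht)
  rw [← Real.rpow_mul ht.le, one_div_mul_eq_div, ENNReal.ofReal_mul (by positivity),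
    ← ENNReal.ofReal_rpow_of_nonneg ht.le (by positivity)] at h1
  exact le_trans (lintegral_mono fun y => enorm_potentialKernel_le hΓ0 hΓ x y) h1

lemma abs_potentialKernel_rpow_le {d q Γ : ℝ} (hq : 1 ≤ q) (hdq : (d - n) * q = -n)
    {a : Fin N → EuclideanSpace ℝ (Fin n)} {g : Fin N → (EuclideanSpace ℝ (Fin n)) × (EuclideanSpace ℝ (Fin n)) → ℝ} (hΓ0 : 0 ≤ Γ) (hΓ : ∀ j z, |g j z| ≤ Γ)
    (x y : EuclideanSpace ℝ (Fin n)) :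
    |potentialKernel d a g x y| ^ q ≤
      Γ ^ q * N ^ (q - 1) * ∑ j, ‖x + a j - y‖ ^ (-(n : ℝ)) := by
  have h0 : ∀ j, 0 ≤ ‖x + a j - y‖ ^ (d - (n : ℝ)) := fun j => Real.rpow_nonneg (norm_nonneg _) _
  calc |potentialKernel d a g x y| ^ q
      ≤ (Γ * ∑ j, ‖x + a j - y‖ ^ (d - (n : ℝ))) ^ q := by
        gcongr
        exact abs_potentialKernel_le hΓ x y
    _ = Γ ^ q * (∑ j, ‖x + a j - y‖ ^ (d - (n : ℝ))) ^ q :=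
        Real.mul_rpow hΓ0 (Finset.sum_nonneg fun j _ => h0 j)
    _ ≤ Γ ^ q * (N ^ (q - 1) * ∑ j, (‖x + a j - y‖ ^ (d - (n : ℝ))) ^ q) := by
        gcongr
        have := Real.rpow_sum_le_const_mul_sum_rpow_of_nonneg (Finset.univ : Finset (Fin N)) hq
          (f := fun j => ‖x + a j - y‖ ^ (d - (n : ℝ))) (fun j _ => h0 j)
        simpa using this
    _ = _ := by
        simp_rw [← Real.rpow_mul (norm_nonneg _), hdq]
        ring

/-- This yields hypothesis `h4` of `exists_tsum_levels_le`: radii between t₂^(1/n) and t₁^(1/n) give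
the logarithm, and beyond them |F| ≤ t₁ bounds the rest. The constant may be crude because it
affects only D, not the exponential constant. -/
lemma setLIntegral_sdiff_singularBalls_le (hn : 0 < n) {d q Γ : ℝ} (hq : 1 ≤ q)
    (hdq : (d - n) * q = -n)
    {a : Fin N → EuclideanSpace ℝ (Fin n)} {g : Fin N → (EuclideanSpace ℝ (Fin n)) × (EuclideanSpace ℝ (Fin n)) → ℝ} (hΓ0 : 0 ≤ Γ) (hΓ : ∀ j z, |g j z| ≤ Γ)
    (x : EuclideanSpace ℝ (Fin n)) {t₁ t₂ : ℝ} (ht₂ : 0 < t₂) (ht : t₂ ≤ t₁) {F : Set (EuclideanSpace ℝ (Fin n))}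
    (hF : volume F ≤ ENNReal.ofReal t₁) :
    ∫⁻ y in F \ singularBalls a x t₂, ‖potentialKernel d a g x y‖ₑ ^ q ≤
      ENNReal.ofReal (Γ ^ q * N ^ (q - 1) * (N * (sphereArea n / n + 1)) *
        (Real.log (t₁ / t₂) + 1)) := by
  have hω := sphereArea_pos hn
  have hn' : (0 : ℝ) < n := by exact_mod_cast hn
  have ht₁ : 0 < t₁ := ht₂.trans_le ht
  have hlog : 0 ≤ Real.log (t₁ / t₂) := Real.log_nonneg ((one_le_div ht₂).2 ht)
  have hrn : ∀ t : ℝ, 0 < t → (t ^ (1 / (n : ℝ))) ^ (-(n : ℝ)) = t⁻¹ := fun t ht => by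
    rw [← Real.rpow_mul ht.le, ← Real.rpow_neg_one]
    congr 1
    field_simp
  have hj : ∀ j, ∫⁻ y in F \ singularBalls a x t₂,
      ENNReal.ofReal (‖x + a j - y‖ ^ (-(n : ℝ))) ≤
      ENNReal.ofReal ((sphereArea n / n + 1) * (Real.log (t₁ / t₂) + 1)) := fun j => by
    refine (setLIntegral_rpow_neg_le hn (r := t₂ ^ (1 / (n : ℝ))) (R := t₁ ^ (1 / (n : ℝ)))
      (by positivity) (by gcongr) (x + a j) (fun y hy => ?_)).trans ?_
    · exact not_lt.1 fun h => hy.2 (mem_iUnion.2 ⟨j, h⟩)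
    · rw [hrn t₁ ht₁]
      calc _ ≤ ENNReal.ofReal (sphereArea n * Real.log (t₁ ^ (1 / (n : ℝ)) / t₂ ^ (1 / (n : ℝ)))) +
            ENNReal.ofReal t₁⁻¹ * ENNReal.ofReal t₁ := by
            gcongr
            exact (measure_mono sdiff_subset).trans hF
        _ = ENNReal.ofReal (sphereArea n / n * Real.log (t₁ / t₂) + 1) := by
            rw [← ENNReal.ofReal_mul (by positivity), inv_mul_cancel₀ ht₁.ne',
              ← Real.div_rpow ht₁.le ht₂.le, Real.log_rpow (by positivity),
              ← ENNReal.ofReal_add (by positivity) (by positivity)]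
            congr 1
            ring
        _ ≤ _ := by
            refine ENNReal.ofReal_le_ofReal ?_
            have : 0 < sphereArea n / n := by positivity
            nlinarith
  calc _ ≤ ∫⁻ y in F \ singularBalls a x t₂, ENNReal.ofReal (Γ ^ q * N ^ (q - 1)) *
        ∑ j, ENNReal.ofReal (‖x + a j - y‖ ^ (-(n : ℝ))) := by
        refine lintegral_mono fun y => ?_
        rw [Real.enorm_eq_ofReal_abs, ENNReal.ofReal_rpow_of_nonneg (abs_nonneg _) (by linarith),
          ← ENNReal.ofReal_sum_of_nonneg fun j _ => Real.rpow_nonneg (norm_nonneg _) _,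
          ← ENNReal.ofReal_mul (by positivity)]
        exact ENNReal.ofReal_le_ofReal (abs_potentialKernel_rpow_le hq hdq hΓ0 hΓ x y)
    _ ≤ ENNReal.ofReal (Γ ^ q * N ^ (q - 1)) * ∑ j : Fin N,
          ENNReal.ofReal ((sphereArea n / n + 1) * (Real.log (t₁ / t₂) + 1)) := by
        rw [lintegral_const_mul _ (by fun_prop), lintegral_finsetSum _ (fun j _ => by fun_prop)]
        gcongr with j
        exact hj j
    _ = _ := by
        rw [Finset.sum_const, Finset.card_univ, Fintype.card_fin, nsmul_eq_mul,
          ← ENNReal.ofReal_natCast, ← ENNReal.ofReal_mul (by positivity),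
          ← ENNReal.ofReal_mul (by positivity)]
        congr 1
        ring

end Kernel

/-! ### The exact leading term of the kernel at its poles. -/

section LocalBound

variable {n N : ℕ}

/-- Bernoulli's inequality applied to (1 - β / (α + β))^q. The coefficient of α ^ q stays 1, which
sharpness of the constant requires. -/
lemma add_rpow_le_add {q α β : ℝ} (hq : 1 ≤ q) (hα : 0 ≤ α) (hβ : 0 ≤ β) :
    (α + β) ^ q ≤ α ^ q + q * β * (α + β) ^ (q - 1) := by
  rcases (add_nonneg hα hβ).eq_or_lt with h | h
  · rw [← h, Real.zero_rpow (by linarith)]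
    have hα' : α = 0 := by linarith
    have hβ' : β = 0 := by linarith
    simp [hα', hβ', Real.zero_rpow (by linarith : q ≠ 0)]
  have h1 := one_add_mul_self_le_rpow_one_add (s := -β / (α + β)) (by
    rw [le_div_iff₀ h]; linarith) hq
  have h2 : 1 + -β / (α + β) = α / (α + β) := by field_simp; ring
  rw [h2, Real.div_rpow hα h.le, le_div_iff₀ (by positivity)] at h1
  have h3 : (α + β) ^ q = (α + β) ^ (q - 1) * (α + β) := by
    rw [← Real.rpow_add_one h.ne']; ring_nf
  have h4 : (1 + q * (-β / (α + β))) * (α + β) ^ q =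
      (α + β) ^ q - q * β * (α + β) ^ (q - 1) := by
    have : -β / (α + β) * (α + β) = -β := by field_simp
    calc _ = (α + β) ^ q + q * (-β / (α + β)) * (α + β) ^ q := by ring
      _ = (α + β) ^ q + q * (-β / (α + β)) * ((α + β) ^ (q - 1) * (α + β)) := by rw [← h3]
      _ = (α + β) ^ q + q * (-β / (α + β) * (α + β)) * (α + β) ^ (q - 1) := by ring
      _ = _ := by rw [this]; ring
  rw [h4] at h1
  linarith

/-- The local structure of the coefficients near the singularities of the kernel. -/
structure IsLocalData (a : Fin N → EuclideanSpace ℝ (Fin n))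
    (g : Fin N → EuclideanSpace ℝ (Fin n) × EuclideanSpace ℝ (Fin n) → ℝ)
    (V : Set (EuclideanSpace ℝ (Fin n) × EuclideanSpace ℝ (Fin n)))
    (Ω Ω' : Set (EuclideanSpace ℝ (Fin n))) (Γ L ε δ : ℝ) : Prop where
  nonneg : 0 ≤ Γ
  hold_nonneg : 0 ≤ L
  exp_pos : 0 < ε
  rad_pos : 0 < δ
  rad_le : δ ≤ 1
  bound : ∀ j, ∀ z ∈ V, |g j z| ≤ Γ
  sub : Ω' ×ˢ Ω ⊆ V
  mem : ∀ j, ∀ x ∈ Ω', ∀ y ∈ Ω, ‖x + a j - y‖ < δ → (x, x + a j) ∈ V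
  hold : ∀ j, ∀ x ∈ Ω', ∀ y ∈ Ω, ‖x + a j - y‖ < δ →
    |g j (x, y)| ≤ |g j (x, x + a j)| + L * ‖x + a j - y‖ ^ ε
  sep : ∀ i j, i ≠ j → 2 * δ ≤ ‖a i - a j‖

/-- Compactness gives the closure of Ω' × Ω a uniform neighbourhood inside U. So if a pole x + a_j
comes within δ of a point of Ω, then (x, x + a_j) belongs to U, and the terms omitted from S(x) have
no singularity near Ω. All Hölder exponents can be lowered to a common ε because δ ≤ 1. -/
lemma exists_isLocalData {a : Fin N → EuclideanSpace ℝ (Fin n)} (ha : Function.Injective a)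
    {U : Set (EuclideanSpace ℝ (Fin n) × EuclideanSpace ℝ (Fin n))}
    {Ω Ω' : Set (EuclideanSpace ℝ (Fin n))} (hΩb : Bornology.IsBounded Ω)
    (hΩb' : Bornology.IsBounded Ω') (hU : IsOpen U) (hUb : Bornology.IsBounded U)
    (hsub : closure (Ω' ×ˢ Ω) ⊆ U)
    {g : Fin N → EuclideanSpace ℝ (Fin n) × EuclideanSpace ℝ (Fin n) → ℝ}
    {σ : Fin N → ℝ≥0} (hσ : ∀ j, 0 < σ j)
    (hg : ∀ j, ∃ L : ℝ≥0, HolderOnWith L (σ j) (g j) (closure U)) {ε₀ : ℝ} (hε₀ : 0 < ε₀) :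
    ∃ Γ L ε δ, ε ≤ ε₀ ∧ IsLocalData a g (closure U) Ω Ω' Γ L ε δ := by
  choose l hl using hg
  have hcomp : IsCompact (closure U) := hUb.isCompact_closure
  have hΓ : ∀ j, ∃ C, ∀ z ∈ closure U, |g j z| ≤ C := fun j =>
    hcomp.exists_bound_of_continuousOn ((hl j).continuousOn (hσ j))
  choose γ hγ using hΓ
  have hle : ∀ c : ℝ, 0 < c → ∀ᶠ ε : ℝ in nhdsWithin 0 (Ioi 0), ε ≤ c := fun c hc =>
    nhdsWithin_le_nhds (Iic_mem_nhds hc)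
  have hev : ∀ᶠ ε : ℝ in nhdsWithin 0 (Ioi 0), (ε ≤ ε₀ ∧ ∀ j, ε ≤ σ j) ∧ 0 < ε := by
    refine ((hle _ hε₀).and ?_).and self_mem_nhdsWithin
    exact Filter.eventually_all.2 fun j => hle _ (by exact_mod_cast hσ j)
  obtain ⟨ε, ⟨hε1, hε2⟩, hε3⟩ := hev.exists
  have hKc : IsCompact (closure (Ω' ×ˢ Ω)) := (hΩb'.prod hΩb).isCompact_closure
  obtain ⟨η, hη, hηU⟩ := hKc.exists_thickening_subset_open hU hsub
  have hev2 : ∀ᶠ δ : ℝ in nhdsWithin 0 (Ioi 0),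
      ((δ ≤ 1 ∧ δ ≤ η) ∧ ∀ i j, i ≠ j → 2 * δ ≤ ‖a i - a j‖) ∧ 0 < δ := by
    refine (((hle _ one_pos).and (hle _ hη)).and ?_).and self_mem_nhdsWithin
    refine Filter.eventually_all.2 fun i => Filter.eventually_all.2 fun j => ?_
    by_cases hij : i = j
    · exact Filter.Eventually.of_forall fun _ h => absurd hij h
    · have h0 : 0 < ‖a i - a j‖ / 2 := by
        have := norm_pos_iff.2 (sub_ne_zero.2 (ha.ne hij))
        positivity
      filter_upwards [hle _ h0] with δ hδ _
      linarith
  obtain ⟨δ, ⟨⟨hδ1, hδ2⟩, hδ3⟩, hδ0⟩ := hev2.exists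
  have hdist : ∀ j (x y : EuclideanSpace ℝ (Fin n)),
      dist (x, y) (x, x + a j) = ‖x + a j - y‖ := fun j x y => by
    rw [Prod.dist_eq]
    simp [dist_eq_norm, norm_sub_rev]
  have hmem : ∀ j, ∀ x ∈ Ω', ∀ y ∈ Ω, ‖x + a j - y‖ < δ → (x, x + a j) ∈ closure U := by
    intro j x hx y hy h
    refine subset_closure (hηU (Metric.mem_thickening_iff.2 ⟨(x, y), subset_closure ⟨hx, hy⟩, ?_⟩))
    rw [dist_comm, hdist]
    linarith
  have hsub' : Ω' ×ˢ Ω ⊆ closure U := subset_closure.trans (hsub.trans subset_closure)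
  refine ⟨∑ j, |γ j|, ∑ j, (l j : ℝ), ε, δ, hε1, ⟨Finset.sum_nonneg fun _ _ => abs_nonneg _,
    Finset.sum_nonneg fun j _ => (l j).2, hε3, hδ0, hδ1, fun j z hz => ?_, hsub', hmem,
    fun j x hx y hy h => ?_, hδ3⟩⟩
  · refine ((hγ j z hz).trans (le_abs_self _)).trans ?_
    exact Finset.single_le_sum (f := fun j => |γ j|) (fun _ _ => abs_nonneg _) (Finset.mem_univ j)
  · have h1 := (hl j).dist_le (hsub' ⟨hx, hy⟩ : (x, y) ∈ closure U) (hmem j x hx y hy h)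
    rw [hdist, Real.dist_eq] at h1
    have h2 : |g j (x, y)| ≤ |g j (x, x + a j)| + |g j (x, y) - g j (x, x + a j)| := by
      have := abs_add_le (g j (x, x + a j)) (g j (x, y) - g j (x, x + a j))
      simpa using this
    refine h2.trans (add_le_add_right (h1.trans ?_) _)
    have h3 : (l j : ℝ) ≤ ∑ j, (l j : ℝ) :=
      Finset.single_le_sum (f := fun j => (l j : ℝ)) (fun j _ => (l j).2) (Finset.mem_univ j)
    have h4 : ‖x + a j - y‖ ^ (σ j : ℝ) ≤ ‖x + a j - y‖ ^ ε := by
      rcases (norm_nonneg (x + a j - y)).eq_or_lt with h0 | h0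
      · rw [← h0, Real.zero_rpow hε3.ne', Real.zero_rpow (by exact_mod_cast (hσ j).ne')]
      · exact Real.rpow_le_rpow_of_exponent_ge h0 (by linarith) (hε2 j)
    have h5 : 0 ≤ ‖x + a j - y‖ ^ (σ j : ℝ) := Real.rpow_nonneg (norm_nonneg _) _
    have h6 : (0 : ℝ) ≤ l j := (l j).2
    gcongr

variable {a : Fin N → EuclideanSpace ℝ (Fin n)}
  {g : Fin N → EuclideanSpace ℝ (Fin n) × EuclideanSpace ℝ (Fin n) → ℝ}
  {V : Set (EuclideanSpace ℝ (Fin n) × EuclideanSpace ℝ (Fin n))}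
  {Ω Ω' : Set (EuclideanSpace ℝ (Fin n))} {Γ L ε δ : ℝ}

lemma IsLocalData.norm_ge (h : IsLocalData a g V Ω Ω' Γ L ε δ) {i j : Fin N} (hij : i ≠ j)
    {x y : EuclideanSpace ℝ (Fin n)} (hy : ‖x + a j - y‖ < δ) : δ ≤ ‖x + a i - y‖ := by
  have h1 := h.sep i j hij
  have h2 : ‖a i - a j‖ ≤ ‖x + a i - y‖ + ‖x + a j - y‖ := by
    have := norm_sub_le (x + a i - y) (x + a j - y)
    rwa [show x + a i - y - (x + a j - y) = a i - a j by abel] at this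
  linarith

lemma IsLocalData.abs_sum_le (h : IsLocalData a g V Ω Ω' Γ L ε δ) {d : ℝ} (hdn : d < n)
    {x y : EuclideanSpace ℝ (Fin n)} (hx : x ∈ Ω') (hy : y ∈ Ω) (s : Finset (Fin N))
    (hs : ∀ i ∈ s, δ ≤ ‖x + a i - y‖) :
    |∑ i ∈ s, g i (x, y) * ‖x + a i - y‖ ^ (d - (n : ℝ))| ≤ N * (Γ * δ ^ (d - (n : ℝ))) := by
  have hδ := h.rad_pos
  calc _ ≤ ∑ i ∈ s, |g i (x, y) * ‖x + a i - y‖ ^ (d - (n : ℝ))| := Finset.abs_sum_le_sum_abs _ _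
    _ ≤ ∑ i ∈ s, Γ * δ ^ (d - (n : ℝ)) := by
        refine Finset.sum_le_sum fun i hi => ?_
        rw [abs_mul, abs_of_nonneg (Real.rpow_nonneg (norm_nonneg _) _)]
        have h1 := h.bound i (x, y) (h.sub ⟨hx, hy⟩)
        have h2 := Real.rpow_le_rpow_of_nonpos hδ (hs i hi) (by linarith : d - (n : ℝ) ≤ 0)
        have h3 := h.nonneg
        gcongr
    _ ≤ _ := by
        rw [Finset.sum_const, nsmul_eq_mul]
        have h3 := h.nonneg
        have : s.card ≤ N := by simpa using Finset.card_le_univ s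
        gcongr

/-- The pointwise majorant of the `q`-th power of the kernel. -/
noncomputable def kernelMajorant (a : Fin N → EuclideanSpace ℝ (Fin n))
    (g : Fin N → EuclideanSpace ℝ (Fin n) × EuclideanSpace ℝ (Fin n) → ℝ)
    (V : Set (EuclideanSpace ℝ (Fin n) × EuclideanSpace ℝ (Fin n))) (q ε δ c : ℝ)
    (x y : EuclideanSpace ℝ (Fin n)) : ℝ≥0∞ :=
  (∑ j, {y | ‖x + a j - y‖ < δ}.indicator (fun y =>
    ENNReal.ofReal (V.indicator (fun z => |g j z| ^ q) (x, x + a j)) *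
      ENNReal.ofReal (‖x + a j - y‖ ^ (-(n : ℝ))) +
    ENNReal.ofReal c * ENNReal.ofReal (‖x + a j - y‖ ^ (ε - (n : ℝ)))) y) + ENNReal.ofReal c

/-- Within δ of the j-th pole the other terms are bounded by Q, and ε ≤ n - d makes r^(d-n+ε) ≥ 1,
so they can be merged with the Hölder error. Thus |K| ≤ r^(d-n) (s + (L + Q) r^ε), and the q-th
power is s^q r^(-n) up to a multiple of r^(ε-n). -/
lemma IsLocalData.exists_majorant (h : IsLocalData a g V Ω Ω' Γ L ε δ) {d q : ℝ} (hq : 1 ≤ q)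
    (hdq : (d - n) * q = -n) (hdn : d < n) (hε : ε ≤ n - d) :
    ∃ c, 0 ≤ c ∧ ∀ x ∈ Ω', ∀ y ∈ Ω,
      ‖potentialKernel d a g x y‖ₑ ^ q ≤ kernelMajorant a g V q ε δ c x y := by
  have hδ := h.rad_pos
  have hΓ := h.nonneg
  have hL := h.hold_nonneg
  set Q := N * (Γ * δ ^ (d - (n : ℝ))) with hQ
  have hQ0 : 0 ≤ Q := by positivity
  set c₁ := q * (L + Q) * (Γ + (L + Q)) ^ (q - 1) with hc₁
  have hc₁0 : 0 ≤ c₁ := by positivity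
  refine ⟨c₁ + Q ^ q, by positivity, fun x hx y hy => ?_⟩
  rw [Real.enorm_eq_ofReal_abs, ENNReal.ofReal_rpow_of_nonneg (abs_nonneg _) (by linarith)]
  have hfar : |potentialKernel d a g x y| ≤ Q →
      ENNReal.ofReal (|potentialKernel d a g x y| ^ q) ≤
        kernelMajorant a g V q ε δ (c₁ + Q ^ q) x y := fun h1 => by
    refine le_trans ?_ le_add_self
    refine ENNReal.ofReal_le_ofReal ?_
    have := Real.rpow_le_rpow (abs_nonneg _) h1 (by linarith : 0 ≤ q)
    linarith
  by_cases hall : ∀ j, δ ≤ ‖x + a j - y‖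
  · exact hfar (h.abs_sum_le hdn hx hy _ fun i _ => hall i)
  push Not at hall
  obtain ⟨j, hj⟩ := hall
  have hrest := h.abs_sum_le hdn hx hy (Finset.univ.erase j) fun i hi =>
    h.norm_ge (Finset.ne_of_mem_erase hi) hj
  have hK : potentialKernel d a g x y = g j (x, y) * ‖x + a j - y‖ ^ (d - (n : ℝ)) +
      ∑ i ∈ Finset.univ.erase j, g i (x, y) * ‖x + a i - y‖ ^ (d - (n : ℝ)) :=
    (Finset.add_sum_erase _ _ (Finset.mem_univ j)).symm
  -- Exactly at the pole the convention 0 ^ (d - n) = 0 removes the singular term.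
  rcases (norm_nonneg (x + a j - y)).eq_or_lt with hr | hr
  · refine hfar ?_
    rw [hK, ← hr, Real.zero_rpow (by linarith), mul_zero, zero_add]
    exact hrest
  set r := ‖x + a j - y‖ with hr'
  have hr1 : r ≤ 1 := hj.le.trans h.rad_le
  set s := |g j (x, x + a j)| with hs
  have hVm := h.mem j x hx y hy hj
  have hsΓ : s ≤ Γ := h.bound j _ hVm
  have hs0 : 0 ≤ s := abs_nonneg _
  have hrε : r ^ ε ≤ 1 := Real.rpow_le_one hr.le hr1 h.exp_pos.le
  have hKle : |potentialKernel d a g x y| ≤ r ^ (d - (n : ℝ)) * (s + (L + Q) * r ^ ε) := by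
    rw [hK]
    refine (abs_add_le _ _).trans ?_
    rw [abs_mul, abs_of_nonneg (Real.rpow_nonneg hr.le _)]
    have h1 := h.hold j x hx y hy hj
    have h2 : 1 ≤ r ^ (d - (n : ℝ)) * r ^ ε := by
      rw [← Real.rpow_add hr]
      exact Real.one_le_rpow_of_pos_of_le_one_of_nonpos hr hr1 (by linarith)
    have h3 : 0 < r ^ (d - (n : ℝ)) := by positivity
    calc _ ≤ (s + L * r ^ ε) * r ^ (d - (n : ℝ)) + Q * (r ^ (d - (n : ℝ)) * r ^ ε) := by
          gcongr
          exact hrest.trans (le_mul_of_one_le_right hQ0 h2)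
      _ = _ := by ring
  have hpow : |potentialKernel d a g x y| ^ q ≤
      s ^ q * r ^ (-(n : ℝ)) + c₁ * r ^ (ε - (n : ℝ)) := by
    calc |potentialKernel d a g x y| ^ q ≤ (r ^ (d - (n : ℝ)) * (s + (L + Q) * r ^ ε)) ^ q := by
          gcongr
      _ = r ^ (-(n : ℝ)) * (s + (L + Q) * r ^ ε) ^ q := by
          rw [Real.mul_rpow (by positivity) (by positivity), ← Real.rpow_mul hr.le, hdq]
      _ ≤ r ^ (-(n : ℝ)) * (s ^ q + q * ((L + Q) * r ^ ε) * (Γ + (L + Q)) ^ (q - 1)) := by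
          gcongr
          refine (add_rpow_le_add hq hs0 (by positivity)).trans ?_
          gcongr
          exact mul_le_of_le_one_right (by positivity) hrε
      _ = s ^ q * r ^ (-(n : ℝ)) + c₁ * (r ^ ε * r ^ (-(n : ℝ))) := by rw [hc₁]; ring
      _ = _ := by rw [← Real.rpow_add hr, ← sub_eq_add_neg]
  refine le_trans ?_ le_self_add
  refine le_trans ?_ (Finset.single_le_sum (fun _ _ => bot_le) (Finset.mem_univ j))
  rw [indicator_of_mem (show y ∈ {y | ‖x + a j - y‖ < δ} from hj), indicator_of_mem hVm,
    ← ENNReal.ofReal_mul (by positivity), ← ENNReal.ofReal_mul (by positivity),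
    ← ENNReal.ofReal_add (by positivity) (by positivity)]
  refine ENNReal.ofReal_le_ofReal (hpow.trans ?_)
  gcongr
  have : 0 ≤ Q ^ q := by positivity
  linarith

/-- Here the sharp constant appears: around each pole the radii from t^(1/n) to t₀^(1/n) carry
(ω_{n-1} / n) log(t₀ / t), and the coefficients add up to S(x). The δ-balls fit in this range since
δ ≤ 1 ≤ t₀, and the errors r^(ε-n) are integrable up to the pole, hence bounded uniformly in t. -/
lemma setLIntegral_kernelMajorant_le (hn : 0 < n) (hε : 0 < ε) (hδ : 0 < δ) (hδ1 : δ ≤ 1)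
    {q c v : ℝ} (hc : 0 ≤ c) (hv : volume Ω ≤ ENNReal.ofReal v) (hv0 : 0 ≤ v)
    {t₀ t : ℝ} (ht₀ : 1 ≤ t₀) (ht : 0 < t) (htt : t ≤ t₀) (x : EuclideanSpace ℝ (Fin n)) :
    ∫⁻ y in Ω \ singularBalls a x t, kernelMajorant a g V q ε δ c x y ≤
      ENNReal.ofReal (sphereArea n / n * shiftedSum q a g V x * Real.log (t₀ / t) +
        (N * (c * (sphereArea n * (δ ^ ε / ε))) + c * v)) := by
  have hω := sphereArea_pos hn
  have hn' : (0 : ℝ) < n := by exact_mod_cast hn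
  have hm : ∀ j, MeasurableSet {y | ‖x + a j - y‖ < δ} := fun j =>
    measurableSet_lt (by fun_prop) measurable_const
  have hlog : 0 ≤ Real.log (t₀ / t) := Real.log_nonneg ((one_le_div ht).2 htt)
  have hs0 : ∀ j, 0 ≤ V.indicator (fun z => |g j z| ^ q) (x, x + a j) := fun j =>
    indicator_nonneg (fun _ _ => Real.rpow_nonneg (abs_nonneg _) _) _
  have hj : ∀ j, ∫⁻ y in Ω \ singularBalls a x t, {y | ‖x + a j - y‖ < δ}.indicator (fun y =>
      ENNReal.ofReal (V.indicator (fun z => |g j z| ^ q) (x, x + a j)) *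
        ENNReal.ofReal (‖x + a j - y‖ ^ (-(n : ℝ))) +
      ENNReal.ofReal c * ENNReal.ofReal (‖x + a j - y‖ ^ (ε - (n : ℝ)))) y ≤
      ENNReal.ofReal (V.indicator (fun z => |g j z| ^ q) (x, x + a j) *
        (sphereArea n / n * Real.log (t₀ / t)) + c * (sphereArea n * (δ ^ ε / ε))) := by
    intro j
    rw [lintegral_indicator (hm j), Measure.restrict_restrict (hm j),
      lintegral_add_left (by fun_prop), lintegral_const_mul _ (by fun_prop),
      lintegral_const_mul _ (by fun_prop)]
    rw [ENNReal.ofReal_add (mul_nonneg (hs0 j) (by positivity)) (by positivity),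
      ENNReal.ofReal_mul (hs0 j), ENNReal.ofReal_mul hc]
    gcongr
    · have h1 := lintegral_annulus_rpow_neg hn (r := t ^ (1 / (n : ℝ))) (R := t₀ ^ (1 / (n : ℝ)))
        (by positivity) (by gcongr) (x + a j)
      rw [← Real.div_rpow (by linarith) ht.le, Real.log_rpow (by positivity)] at h1
      rw [show sphereArea n / n * Real.log (t₀ / t) =
        sphereArea n * (1 / n * Real.log (t₀ / t)) by ring, ← h1]
      refine lintegral_mono_set fun y hy => ⟨?_, ?_⟩
      · exact not_lt.1 fun h => hy.2.2 (mem_iUnion.2 ⟨j, h⟩)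
      · have h2 : ‖x + a j - y‖ < δ := hy.1
        have h3 : 1 ≤ t₀ ^ (1 / (n : ℝ)) := Real.one_le_rpow ht₀ (by positivity)
        linarith
    · rw [← lintegral_ball_rpow hn hε hδ (x + a j)]
      exact lintegral_mono_set inter_subset_left
  unfold kernelMajorant
  rw [lintegral_add_right _ measurable_const, lintegral_finsetSum _ (fun j _ =>
    Measurable.indicator (by fun_prop) (hm j)), setLIntegral_const]
  have hS : ∑ j, (V.indicator (fun z => |g j z| ^ q) (x, x + a j) *
      (sphereArea n / n * Real.log (t₀ / t)) + c * (sphereArea n * (δ ^ ε / ε))) =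
      sphereArea n / n * shiftedSum q a g V x * Real.log (t₀ / t) +
        N * (c * (sphereArea n * (δ ^ ε / ε))) := by
    rw [Finset.sum_add_distrib, ← Finset.sum_mul, Finset.sum_const, Finset.card_univ,
      Fintype.card_fin, nsmul_eq_mul]
    unfold shiftedSum
    ring
  calc _ ≤ ∑ j, ENNReal.ofReal (V.indicator (fun z => |g j z| ^ q) (x, x + a j) *
        (sphereArea n / n * Real.log (t₀ / t)) + c * (sphereArea n * (δ ^ ε / ε))) +
        ENNReal.ofReal c * ENNReal.ofReal v := by
        gcongr with j
        · exact hj j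
        · exact (measure_mono sdiff_subset).trans hv
    _ = _ := by
        have h0 : ∀ j, 0 ≤ V.indicator (fun z => |g j z| ^ q) (x, x + a j) *
            (sphereArea n / n * Real.log (t₀ / t)) + c * (sphereArea n * (δ ^ ε / ε)) := fun j =>
          add_nonneg (mul_nonneg (hs0 j) (by positivity)) (by positivity)
        rw [← ENNReal.ofReal_sum_of_nonneg fun j _ => h0 j, ← ENNReal.ofReal_mul hc,
          ← ENNReal.ofReal_add (Finset.sum_nonneg fun j _ => h0 j) (by positivity), hS]
        congr 1
        ring

end LocalBound

/-! ### Well-definedness of the operator and the exponential inequality. -/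

section Operator

variable {n N : ℕ} {d p q : ℝ} {a : Fin N → EuclideanSpace ℝ (Fin n)}
  {g : Fin N → EuclideanSpace ℝ (Fin n) × EuclideanSpace ℝ (Fin n) → ℝ}
  {V : Set (EuclideanSpace ℝ (Fin n) × EuclideanSpace ℝ (Fin n))}
  {Ω Ω' : Set (EuclideanSpace ℝ (Fin n))} {Γ L ε δ : ℝ}

/-- The g_j are controlled only on the closure of U. Cutting them off outside Ω' × Ω makes them
bounded and measurable on the whole space without changing the values that enter Tf on Ω'. -/
lemma potentialKernel_indicator {x y : EuclideanSpace ℝ (Fin n)} (hx : x ∈ Ω') (hy : y ∈ Ω) :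
    potentialKernel d a (fun j => (Ω' ×ˢ Ω).indicator (g j)) x y = potentialKernel d a g x y := by
  unfold potentialKernel
  simp [hx, hy]

lemma potentialKernel_indicator_of_notMem {x : EuclideanSpace ℝ (Fin n)} (hx : x ∉ Ω')
    (y : EuclideanSpace ℝ (Fin n)) :
    potentialKernel d a (fun j => (Ω' ×ˢ Ω).indicator (g j)) x y = 0 := by
  unfold potentialKernel
  simp [hx]

lemma potentialOp_indicator (hΩ : MeasurableSet Ω) (f : EuclideanSpace ℝ (Fin n) → ℝ)
    {x : EuclideanSpace ℝ (Fin n)} (hx : x ∈ Ω') :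
    potentialOp d a (fun j => (Ω' ×ˢ Ω).indicator (g j)) Ω f x = potentialOp d a g Ω f x :=
  setIntegral_congr_fun hΩ fun y hy => by simp only [potentialKernel_indicator hx hy]

lemma measurable_indicator_of_continuousOn {X : Type*} [TopologicalSpace X] [MeasurableSpace X]
    [BorelSpace X] {s : Set X} (hs : MeasurableSet s) {f : X → ℝ} (hf : ContinuousOn f s) :
    Measurable (s.indicator f) := by
  classical
  rw [← piecewise_eq_indicator]
  exact hf.measurable_piecewise continuousOn_const hs

lemma IsLocalData.abs_indicator_le (h : IsLocalData a g V Ω Ω' Γ L ε δ) (j : Fin N)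
    (z : EuclideanSpace ℝ (Fin n) × EuclideanSpace ℝ (Fin n)) :
    |(Ω' ×ˢ Ω).indicator (g j) z| ≤ Γ := by
  by_cases hz : z ∈ Ω' ×ˢ Ω
  · rw [indicator_of_mem hz]; exact h.bound j z (h.sub hz)
  · rw [indicator_of_notMem hz, abs_zero]; exact h.nonneg

/-- Tonelli with x integrated first: ∫ |K(x,y)| dx over Ω' is bounded uniformly in y, so an
integrable f is enough. -/
lemma integrable_potentialKernel_mul (hn : 0 < n) (hd : 0 < d) (hdn : d < n) (hΓ0 : 0 ≤ Γ)
    (hgm : ∀ j, Measurable (g j)) (hΓ : ∀ j z, |g j z| ≤ Γ) (hΩf' : volume Ω' ≠ ∞)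
    {f : EuclideanSpace ℝ (Fin n) → ℝ} (hf : IntegrableOn f Ω) :
    Integrable (fun z : EuclideanSpace ℝ (Fin n) × EuclideanSpace ℝ (Fin n) =>
      potentialKernel d a g z.1 z.2 * f z.2)
      ((volume.restrict Ω').prod (volume.restrict Ω)) := by
  have hK : Measurable fun z : EuclideanSpace ℝ (Fin n) × EuclideanSpace ℝ (Fin n) =>
      potentialKernel d a g z.1 z.2 := measurable_potentialKernel hgm
  have hmeas : AEStronglyMeasurable (fun z : EuclideanSpace ℝ (Fin n) × EuclideanSpace ℝ (Fin n) =>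
      potentialKernel d a g z.1 z.2 * f z.2)
      ((volume.restrict Ω').prod (volume.restrict Ω)) :=
    hK.aestronglyMeasurable.mul hf.aestronglyMeasurable.comp_snd
  refine ⟨hmeas, ?_⟩
  unfold HasFiniteIntegral
  rw [lintegral_prod_symm _ hmeas.enorm]
  set C := ENNReal.ofReal (Γ * (N * (sphereArea n / d + 1))) * volume Ω' ^ (d / n) with hC
  have hCt : C ≠ ∞ := ENNReal.mul_ne_top ENNReal.ofReal_ne_top
    (ENNReal.rpow_ne_top_of_nonneg (by positivity) hΩf')
  calc ∫⁻ y in Ω, ∫⁻ x in Ω', ‖potentialKernel d a g x y * f y‖ₑ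
      ≤ ∫⁻ y in Ω, C * ‖f y‖ₑ := by
        refine lintegral_mono fun y => ?_
        simp_rw [enorm_mul]
        have hm : Measurable fun x => ‖potentialKernel d a g x y‖ₑ :=
          (hK.comp (measurable_id.prodMk measurable_const)).enorm
        rw [lintegral_mul_const _ hm]
        gcongr
        exact lintegral_kernel_left_le hn hd hdn hΓ0 hΓ hΩf' y
    _ = C * ∫⁻ y in Ω, ‖f y‖ₑ := lintegral_const_mul' _ _ hCt
    _ < ∞ := ENNReal.mul_lt_top hCt.lt_top hf.2

/-- The operator is well defined on integrable functions. -/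
lemma IsLocalData.operator_wellDefined (h : IsLocalData a g V Ω Ω' Γ L ε δ) (hn : 0 < n)
    (hd : 0 < d) (hdn : d < n) (hΩ : MeasurableSet Ω) (hΩ' : MeasurableSet Ω')
    (hgm : ∀ j, Measurable ((Ω' ×ˢ Ω).indicator (g j))) (hΩf' : volume Ω' ≠ ∞)
    {f : EuclideanSpace ℝ (Fin n) → ℝ} (hf : IntegrableOn f Ω) :
    (∀ᵐ x ∂(volume.restrict Ω'), IntegrableOn (fun y => potentialKernel d a g x y * f y) Ω) ∧
      AEMeasurable (potentialOp d a g Ω f) (volume.restrict Ω') := by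
  have hint := integrable_potentialKernel_mul (a := a) hn hd hdn h.nonneg hgm
    h.abs_indicator_le hΩf' hf
  constructor
  · filter_upwards [hint.prod_right_ae, ae_restrict_mem hΩ'] with x hx hxΩ
    refine IntegrableOn.congr_fun hx (fun y hy => ?_) hΩ
    simp only [potentialKernel_indicator hxΩ hy]
  · refine (hint.aestronglyMeasurable.integral_prod_right').aemeasurable.congr ?_
    filter_upwards [ae_restrict_mem hΩ'] with x hx
    exact potentialOp_indicator hΩ f hx

lemma IsLocalData.shiftedSum_le (h : IsLocalData a g V Ω Ω' Γ L ε δ) (hq : 0 ≤ q)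
    {x : EuclideanSpace ℝ (Fin n)} (hx : x ∈ Ω') :
    shiftedSum q a g V x ≤ supShiftedSum q a g V Ω' := by
  refine le_csSup ⟨N * Γ ^ q, ?_⟩ (mem_image_of_mem _ hx)
  rintro _ ⟨z, _, rfl⟩
  unfold shiftedSum
  have hΓ := h.nonneg
  calc _ ≤ ∑ _j : Fin N, Γ ^ q := by
        refine Finset.sum_le_sum fun j _ => ?_
        by_cases hz : (z, z + a j) ∈ V
        · rw [indicator_of_mem hz]
          exact Real.rpow_le_rpow (abs_nonneg _) (h.bound j _ hz) hq
        · rw [indicator_of_notMem hz]; positivity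
    _ = _ := by simp

/-- Spheres are null, so the norm can serve as the auxiliary function ρ that cuts level sets. -/
lemma volume_restrict_norm_eq (hn : 0 < n) (Ω : Set (EuclideanSpace ℝ (Fin n))) (r : ℝ) :
    volume.restrict Ω {y : EuclideanSpace ℝ (Fin n) | ‖y‖ = r} = 0 := by
  have : Nonempty (Fin n) := ⟨⟨0, hn⟩⟩
  have h1 : {y : EuclideanSpace ℝ (Fin n) | ‖y‖ = r} = Metric.sphere 0 r := by ext; simp
  rw [h1]
  exact le_antisymm ((Measure.restrict_apply_le _ _).trans
    (Measure.addHaar_sphere volume 0 r).le) bot_le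

/-- The level sets of the potentials of normalized functions. -/
lemma IsLocalData.exists_levels_le (h : IsLocalData a g V Ω Ω' Γ L ε δ) (hn : 0 < n)
    (hd : 0 < d) (hdn : d < n) (hε : ε ≤ n - d) (hpq : p.HolderConjugate q) (hdp : d / n = 1 / p)
    (hdq : (d - n) * q = -n) (hΩ : MeasurableSet Ω)
    (hgm : ∀ j, Measurable ((Ω' ×ˢ Ω).indicator (g j))) (hΩf : volume Ω ≠ ∞)
    (hΩf' : volume Ω' ≠ ∞) (hM : 0 < supShiftedSum q a g V Ω') :
    ∃ C' : ℝ≥0, ∀ f : EuclideanSpace ℝ (Fin n) → ℝ≥0∞, Measurable f →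
      ∫⁻ y in Ω, f y ^ p = 1 →
      ∑' m : ℕ, ENNReal.ofReal (Real.exp m) * volume.restrict Ω'
        {x | ENNReal.ofReal (sphereArea n / n * supShiftedSum q a g V Ω' * m) ≤
          (∫⁻ y in Ω, ‖potentialKernel d a (fun j => (Ω' ×ˢ Ω).indicator (g j)) x y‖ₑ * f y) ^ q}
        ≤ C' := by
  have hω := sphereArea_pos hn
  have hn' : (0 : ℝ) < n := by exact_mod_cast hn
  have hq1 : 1 ≤ q := hpq.symm.lt.le
  have hΓ := h.nonneg
  set M := supShiftedSum q a g V Ω' with hMdef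
  have : IsFiniteMeasure (volume.restrict Ω) := ⟨by simpa using hΩf.lt_top⟩
  have : IsFiniteMeasure (volume.restrict Ω') := ⟨by simpa using hΩf'.lt_top⟩
  obtain ⟨c, hc, hmaj⟩ := h.exists_majorant hq1 hdq hdn hε
  set g' := fun j => (Ω' ×ˢ Ω).indicator (g j) with hg'
  have hgΓ : ∀ j z, |g' j z| ≤ Γ := h.abs_indicator_le
  -- The value |Ω'| bounds every level set; the 1 makes the δ-balls lie within radius t₀^(1/n).
  set t₀ := max 1 (volume Ω').toReal with ht₀
  have ht₀1 : 1 ≤ t₀ := le_max_left _ _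
  have hε0 := h.exp_pos
  have hδ0 := h.rad_pos
  have hnn : (0 : ℝ) ≤ sphereArea n / n := by positivity
  have hnd : (0 : ℝ) ≤ sphereArea n / d := by positivity
  refine exists_tsum_levels_le (ρ := fun y => ‖y‖) measurable_norm (volume_restrict_norm_eq hn Ω)
    hpq (k := fun x y => ‖potentialKernel d a g' x y‖ₑ) (measurable_potentialKernel hgm).enorm
    (C := Γ * (N * (sphereArea n / d + 1 + N * (sphereArea n / n))))
    (B := N * (c * (sphereArea n * (δ ^ ε / ε))) + c * (volume Ω).toReal)
    (D := Γ ^ q * N ^ (q - 1) * (N * (sphereArea n / n + 1))) (t₀ := t₀)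
    (G := singularBalls a) (by positivity) (by positivity) (by positivity) (by positivity)
    (by positivity) ?_ (measurableSet_singularBalls a) ?_ ?_ ?_ ?_
  · rw [Measure.restrict_apply_univ, ← ENNReal.ofReal_toReal hΩf']
    exact ENNReal.ofReal_le_ofReal (le_max_right _ _)
  · intro S hS y
    rw [Measure.restrict_restrict hS, Measure.restrict_apply hS, ← hdp]
    refine (lintegral_kernel_left_le hn hd hdn hΓ hgΓ
      (measure_ne_top_of_subset inter_subset_right hΩf') y).trans ?_
    have hle : sphereArea n / d + 1 ≤ sphereArea n / d + 1 + N * (sphereArea n / n) :=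
      le_add_of_nonneg_right (by positivity)
    gcongr
  · intro x t ht
    refine (lintegral_mono' (Measure.restrict_mono subset_rfl Measure.restrict_le_self)
      le_rfl).trans ?_
    rw [← hdp]
    refine (setLIntegral_singularBalls_le hn hd hdn hΓ hgΓ x ht).trans ?_
    gcongr
    linarith
  · intro x t ht htt
    rw [Measure.restrict_restrict (measurableSet_singularBalls a x t).compl]
    by_cases hx : x ∈ Ω'
    · rw [inter_comm, ← Set.sdiff_eq]
      calc _ ≤ ∫⁻ y in Ω \ singularBalls a x t, kernelMajorant a g V q ε δ c x y := by
            refine setLIntegral_mono' (hΩ.diff (measurableSet_singularBalls a x t)) fun y hy => ?_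
            simp only [hg', potentialKernel_indicator hx hy.1]
            exact hmaj x hx y hy.1
        _ ≤ _ := setLIntegral_kernelMajorant_le hn hε0 hδ0 h.rad_le hc
            (ENNReal.ofReal_toReal hΩf).ge ENNReal.toReal_nonneg ht₀1 ht htt x
        _ ≤ _ := by
            have hlog : 0 ≤ Real.log (t₀ / t) := Real.log_nonneg ((one_le_div ht).2 htt)
            have := h.shiftedSum_le (q := q) (by linarith) hx
            gcongr
    · simp only [hg', potentialKernel_indicator_of_notMem hx, enorm_zero,
        ENNReal.zero_rpow_of_pos hpq.symm.pos, lintegral_zero]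
      exact bot_le
  · intro x t₁ t₂ F ht₂ ht ht₁ hF hFt
    rw [Measure.restrict_restrict (hF.diff (measurableSet_singularBalls a x t₂))]
    rw [Measure.restrict_apply hF] at hFt
    rw [show (F \ singularBalls a x t₂) ∩ Ω = (F ∩ Ω) \ singularBalls a x t₂ by
      ext; simp; tauto]
    exact setLIntegral_sdiff_singularBalls_le hn hq1 hdq hΓ hgΓ x ht₂ ht hFt

/-- The single term m = ⌊v⌋ suffices, at the cost of a factor e. -/
lemma ofReal_exp_le_tsum {v : ℝ} (hv : 0 ≤ v) :
    ENNReal.ofReal (Real.exp v) ≤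
      ∑' m : ℕ, ENNReal.ofReal (Real.exp 1) * (ENNReal.ofReal (Real.exp m) *
        {m : ℕ | (m : ℝ) ≤ v}.indicator (fun _ => 1) m) := by
  refine le_trans ?_ (ENNReal.le_tsum ⌊v⌋₊)
  rw [indicator_of_mem (show ⌊v⌋₊ ∈ {m : ℕ | (m : ℝ) ≤ v} from Nat.floor_le hv), mul_one,
    ← ENNReal.ofReal_mul (by positivity), ← Real.exp_add]
  refine ENNReal.ofReal_le_ofReal (Real.exp_le_exp.2 ?_)
  linarith [Nat.lt_floor_add_one v]

/-- The exponential inequality. -/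
lemma IsLocalData.exists_expIntegral_le (h : IsLocalData a g V Ω Ω' Γ L ε δ) (hn : 0 < n)
    (hd : 0 < d) (hdn : d < n) (hε : ε ≤ n - d) (hpq : p.HolderConjugate q) (hdp : d / n = 1 / p)
    (hdq : (d - n) * q = -n) (hΩ : MeasurableSet Ω) (hΩ' : MeasurableSet Ω')
    (hgm : ∀ j, Measurable ((Ω' ×ˢ Ω).indicator (g j))) (hΩf : volume Ω ≠ ∞)
    (hΩf' : volume Ω' ≠ ∞) (hM : 0 < supShiftedSum q a g V Ω') :
    ∃ C : ℝ, ∀ f : EuclideanSpace ℝ (Fin n) → ℝ,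
      MemLp f (ENNReal.ofReal p) (volume.restrict Ω) →
      expIntegral d p q (n / (sphereArea n * supShiftedSum q a g V Ω')) a g Ω Ω' f
        ≤ ENNReal.ofReal C := by
  have hω := sphereArea_pos hn
  have hn' : (0 : ℝ) < n := by exact_mod_cast hn
  have hp := hpq.pos
  have hq := hpq.symm.pos
  obtain ⟨C', hC'⟩ := h.exists_levels_le hn hd hdn hε hpq hdp hdq hΩ hgm hΩf hΩf' hM
  set M := supShiftedSum q a g V Ω' with hMdef
  set A := sphereArea n / n * M with hA
  have hA0 : 0 < A := by positivity
  have hα : n / (sphereArea n * M) = A⁻¹ := by rw [hA]; field_simp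
  rw [hα]
  -- The first entry covers f of norm zero: division by zero makes the exponent 0 and the integral
  -- |Ω'|.
  refine ⟨max (volume Ω').toReal (Real.exp 1 * C'), fun f hf => ?_⟩
  set c := lpNormOn p Ω f with hc
  have hc0 : 0 ≤ c := ENNReal.toReal_nonneg
  unfold expIntegral
  rw [← hc]
  rcases hc0.eq_or_lt with hc00 | hcpos
  · rw [← hc00]
    simp only [div_zero, Real.zero_rpow hq.ne', mul_zero, Real.exp_zero, ENNReal.ofReal_one,
      lintegral_one, Measure.restrict_apply_univ]
    exact (ENNReal.ofReal_toReal hΩf').ge.trans (ENNReal.ofReal_le_ofReal (le_max_left _ _))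
  have hfs := hf.aestronglyMeasurable
  -- The level-set estimate asks for a measurable function of norm 1, so the measurable
  -- representative of f is normalized.
  set F : EuclideanSpace ℝ (Fin n) → ℝ≥0∞ := fun y => ‖hfs.mk f y‖ₑ / ENNReal.ofReal c with hF
  have hFm : Measurable F := (hfs.stronglyMeasurable_mk.measurable.enorm).div_const _
  have hFae : F =ᵐ[volume.restrict Ω] fun y => ‖f y‖ₑ / ENNReal.ofReal c := by
    filter_upwards [hfs.ae_eq_mk] with y hy
    simp only [hF, hy]
  have hcE : eLpNorm f (ENNReal.ofReal p) (volume.restrict Ω) = ENNReal.ofReal c :=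
    (ENNReal.ofReal_toReal hf.2.ne).symm
  have hpne : ENNReal.ofReal p ≠ 0 := by simpa using hp
  have hcp : ∫⁻ y in Ω, ‖f y‖ₑ ^ p = ENNReal.ofReal c ^ p := by
    rw [← hcE, eLpNorm_eq_lintegral_rpow_enorm_toReal hpne ENNReal.ofReal_ne_top,
      ENNReal.toReal_ofReal hp.le, ← ENNReal.rpow_mul, one_div_mul_cancel hp.ne', ENNReal.rpow_one]
  have hc' : ENNReal.ofReal c ≠ 0 := by simpa using hcpos
  have hF1 : ∫⁻ y in Ω, F y ^ p = 1 := by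
    have h1 : ∫⁻ y in Ω, F y ^ p = ∫⁻ y in Ω, ‖f y‖ₑ ^ p * (ENNReal.ofReal c ^ p)⁻¹ := by
      refine lintegral_congr_ae ?_
      filter_upwards [hFae] with y hy
      rw [hy, div_eq_mul_inv, ENNReal.mul_rpow_of_nonneg _ _ hp.le, ENNReal.inv_rpow]
    rw [h1, lintegral_mul_const' _ _ (ENNReal.inv_ne_top.2 (by
      rw [ENNReal.ofReal_rpow_of_pos hcpos]; simp; positivity)), hcp]
    refine ENNReal.mul_inv_cancel ?_ ?_
    · rw [ENNReal.ofReal_rpow_of_pos hcpos]; simp; positivity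
    · rw [ENNReal.ofReal_rpow_of_pos hcpos]; exact ENNReal.ofReal_ne_top
  set k := fun x y => ‖potentialKernel d a (fun j => (Ω' ×ˢ Ω).indicator (g j)) x y‖ₑ with hk
  have hkm : Measurable (Function.uncurry k) := (measurable_potentialKernel hgm).enorm
  set u := fun x => ∫⁻ y in Ω, k x y * F y with hu
  have hum : Measurable u := by
    have hkf : Measurable (Function.uncurry fun x y => k x y * F y) :=
      hkm.mul (hFm.comp measurable_snd)
    exact hkf.lintegral_prod_right'
  have hle : ∀ x ∈ Ω', ENNReal.ofReal (|potentialOp d a g Ω f x| / c) ≤ u x := by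
    intro x hx
    rw [← potentialOp_indicator hΩ f hx, ENNReal.ofReal_div_of_pos hcpos,
      ← Real.enorm_eq_ofReal_abs]
    unfold potentialOp
    have h1 : u x = ∫⁻ y in Ω,
        ‖potentialKernel d a (fun j => (Ω' ×ˢ Ω).indicator (g j)) x y * f y‖ₑ *
          (ENNReal.ofReal c)⁻¹ := by
      refine lintegral_congr_ae ?_
      filter_upwards [hFae] with y hy
      rw [hy, enorm_mul, div_eq_mul_inv, mul_assoc]
    rw [h1, lintegral_mul_const' _ _ (ENNReal.inv_ne_top.2 hc'), ← div_eq_mul_inv]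
    exact ENNReal.div_le_div_right (enorm_integral_le_lintegral_enorm _) _
  set E : ℕ → Set (EuclideanSpace ℝ (Fin n)) := fun m => {x | ENNReal.ofReal (A * m) ≤ u x ^ q}
  have hEm : ∀ m, MeasurableSet (E m) := fun m => measurableSet_le measurable_const (hum.pow_const q)
  calc ∫⁻ x in Ω', ENNReal.ofReal (Real.exp (A⁻¹ * (|potentialOp d a g Ω f x| / c) ^ q))
      ≤ ∫⁻ x in Ω', ∑' m : ℕ, ENNReal.ofReal (Real.exp 1) * (ENNReal.ofReal (Real.exp m) *
          (E m).indicator 1 x) := by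
        refine setLIntegral_mono' hΩ' fun x hx => ?_
        refine (ofReal_exp_le_tsum (by positivity)).trans ?_
        refine ENNReal.tsum_le_tsum fun m => ?_
        gcongr
        by_cases hm : (m : ℝ) ≤ A⁻¹ * (|potentialOp d a g Ω f x| / c) ^ q
        · have hx' : x ∈ E m := by
            have h1 : A * m ≤ (|potentialOp d a g Ω f x| / c) ^ q := by
              rwa [inv_mul_eq_div, le_div_iff₀ hA0, mul_comm] at hm
            refine (ENNReal.ofReal_le_ofReal h1).trans ?_
            rw [← ENNReal.ofReal_rpow_of_nonneg (by positivity) hq.le]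
            exact ENNReal.rpow_le_rpow (hle x hx) hq.le
          rw [indicator_of_mem hx']
          exact indicator_le_self' (fun _ _ => bot_le) m
        · rw [indicator_of_notMem (show m ∉ {m : ℕ | (m : ℝ) ≤ _} from hm)]
          exact bot_le
    _ = ENNReal.ofReal (Real.exp 1) *
          ∑' m : ℕ, ENNReal.ofReal (Real.exp m) * volume.restrict Ω' (E m) := by
        have hind : ∀ m, Measurable ((E m).indicator (1 : EuclideanSpace ℝ (Fin n) → ℝ≥0∞)) :=
          fun m => measurable_one.indicator (hEm m)
        rw [lintegral_tsum fun m => (((hind m).const_mul _).const_mul _).aemeasurable,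
          ← ENNReal.tsum_mul_left]
        congr 1 with m
        rw [lintegral_const_mul _ ((hind m).const_mul _), lintegral_const_mul _ (hind m),
          lintegral_indicator_one (hEm m)]
    _ ≤ ENNReal.ofReal (Real.exp 1) * C' := by
        gcongr
        exact hC' F hFm hF1
    _ ≤ _ := by
        rw [← ENNReal.ofReal_coe_nnreal, ← ENNReal.ofReal_mul (by positivity)]
        exact ENNReal.ofReal_le_ofReal (le_max_right _ _)

end Operator

/-! ### Extremal functions and pointwise lower bounds. -/

section Sharpness

variable {n N : ℕ} {d p q : ℝ}

lemma integrableOn_and_integral_eq {X : Type*} [MeasurableSpace X] {μ : Measure X} {f : X → ℝ}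
    (hf : Measurable f) (hf0 : ∀ x, 0 ≤ f x) {S : Set X} {v : ℝ} (hv : 0 ≤ v)
    (h : ∫⁻ x in S, ENNReal.ofReal (f x) ∂μ = ENNReal.ofReal v) :
    IntegrableOn f S μ ∧ ∫ x in S, f x ∂μ = v := by
  constructor
  · refine ⟨hf.aestronglyMeasurable, ?_⟩
    rw [hasFiniteIntegral_iff_ofReal (Filter.Eventually.of_forall hf0), h]
    exact ENNReal.ofReal_lt_top
  · rw [integral_eq_lintegral_of_nonneg_ae (Filter.Eventually.of_forall hf0)
      hf.aestronglyMeasurable, h, ENNReal.toReal_ofReal hv]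

/-- The annulus `τ ≤ |b - y| < ρ`. -/
def annulus (b : EuclideanSpace ℝ (Fin n)) (τ ρ : ℝ) : Set (EuclideanSpace ℝ (Fin n)) :=
  {y | τ ≤ ‖b - y‖ ∧ ‖b - y‖ < ρ}

lemma measurableSet_annulus (b : EuclideanSpace ℝ (Fin n)) (τ ρ : ℝ) :
    MeasurableSet (annulus b τ ρ) :=
  (measurableSet_le measurable_const (measurable_const.sub measurable_id).norm).inter
    (measurableSet_lt (measurable_const.sub measurable_id).norm measurable_const)

lemma integral_annulus (hn : 0 < n) {τ ρ : ℝ} (hτ : 0 < τ) (hτρ : τ ≤ ρ)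
    (b : EuclideanSpace ℝ (Fin n)) :
    IntegrableOn (fun y => ‖b - y‖ ^ (-(n : ℝ))) (annulus b τ ρ) ∧
      ∫ y in annulus b τ ρ, ‖b - y‖ ^ (-(n : ℝ)) = sphereArea n * Real.log (ρ / τ) :=
  integrableOn_and_integral_eq (by fun_prop) (fun _ => Real.rpow_nonneg (norm_nonneg _) _)
    (mul_nonneg (sphereArea_pos hn).le (Real.log_nonneg ((one_le_div hτ).2 hτρ)))
    (lintegral_annulus_rpow_neg hn hτ hτρ b)

lemma integral_ball_rpow (hn : 0 < n) (hdn : d < n) {ρ : ℝ} (hρ : 0 < ρ)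
    (b : EuclideanSpace ℝ (Fin n)) :
    IntegrableOn (fun y => ‖b - y‖ ^ (-d)) {y | ‖b - y‖ < ρ} ∧
      ∫ y in {y | ‖b - y‖ < ρ}, ‖b - y‖ ^ (-d) =
        sphereArea n * (ρ ^ (n - d) / (n - d)) := by
  have hdn' : 0 < (n : ℝ) - d := by linarith
  have hω := sphereArea_pos hn
  have h := lintegral_ball_rpow hn hdn' hρ b
  rw [show (n : ℝ) - d - n = -d by ring] at h
  exact integrableOn_and_integral_eq (by fun_prop) (fun _ => Real.rpow_nonneg (norm_nonneg _) _)
    (by positivity) h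

/-- The extremal functions: `∑ⱼ cⱼ |cⱼ| ^ (q - 2) |bⱼ - y| ^ (-d)` cut off to annuli. -/
noncomputable def extremal (d q : ℝ) (c : Fin N → ℝ) (b : Fin N → EuclideanSpace ℝ (Fin n))
    (τ ρ : ℝ) (y : EuclideanSpace ℝ (Fin n)) : ℝ :=
  ∑ j, (annulus (b j) τ ρ).indicator
    (fun y => c j * |c j| ^ (q - 2) * ‖b j - y‖ ^ (-d)) y

lemma measurable_extremal (c : Fin N → ℝ) (b : Fin N → EuclideanSpace ℝ (Fin n)) (τ ρ : ℝ) :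
    Measurable (extremal d q c b τ ρ) :=
  Finset.measurable_sum _ fun j _ =>
    Measurable.indicator (by fun_prop) (measurableSet_annulus (b j) τ ρ)

lemma annulus_disjoint {b : Fin N → EuclideanSpace ℝ (Fin n)} {τ ρ : ℝ}
    (hsep : ∀ i j, i ≠ j → 2 * ρ ≤ ‖b i - b j‖) {i j : Fin N} (hij : i ≠ j)
    {y : EuclideanSpace ℝ (Fin n)} (hy : y ∈ annulus (b j) τ ρ) : y ∉ annulus (b i) τ ρ := by
  intro hi
  have h1 := hsep i j hij
  have h2 : ‖b i - b j‖ ≤ ‖b i - y‖ + ‖b j - y‖ := by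
    have := norm_sub_le (b i - y) (b j - y)
    rwa [sub_sub_sub_cancel_right] at this
  linarith [hi.2, hy.2]

lemma sum_indicator_annulus {b : Fin N → EuclideanSpace ℝ (Fin n)} {τ ρ : ℝ}
    (hsep : ∀ i j, i ≠ j → 2 * ρ ≤ ‖b i - b j‖) {j : Fin N}
    {y : EuclideanSpace ℝ (Fin n)} (hy : y ∈ annulus (b j) τ ρ)
    {R : Type*} [AddCommMonoid R] (φ : Fin N → EuclideanSpace ℝ (Fin n) → R) :
    ∑ i, (annulus (b i) τ ρ).indicator (φ i) y = φ j y := by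
  rw [Finset.sum_eq_single j (fun i _ hij => indicator_of_notMem (annulus_disjoint hsep hij hy) _)
    (fun h => absurd (Finset.mem_univ j) h), indicator_of_mem hy]

lemma sum_indicator_annulus_of_notMem {b : Fin N → EuclideanSpace ℝ (Fin n)} {τ ρ : ℝ}
    {y : EuclideanSpace ℝ (Fin n)} (hy : ∀ j, y ∉ annulus (b j) τ ρ)
    {R : Type*} [AddCommMonoid R] (φ : Fin N → EuclideanSpace ℝ (Fin n) → R) :
    ∑ i, (annulus (b i) τ ρ).indicator (φ i) y = 0 :=
  Finset.sum_eq_zero fun i _ => indicator_of_notMem (hy i) _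

/-- At c = 0 the factor c cancels whatever value 0 ^ (q - 2) takes. -/
lemma abs_mul_rpow_sub_two (hq : 1 < q) (c : ℝ) : |c * |c| ^ (q - 2)| = |c| ^ (q - 1) := by
  rw [abs_mul, abs_of_nonneg (Real.rpow_nonneg (abs_nonneg c) _)]
  rcases eq_or_ne c 0 with rfl | hc
  · simp [Real.zero_rpow (by linarith : q - 1 ≠ 0)]
  · rw [show q - 1 = 1 + (q - 2) by ring, Real.rpow_add (abs_pos.2 hc), Real.rpow_one]

/-- The annuli are disjoint, and (q - 1) p = q, d p = n turn the p-th power into ∑ |c_j|^q |b_j -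
y|^(-n). This is also the leading part of the kernel times the function, as in the equality case of
Hölder. -/
lemma lintegral_extremal (hn : 0 < n) (hpq : p.HolderConjugate q) (hdp : d * p = n)
    {c : Fin N → ℝ} {b : Fin N → EuclideanSpace ℝ (Fin n)} {τ ρ : ℝ} (hτ : 0 < τ) (hτρ : τ ≤ ρ)
    (hsep : ∀ i j, i ≠ j → 2 * ρ ≤ ‖b i - b j‖)
    {Ω : Set (EuclideanSpace ℝ (Fin n))} (hΩ : ∀ j, annulus (b j) τ ρ ⊆ Ω) :
    ∫⁻ y in Ω, ‖extremal d q c b τ ρ y‖ₑ ^ p =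
      ENNReal.ofReal ((∑ j, |c j| ^ q) * (sphereArea n * Real.log (ρ / τ))) := by
  have hp := hpq.pos
  have hω := sphereArea_pos hn
  have hlog : 0 ≤ Real.log (ρ / τ) := Real.log_nonneg ((one_le_div hτ).2 hτρ)
  have h1 : ∀ y, ‖extremal d q c b τ ρ y‖ₑ ^ p = ∑ j, (annulus (b j) τ ρ).indicator
      (fun y => ENNReal.ofReal (|c j| ^ q) * ENNReal.ofReal (‖b j - y‖ ^ (-(n : ℝ)))) y := by
    intro y
    by_cases hy : ∃ j, y ∈ annulus (b j) τ ρ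
    · obtain ⟨j, hj⟩ := hy
      unfold extremal
      rw [sum_indicator_annulus hsep hj, sum_indicator_annulus hsep hj, Real.enorm_eq_ofReal_abs,
        ENNReal.ofReal_rpow_of_nonneg (abs_nonneg _) hp.le, abs_mul,
        abs_mul_rpow_sub_two hpq.symm.lt, abs_of_nonneg (Real.rpow_nonneg (norm_nonneg _) _),
        Real.mul_rpow (by positivity) (by positivity), ← Real.rpow_mul (abs_nonneg _),
        ← Real.rpow_mul (norm_nonneg _), hpq.symm.sub_one_mul_conj, neg_mul, hdp,
        ENNReal.ofReal_mul (by positivity)]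
    · push Not at hy
      unfold extremal
      rw [sum_indicator_annulus_of_notMem hy, sum_indicator_annulus_of_notMem hy]
      simp [hp]
  simp_rw [h1]
  rw [lintegral_finsetSum _ (fun j _ => Measurable.indicator (by fun_prop)
    (measurableSet_annulus (b j) τ ρ)), Finset.sum_mul, ENNReal.ofReal_sum_of_nonneg
    (fun j _ => by positivity)]
  refine Finset.sum_congr rfl fun j _ => ?_
  rw [lintegral_indicator (measurableSet_annulus (b j) τ ρ),
    Measure.restrict_restrict (measurableSet_annulus (b j) τ ρ), inter_eq_left.2 (hΩ j),
    lintegral_const_mul _ (by fun_prop), ENNReal.ofReal_mul (by positivity)]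
  congr 1
  exact lintegral_annulus_rpow_neg hn hτ hτρ (b j)

lemma memLp_extremal (hn : 0 < n) (hpq : p.HolderConjugate q) (hdp : d * p = n)
    {c : Fin N → ℝ} {b : Fin N → EuclideanSpace ℝ (Fin n)} {τ ρ : ℝ} (hτ : 0 < τ) (hτρ : τ ≤ ρ)
    (hsep : ∀ i j, i ≠ j → 2 * ρ ≤ ‖b i - b j‖)
    {Ω : Set (EuclideanSpace ℝ (Fin n))} (hΩ : ∀ j, annulus (b j) τ ρ ⊆ Ω) :
    MemLp (extremal d q c b τ ρ) (ENNReal.ofReal p) (volume.restrict Ω) ∧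
      lpNormOn p Ω (extremal d q c b τ ρ) =
        ((∑ j, |c j| ^ q) * (sphereArea n * Real.log (ρ / τ))) ^ (1 / p) := by
  have hp := hpq.pos
  have hω := sphereArea_pos hn
  have hlog : 0 ≤ Real.log (ρ / τ) := Real.log_nonneg ((one_le_div hτ).2 hτρ)
  have h0 : 0 ≤ (∑ j, |c j| ^ q) * (sphereArea n * Real.log (ρ / τ)) :=
    mul_nonneg (Finset.sum_nonneg fun j _ => by positivity) (by positivity)
  have h1 : eLpNorm (extremal d q c b τ ρ) (ENNReal.ofReal p) (volume.restrict Ω) =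
      ENNReal.ofReal (((∑ j, |c j| ^ q) * (sphereArea n * Real.log (ρ / τ))) ^ (1 / p)) := by
    rw [eLpNorm_eq_lintegral_rpow_enorm_toReal (by simpa using hp) ENNReal.ofReal_ne_top,
      ENNReal.toReal_ofReal hp.le, lintegral_extremal hn hpq hdp hτ hτρ hsep hΩ,
      ENNReal.ofReal_rpow_of_nonneg h0 (by positivity)]
  refine ⟨⟨(measurable_extremal c b τ ρ).aestronglyMeasurable, ?_⟩, ?_⟩
  · rw [h1]; exact ENNReal.ofReal_lt_top
  · unfold lpNormOn
    rw [h1, ENNReal.toReal_ofReal (by positivity)]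

lemma abs_sum_erase_rpow_le (hdn : d < n) {a : Fin N → EuclideanSpace ℝ (Fin n)}
    {g : Fin N → EuclideanSpace ℝ (Fin n) × EuclideanSpace ℝ (Fin n) → ℝ}
    {x y : EuclideanSpace ℝ (Fin n)} {ρ Γ : ℝ} (hΓ0 : 0 ≤ Γ) (hρ : 0 < ρ)
    (hsep : ∀ i j, i ≠ j → 4 * ρ ≤ ‖a i - a j‖) (hΓ : ∀ j, |g j (x, y)| ≤ Γ) {j : Fin N}
    (hxy : ‖x + a j - y‖ ≤ 2 * ρ) :
    |∑ i ∈ Finset.univ.erase j, g i (x, y) * ‖x + a i - y‖ ^ (d - (n : ℝ))| ≤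
      N * (Γ * ρ ^ (d - (n : ℝ))) := by
  calc _ ≤ ∑ i ∈ Finset.univ.erase j, |g i (x, y) * ‖x + a i - y‖ ^ (d - (n : ℝ))| :=
        Finset.abs_sum_le_sum_abs _ _
    _ ≤ ∑ i ∈ Finset.univ.erase j, Γ * ρ ^ (d - (n : ℝ)) := by
        refine Finset.sum_le_sum fun i hi => ?_
        have hij : i ≠ j := Finset.ne_of_mem_erase hi
        have h3 := hsep i j hij
        have h4 : ‖a i - a j‖ ≤ ‖x + a i - y‖ + ‖x + a j - y‖ := by
          have := norm_sub_le (x + a i - y) (x + a j - y)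
          rwa [show x + a i - y - (x + a j - y) = a i - a j by abel] at this
        have h5 : ρ ≤ ‖x + a i - y‖ := by linarith
        rw [abs_mul, abs_of_nonneg (Real.rpow_nonneg (norm_nonneg _) _)]
        have h6 := Real.rpow_le_rpow_of_nonpos hρ h5 (by linarith : d - (n : ℝ) ≤ 0)
        have h7 := hΓ i
        gcongr
    _ ≤ _ := by
        rw [Finset.sum_const, nsmul_eq_mul]
        have : (Finset.univ.erase j).card ≤ N := by simp
        gcongr

lemma one_sub_mul_rpow_le (hq : 0 < q) {c γ η : ℝ} (h3 : c ≠ 0 → |γ - c| ≤ η * |c|) :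
    (1 - η) * |c| ^ q ≤ c * |c| ^ (q - 2) * γ := by
  rcases eq_or_ne (c) 0 with hc | hc
  · rw [hc]; simp [Real.zero_rpow (by linarith : q ≠ 0)]
  · have h3 := h3 hc
    have hcp : 0 < |c| := abs_pos.2 hc
    have h4 : |c| ^ q = |c| ^ (q - 2) * c ^ 2 := by
      rw [← sq_abs c, ← Real.rpow_natCast |c| 2, ← Real.rpow_add hcp]
      congr 1; push_cast; ring
    have h5 : (1 - η) * c ^ 2 ≤ c * γ := by
      have h6 : |c * (γ - c)| ≤ η * c ^ 2 := by
        rw [abs_mul, ← sq_abs c]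
        nlinarith
      have := neg_abs_le (c * (γ - c))
      nlinarith
    have h7 : 0 ≤ |c| ^ (q - 2) := by positivity
    rw [h4]
    nlinarith [mul_le_mul_of_nonneg_left h5 h7]

/-- The pointwise lower bound for the kernel times the extremal function. -/
lemma le_potentialKernel_mul_extremal (hq : 1 < q) (hdn : d < n)
    {a : Fin N → EuclideanSpace ℝ (Fin n)}
    {g : Fin N → EuclideanSpace ℝ (Fin n) × EuclideanSpace ℝ (Fin n) → ℝ}
    {c : Fin N → ℝ} {z x y : EuclideanSpace ℝ (Fin n)} {τ ρ η Γ : ℝ} (hτ : 0 < τ) (hτρ : τ ≤ ρ)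
    (hη : 0 < η) (hη1 : η < 1) (hΓ0 : 0 ≤ Γ)
    (hsep : ∀ i j, i ≠ j → 4 * ρ ≤ ‖a i - a j‖) (hx : ‖x - z‖ < η * τ)
    (hΓ : ∀ j, |g j (x, y)| ≤ Γ)
    (hgc : ∀ j, c j ≠ 0 → y ∈ annulus (z + a j) τ ρ → |g j (x, y) - c j| ≤ η * |c j|) :
    ∑ j, (annulus (z + a j) τ ρ).indicator (fun y => ((1 - η) * (1 + η) ^ (d - (n : ℝ)) *
        |c j| ^ q) * ‖z + a j - y‖ ^ (-(n : ℝ))) y -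
      ∑ j, {y | ‖z + a j - y‖ < ρ}.indicator (fun y => |c j| ^ (q - 1) *
        (N * (Γ * ρ ^ (d - (n : ℝ)))) * ‖z + a j - y‖ ^ (-d)) y ≤
      potentialKernel d a g x y * extremal d q c (fun j => z + a j) τ ρ y := by
  have hρ : 0 < ρ := hτ.trans_le hτρ
  have hsep' : ∀ i j, i ≠ j → 2 * ρ ≤ ‖(fun j => z + a j) i - (fun j => z + a j) j‖ := by
    intro i j hij
    have := hsep i j hij
    simp only [add_sub_add_left_eq_sub]
    linarith
  have hpos : ∀ j, 0 ≤ {y | ‖z + a j - y‖ < ρ}.indicator (fun y => |c j| ^ (q - 1) *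
        (N * (Γ * ρ ^ (d - (n : ℝ)))) * ‖z + a j - y‖ ^ (-d)) y := fun j =>
    indicator_nonneg (fun _ _ => by positivity) _
  by_cases hy : ∃ j, y ∈ annulus ((fun j => z + a j) j) τ ρ
  swap
  · push Not at hy
    unfold extremal
    rw [sum_indicator_annulus_of_notMem hy, sum_indicator_annulus_of_notMem hy, mul_zero, zero_sub,
      neg_nonpos]
    exact Finset.sum_nonneg fun j _ => hpos j
  obtain ⟨j, hj⟩ := hy
  unfold extremal
  have h1 := sum_indicator_annulus hsep' hj (fun j y => ((1 - η) * (1 + η) ^ (d - (n : ℝ)) *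
    |c j| ^ q) * ‖z + a j - y‖ ^ (-(n : ℝ)))
  have h2 := sum_indicator_annulus hsep' hj
    (fun j y => c j * |c j| ^ (q - 2) * ‖z + a j - y‖ ^ (-d))
  rw [h1, h2]
  have hw1 : τ ≤ ‖z + a j - y‖ := hj.1
  have hw2 : ‖z + a j - y‖ < ρ := hj.2
  set w := ‖z + a j - y‖ with hw
  have hw0 : 0 < w := hτ.trans_le hw1
  -- Moving x from z by less than η τ changes distances on the annulus by at most the fraction η, so
  -- the kernel loses no more than (1 + η)^(d-n).
  have hητ : η * τ ≤ η * w := by gcongr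
  have hxz : x + a j - y = (z + a j - y) + (x - z) := by abel
  have hup : ‖x + a j - y‖ ≤ (1 + η) * w := by
    rw [hxz]
    refine (norm_add_le _ _).trans ?_
    linarith
  have hlo : 0 < ‖x + a j - y‖ := by
    have := norm_sub_le (x + a j - y) (x - z)
    rw [hxz, add_sub_cancel_right, ← hw, ← hxz] at this
    nlinarith
  have hpw : (1 + η) ^ (d - (n : ℝ)) * w ^ (d - (n : ℝ)) ≤ ‖x + a j - y‖ ^ (d - (n : ℝ)) := by
    rw [← Real.mul_rpow (by linarith) hw0.le]
    exact Real.rpow_le_rpow_of_nonpos hlo hup (by linarith)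
  set P := ‖x + a j - y‖ ^ (d - (n : ℝ)) with hP
  set s := c j * |c j| ^ (q - 2) with hs
  have hsabs : |s| = |c j| ^ (q - 1) := abs_mul_rpow_sub_two hq (c j)
  have hrest := abs_sum_erase_rpow_le (d := d) hdn hΓ0 hρ hsep hΓ (j := j) (by nlinarith)
  set R := N * (Γ * ρ ^ (d - (n : ℝ))) with hR
  have hK : potentialKernel d a g x y = g j (x, y) * P +
      ∑ i ∈ Finset.univ.erase j, g i (x, y) * ‖x + a i - y‖ ^ (d - (n : ℝ)) :=
    (Finset.add_sum_erase _ _ (Finset.mem_univ j)).symm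
  set Z := ∑ i ∈ Finset.univ.erase j, g i (x, y) * ‖x + a i - y‖ ^ (d - (n : ℝ))
  have hsg : (1 - η) * |c j| ^ q ≤ s * g j (x, y) :=
    one_sub_mul_rpow_le (by linarith) fun hc => hgc j hc hj
  have hsum : |c j| ^ (q - 1) * R * w ^ (-d) ≤
      ∑ j, {y | ‖z + a j - y‖ < ρ}.indicator (fun y => |c j| ^ (q - 1) *
        R * ‖z + a j - y‖ ^ (-d)) y := by
    refine le_trans (le_of_eq ?_)
      (Finset.single_le_sum (fun i _ => hpos i) (Finset.mem_univ j))
    rw [indicator_of_mem (show y ∈ {y | ‖z + a j - y‖ < ρ} from hw2)]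
  have hmain : (1 - η) * (1 + η) ^ (d - (n : ℝ)) * |c j| ^ q * w ^ (-(n : ℝ)) ≤
      s * g j (x, y) * P * w ^ (-d) := by
    have hwn : w ^ (-(n : ℝ)) = w ^ (d - (n : ℝ)) * w ^ (-d) := by
      rw [← Real.rpow_add hw0]; congr 1; ring
    have h3 : 0 ≤ w ^ (-d) := by positivity
    have h4 : 0 ≤ (1 - η) * |c j| ^ q := mul_nonneg (by linarith) (by positivity)
    have h5 : 0 ≤ P := by positivity
    calc _ = ((1 - η) * |c j| ^ q) * ((1 + η) ^ (d - (n : ℝ)) * w ^ (d - (n : ℝ))) * w ^ (-d) := by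
          rw [hwn]; ring
      _ ≤ ((1 - η) * |c j| ^ q) * P * w ^ (-d) :=
          mul_le_mul_of_nonneg_right (mul_le_mul_of_nonneg_left hpw h4) h3
      _ ≤ _ := mul_le_mul_of_nonneg_right (mul_le_mul_of_nonneg_right hsg h5) h3
  -- The interaction with the other poles is at most a bounded factor times w^(-d), whose integral
  -- over the ρ-ball does not depend on τ, whereas the main term grows like log(ρ / τ).
  have hcross : -(|c j| ^ (q - 1) * R * w ^ (-d)) ≤ s * Z * w ^ (-d) := by
    have h3 : 0 ≤ w ^ (-d) := by positivity
    have h4 : |s * Z| ≤ |c j| ^ (q - 1) * R := by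
      rw [abs_mul, hsabs]
      exact mul_le_mul_of_nonneg_left hrest (by positivity)
    have h5 := neg_abs_le (s * Z)
    nlinarith
  rw [hK]
  have : (g j (x, y) * P + Z) * (s * w ^ (-d)) =
    s * g j (x, y) * P * w ^ (-d) + s * Z * w ^ (-d) := by ring
  rw [this]
  linarith

end Sharpness

/-! ### Blow-up for larger exponents. -/

section SharpnessConclusion

variable {n N : ℕ} {d p q : ℝ}

/-- The potential of an extremal function near the center of its annuli. -/
lemma le_potentialOp_extremal (hn : 0 < n) (hq : 1 < q) (hdn : d < n)
    {a : Fin N → EuclideanSpace ℝ (Fin n)}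
    {g : Fin N → EuclideanSpace ℝ (Fin n) × EuclideanSpace ℝ (Fin n) → ℝ}
    {Ω : Set (EuclideanSpace ℝ (Fin n))} (hΩ : MeasurableSet Ω)
    {c : Fin N → ℝ} {z x : EuclideanSpace ℝ (Fin n)} {τ ρ η Γ : ℝ} (hτ : 0 < τ) (hτρ : τ ≤ ρ)
    (hη : 0 < η) (hη1 : η < 1) (hΓ0 : 0 ≤ Γ)
    (hsep : ∀ i j, i ≠ j → 4 * ρ ≤ ‖a i - a j‖) (hx : ‖x - z‖ < η * τ)
    (hΓ : ∀ j, ∀ y ∈ Ω, |g j (x, y)| ≤ Γ) (hball : ∀ j, {y | ‖z + a j - y‖ < ρ} ⊆ Ω)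
    (hgc : ∀ j, c j ≠ 0 → ∀ y, ‖z + a j - y‖ < ρ → |g j (x, y) - c j| ≤ η * |c j|)
    (hint : IntegrableOn (fun y => potentialKernel d a g x y *
      extremal d q c (fun j => z + a j) τ ρ y) Ω) :
    (1 - η) * (1 + η) ^ (d - (n : ℝ)) * ((∑ j, |c j| ^ q) * (sphereArea n * Real.log (ρ / τ))) -
      ∑ j, |c j| ^ (q - 1) * (N * (Γ * ρ ^ (d - (n : ℝ)))) *
        (sphereArea n * (ρ ^ (n - d) / (n - d))) ≤
      potentialOp d a g Ω (extremal d q c (fun j => z + a j) τ ρ) x := by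
  have hρ := hτ.trans_le hτρ
  have hann : ∀ j, annulus (z + a j) τ ρ ⊆ Ω := fun j y hy => hball j hy.2
  have hbm : ∀ j, MeasurableSet {y | ‖z + a j - y‖ < ρ} := fun j =>
    measurableSet_lt (by fun_prop) measurable_const
  have h1 : ∀ j, ∀ k : ℝ, IntegrableOn ((annulus (z + a j) τ ρ).indicator
      (fun y => k * ‖z + a j - y‖ ^ (-(n : ℝ)))) Ω ∧
      ∫ y in Ω, (annulus (z + a j) τ ρ).indicator (fun y => k * ‖z + a j - y‖ ^ (-(n : ℝ))) y =
        k * (sphereArea n * Real.log (ρ / τ)) := fun j k => by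
    obtain ⟨h2, h3⟩ := integral_annulus hn hτ hτρ (z + a j)
    constructor
    · exact ((integrable_indicator_iff (measurableSet_annulus _ _ _)).2
        (h2.const_mul k)).integrableOn
    · rw [setIntegral_indicator (measurableSet_annulus _ _ _), inter_eq_right.2 (hann j),
        integral_const_mul, h3]
  have h2 : ∀ j, ∀ k : ℝ, IntegrableOn ({y | ‖z + a j - y‖ < ρ}.indicator
      (fun y => k * ‖z + a j - y‖ ^ (-d))) Ω ∧
      ∫ y in Ω, {y | ‖z + a j - y‖ < ρ}.indicator (fun y => k * ‖z + a j - y‖ ^ (-d)) y =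
        k * (sphereArea n * (ρ ^ (n - d) / (n - d))) := fun j k => by
    obtain ⟨h2, h3⟩ := integral_ball_rpow hn hdn hρ (z + a j)
    constructor
    · exact ((integrable_indicator_iff (hbm j)).2 (h2.const_mul k)).integrableOn
    · rw [setIntegral_indicator (hbm j), inter_eq_right.2 (hball j), integral_const_mul, h3]
  have h3 := setIntegral_mono_on ((integrable_finsetSum Finset.univ fun j _ => (h1 j _).1).sub
      (integrable_finsetSum Finset.univ fun j _ => (h2 j _).1)) hint hΩ fun y hy =>
    le_potentialKernel_mul_extremal (q := q) hq hdn hτ hτρ hη hη1 hΓ0 hsep hx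
      (fun j => hΓ j y hy) (fun j hc hyj => hgc j hc y hyj.2)
  refine le_trans (le_of_eq ?_) h3
  rw [integral_sub' (integrable_finsetSum Finset.univ fun j _ => (h1 j _).1)
    (integrable_finsetSum Finset.univ fun j _ => (h2 j _).1),
    integral_finsetSum _ fun j _ => (h1 j _).1, integral_finsetSum _ fun j _ => (h2 j _).1]
  simp_rw [(h1 _ _).2, (h2 _ _).2]
  rw [Finset.sum_mul, Finset.mul_sum]
  congr 1
  refine Finset.sum_congr rfl fun j _ => ?_
  ring

/-- One factor κ is the loss in the kernel; a second one absorbs the bounded remainder Q, since κ t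
- Q ≥ κ² t. Division by the norm t^(1/p) leaves κ² t^(1/q). -/
lemma rpow_le_of_quotient (hpq : p.HolderConjugate q) {κ t Q X : ℝ} (hκ : 0 ≤ κ) (ht : 0 < t)
    (hQ : Q ≤ (κ - κ ^ 2) * t) (hX : κ * t - Q ≤ X) :
    κ ^ (2 * q) * t ≤ (|X| / t ^ (1 / p)) ^ q := by
  have hq := hpq.symm.pos
  have h1 : κ ^ 2 * t ^ (1 / q) ≤ |X| / t ^ (1 / p) := by
    rw [le_div_iff₀ (by positivity), mul_assoc, ← Real.rpow_add ht]
    have : 1 / q + 1 / p = 1 := by simpa [add_comm] using hpq.inv_add_inv_eq_one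
    rw [this, Real.rpow_one]
    nlinarith [le_abs_self X]
  have h2 := Real.rpow_le_rpow (by positivity) h1 hq.le
  rwa [Real.mul_rpow (by positivity) (by positivity), ← Real.rpow_mul ht.le,
    one_div_mul_cancel hq.ne', Real.rpow_one, ← Real.rpow_natCast κ 2, ← Real.rpow_mul hκ] at h2

/-- At η = 0 the right side is K, and it depends continuously on η. -/
lemma exists_slack {K : ℝ} (hK : (n : ℝ) < K) :
    ∃ η : ℝ, 0 < η ∧ η < 1 ∧ (n : ℝ) < K * ((1 - η) * (1 + η) ^ (d - (n : ℝ))) ^ (2 * q) := by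
  have hc : ContinuousAt (fun η : ℝ => K * ((1 - η) * (1 + η) ^ (d - (n : ℝ))) ^ (2 * q)) 0 := by
    refine continuousAt_const.mul (ContinuousAt.rpow_const ?_ (Or.inl (by simp)))
    exact (continuousAt_const.sub continuousAt_id).mul
      (ContinuousAt.rpow_const (continuousAt_const.add continuousAt_id) (Or.inl (by simp)))
  have h1 : ∀ᶠ η : ℝ in nhds 0, (n : ℝ) < K * ((1 - η) * (1 + η) ^ (d - (n : ℝ))) ^ (2 * q) :=
    hc.eventually_const_lt (by simpa using hK)
  have h2 : ∀ᶠ η : ℝ in nhdsWithin 0 (Ioi 0), η < 1 :=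
    nhdsWithin_le_nhds (Iio_mem_nhds one_pos)
  obtain ⟨η, ⟨h3, h4⟩, h5⟩ :=
    (((h1.filter_mono nhdsWithin_le_nhds).and h2).and self_mem_nhdsWithin).exists
  exact ⟨η, h5, h4, h3⟩

lemma exists_radius {a : Fin N → EuclideanSpace ℝ (Fin n)} (ha : Function.Injective a)
    {g : Fin N → EuclideanSpace ℝ (Fin n) × EuclideanSpace ℝ (Fin n) → ℝ}
    {Ω Ω' : Set (EuclideanSpace ℝ (Fin n))} (hΩ : IsOpen Ω) (hΩ' : IsOpen Ω')
    {z : EuclideanSpace ℝ (Fin n)} (hz : z ∈ Ω') (hza : ∀ j, z + a j ∈ Ω)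
    (hg : ∀ j, ContinuousAt (g j) (z, z + a j)) {η : ℝ} (hη : 0 < η) :
    ∃ ρ : ℝ, 0 < ρ ∧ {x | ‖x - z‖ < ρ} ⊆ Ω' ∧ (∀ j, {y | ‖z + a j - y‖ < ρ} ⊆ Ω) ∧
      (∀ i j, i ≠ j → 4 * ρ ≤ ‖a i - a j‖) ∧
      ∀ j, g j (z, z + a j) ≠ 0 → ∀ x, ‖x - z‖ < ρ → ∀ y, ‖z + a j - y‖ < ρ →
        |g j (x, y) - g j (z, z + a j)| ≤ η * |g j (z, z + a j)| := by
  have hle : ∀ c : ℝ, 0 < c → ∀ᶠ ε : ℝ in nhdsWithin 0 (Ioi 0), ε ≤ c := fun c hc =>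
    nhdsWithin_le_nhds (Iic_mem_nhds hc)
  obtain ⟨r, hr, hrΩ⟩ := Metric.isOpen_iff.1 hΩ' z hz
  have h1 : ∀ᶠ ρ : ℝ in nhdsWithin 0 (Ioi 0), ∀ j, {y | ‖z + a j - y‖ < ρ} ⊆ Ω := by
    refine Filter.eventually_all.2 fun j => ?_
    obtain ⟨s, hs, hsΩ⟩ := Metric.isOpen_iff.1 hΩ (z + a j) (hza j)
    filter_upwards [hle s hs] with ρ hρ y hy
    refine hsΩ ?_
    rw [Metric.mem_ball, dist_comm, dist_eq_norm]
    exact lt_of_lt_of_le hy hρ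
  have h2 : ∀ᶠ ρ : ℝ in nhdsWithin 0 (Ioi 0), ∀ i j, i ≠ j → 4 * ρ ≤ ‖a i - a j‖ := by
    refine Filter.eventually_all.2 fun i => Filter.eventually_all.2 fun j => ?_
    by_cases hij : i = j
    · exact Filter.Eventually.of_forall fun _ h => absurd hij h
    · have h0 : 0 < ‖a i - a j‖ / 4 := by
        have := norm_pos_iff.2 (sub_ne_zero.2 (ha.ne hij))
        positivity
      filter_upwards [hle _ h0] with δ hδ _
      linarith
  have h3 : ∀ᶠ ρ : ℝ in nhdsWithin 0 (Ioi 0),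
      ∀ j, g j (z, z + a j) ≠ 0 → ∀ x, ‖x - z‖ < ρ → ∀ y, ‖z + a j - y‖ < ρ →
        |g j (x, y) - g j (z, z + a j)| ≤ η * |g j (z, z + a j)| := by
    refine Filter.eventually_all.2 fun j => ?_
    by_cases hc : g j (z, z + a j) = 0
    · exact Filter.Eventually.of_forall fun _ h => absurd hc h
    · obtain ⟨s, hs, hsg⟩ := Metric.continuousAt_iff.1 (hg j) (η * |g j (z, z + a j)|)
        (mul_pos hη (abs_pos.2 hc))
      filter_upwards [hle s hs] with ρ hρ _ x hx y hy
      refine (hsg (x := (x, y)) ?_).le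
      rw [Prod.dist_eq, max_lt_iff, dist_eq_norm, dist_comm, dist_eq_norm]
      exact ⟨hx.trans_le hρ, hy.trans_le hρ⟩
  obtain ⟨ρ, ⟨⟨⟨hρr, hρ1⟩, hρ2⟩, hρ3⟩, hρ0⟩ :=
    (((((hle r hr).and h1).and h2).and h3).and self_mem_nhdsWithin).exists
  refine ⟨ρ, hρ0, fun x hx => hrΩ ?_, hρ1, hρ2, hρ3⟩
  rw [Metric.mem_ball, dist_eq_norm]
  exact lt_of_lt_of_le hx hρr

/-- Sharpness of the exponential constant. -/
lemma IsLocalData.not_exists_expIntegral_le {a : Fin N → EuclideanSpace ℝ (Fin n)}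
    {g : Fin N → EuclideanSpace ℝ (Fin n) × EuclideanSpace ℝ (Fin n) → ℝ}
    {V : Set (EuclideanSpace ℝ (Fin n) × EuclideanSpace ℝ (Fin n))}
    {Ω Ω' : Set (EuclideanSpace ℝ (Fin n))} {Γ L ε δ : ℝ}
    (h : IsLocalData a g V Ω Ω' Γ L ε δ) (ha : Function.Injective a) (hn : 0 < n)
    (hd : 0 < d) (hdn : d < n) (hpq : p.HolderConjugate q) (hdp : d * p = n)
    (hΩ : IsOpen Ω) (hΩ' : IsOpen Ω')
    (hgm : ∀ j, Measurable ((Ω' ×ˢ Ω).indicator (g j))) (hΩf : volume Ω ≠ ∞)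
    (hΩf' : volume Ω' ≠ ∞) {z : EuclideanSpace ℝ (Fin n)} (hz : z ∈ Ω') (hza : ∀ j, z + a j ∈ Ω)
    (hg : ∀ j, ContinuousAt (g j) (z, z + a j)) (hS : 0 < shiftedSum q a g V z) {α : ℝ}
    (hα : n / (sphereArea n * shiftedSum q a g V z) < α) :
    ¬ ∃ C : ℝ, ∀ f : EuclideanSpace ℝ (Fin n) → ℝ,
      MemLp f (ENNReal.ofReal p) (volume.restrict Ω) →
      expIntegral d p q α a g Ω Ω' f ≤ ENNReal.ofReal C := by
  rintro ⟨C, hC⟩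
  have hω := sphereArea_pos hn
  have hn' : (0 : ℝ) < n := by exact_mod_cast hn
  have hq := hpq.symm.pos
  have : IsFiniteMeasure (volume.restrict Ω) := ⟨by simpa using hΩf.lt_top⟩
  set c : Fin N → ℝ := fun j => g j (z, z + a j) with hc
  have hSc : shiftedSum q a g V z = ∑ j, |c j| ^ q := by
    unfold shiftedSum
    exact Finset.sum_congr rfl fun j _ => indicator_of_mem (h.sub ⟨hz, hza j⟩) _
  rw [hSc] at hα hS
  set M := ∑ j, |c j| ^ q with hM
  have hα0 : 0 < α := lt_trans (by positivity) hα
  have hK : (n : ℝ) < α * (sphereArea n * M) := by rwa [div_lt_iff₀ (by positivity)] at hα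
  obtain ⟨η, hη0, hη1, hηK⟩ := exists_slack (d := d) (q := q) hK
  obtain ⟨ρ, hρ0, hρΩ', hρΩ, hsep, hgc⟩ := exists_radius ha hΩ hΩ' hz hza hg hη0
  set κ := (1 - η) * (1 + η) ^ (d - (n : ℝ)) with hκ
  have hκ0 : 0 < κ := mul_pos (by linarith) (by positivity)
  -- Strictness makes κ - κ² positive, so that Q is eventually absorbed as Λ grows.
  have hκ1 : κ < 1 := by
    have h1 : (1 + η) ^ (d - (n : ℝ)) ≤ 1 :=
      Real.rpow_le_one_of_one_le_of_nonpos (by linarith) (by linarith)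
    have h2 : 0 < (1 + η) ^ (d - (n : ℝ)) := by positivity
    rw [hκ]; nlinarith
  set Q := ∑ j, |c j| ^ (q - 1) * (N * (Γ * ρ ^ (d - (n : ℝ)))) *
        (sphereArea n * (ρ ^ (n - d) / (n - d))) with hQ
  set β := α * (sphereArea n * M) * κ ^ (2 * q) with hβ
  have hsep' : ∀ i j, i ≠ j → 2 * ρ ≤ ‖(fun j => z + a j) i - (fun j => z + a j) j‖ := by
    intro i j hij
    have := hsep i j hij
    simp only [add_sub_add_left_eq_sub]
    linarith
  -- With τ = ρ e^(-Λ) the integrand is at least e^(βΛ) on the ball of radius η τ, whose volume is a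
  -- constant times e^(-nΛ). Since β > n, no C bounds the product for all Λ.
  have key : ∀ Λ : ℝ, 0 < Λ → Q ≤ (κ - κ ^ 2) * (M * (sphereArea n * Λ)) →
      sphereArea n / n * (η * ρ) ^ (n : ℝ) * Real.exp ((β - n) * Λ) ≤ C := by
    intro Λ hΛ hΛQ
    set τ := ρ * Real.exp (-Λ) with hτ
    have hτ0 : 0 < τ := by positivity
    have hτρ : τ ≤ ρ := mul_le_of_le_one_right hρ0.le (Real.exp_le_one_iff.2 (by linarith))
    have hlog : Real.log (ρ / τ) = Λ := by
      rw [hτ, div_mul_eq_div_div, div_self hρ0.ne', one_div, Real.exp_neg, inv_inv, Real.log_exp]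
    set f := extremal d q c (fun j => z + a j) τ ρ with hf
    obtain ⟨hfL, hfn⟩ := memLp_extremal (c := c) hn hpq hdp hτ0 hτρ hsep'
      (fun j y hy => hρΩ j hy.2 : ∀ j, annulus (z + a j) τ ρ ⊆ Ω)
    rw [← hf, hlog] at hfn
    rw [← hf] at hfL
    have hf1 : IntegrableOn f Ω := hfL.integrable (by simpa using hpq.lt.le)
    have hwd := (h.operator_wellDefined hn hd hdn hΩ.measurableSet hΩ'.measurableSet hgm hΩf'
      hf1).1
    have hsub : {x | ‖z - x‖ < η * τ} ⊆ Ω' := fun x hx => hρΩ' (by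
      have hx' : ‖z - x‖ < η * τ := hx
      rw [norm_sub_rev] at hx'
      have : η * τ ≤ ρ := by nlinarith
      exact hx'.trans_le this)
    have hle : ENNReal.ofReal (Real.exp (β * Λ)) * volume {x | ‖z - x‖ < η * τ} ≤
        ENNReal.ofReal C := by
      refine le_trans ?_ (hC f hfL)
      unfold expIntegral
      rw [← setLIntegral_const]
      -- Only almost every x is used: where the integral defining Tf(x) fails to converge absolutely
      -- it is 0 by convention, and the lower bound would fail.
      refine (lintegral_mono_ae ?_).trans (lintegral_mono_set hsub)
      filter_upwards [ae_restrict_of_ae_restrict_of_subset hsub hwd,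
        ae_restrict_mem (measurableSet_lt (by fun_prop) measurable_const)] with x hx hxz
      have hxz' : ‖x - z‖ < η * τ := by rw [norm_sub_rev]; exact hxz
      have hxρ : ‖x - z‖ < ρ := hxz'.trans_le (by nlinarith)
      refine ENNReal.ofReal_le_ofReal (Real.exp_le_exp.2 ?_)
      have h1 := le_potentialOp_extremal hn hpq.symm.lt hdn hΩ.measurableSet (c := c) hτ0 hτρ hη0
        hη1 h.nonneg hsep hxz' (fun j y hy => h.bound j _ (h.sub ⟨hρΩ' hxρ, hy⟩)) hρΩ
        (fun j hcj y hy => hgc j hcj x hxρ y hy) hx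
      rw [hlog] at h1
      have h2 := rpow_le_of_quotient hpq hκ0.le (by positivity) hΛQ h1
      rw [hfn]
      calc β * Λ = α * (κ ^ (2 * q) * (M * (sphereArea n * Λ))) := by rw [hβ]; ring
        _ ≤ _ := mul_le_mul_of_nonneg_left h2 hα0.le
    rw [volume_setOf_norm_sub_lt hn (by positivity), ← ENNReal.ofReal_mul (by positivity)] at hle
    have h3 : Real.exp (β * Λ) * (sphereArea n / n * (η * τ) ^ (n : ℝ)) =
        sphereArea n / n * (η * ρ) ^ (n : ℝ) * Real.exp ((β - n) * Λ) := by
      rw [show η * τ = η * ρ * Real.exp (-Λ) by rw [hτ]; ring,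
        Real.mul_rpow (x := η * ρ) (by positivity) (by positivity), ← Real.exp_mul,
        show (β - n) * Λ = β * Λ + -Λ * n by ring, Real.exp_add]
      ring
    rw [h3] at hle
    rcases (ENNReal.ofReal_le_ofReal_iff').1 hle with h4 | h4
    · exact h4
    · exact absurd h4 (not_le.2 (by positivity))
  have hκκ : 0 < (κ - κ ^ 2) * (M * sphereArea n) := mul_pos (by nlinarith) (by positivity)
  have hbn : 0 < β - n := by linarith
  have ht : Filter.Tendsto (fun Λ : ℝ => sphereArea n / n * (η * ρ) ^ (n : ℝ) *
      Real.exp ((β - n) * Λ)) Filter.atTop Filter.atTop :=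
    Filter.Tendsto.const_mul_atTop (by positivity)
      (Real.tendsto_exp_atTop.comp (Filter.tendsto_id.const_mul_atTop hbn))
  obtain ⟨Λ, ⟨h1, h2⟩, h3⟩ := ((ht.eventually_gt_atTop C).and
    (Filter.eventually_gt_atTop 0) |>.and
    (Filter.eventually_ge_atTop (Q / ((κ - κ ^ 2) * (M * sphereArea n))))).exists
  rw [div_le_iff₀ hκκ] at h3
  exact absurd (key Λ h2 (by linarith)) (not_le.2 h1)

end SharpnessConclusion

/-! ### Assembly of the theorem. -/

theorem theorem15 (n N : ℕ) (Ω Ω' : Set (EuclideanSpace ℝ (Fin n)))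
    (hΩ : IsDomainSet Ω) (hΩb : Bornology.IsBounded Ω)
    (hΩ' : IsDomainSet Ω') (hΩb' : Bornology.IsBounded Ω')
    (a : Fin N → EuclideanSpace ℝ (Fin n)) (ha : Function.Injective a)
    (U : Set (EuclideanSpace ℝ (Fin n) × EuclideanSpace ℝ (Fin n)))
    (hU : IsDomainSet U) (hUb : Bornology.IsBounded U)
    (hsub : closure (Ω' ×ˢ Ω) ⊆ U)
    (g : Fin N → EuclideanSpace ℝ (Fin n) × EuclideanSpace ℝ (Fin n) → ℝ)
    (σ : Fin N → ℝ≥0) (hσ : ∀ j, 0 < σ j ∧ σ j ≤ 1)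
    (hg : ∀ j, ∃ L : ℝ≥0, HolderOnWith L (σ j) (g j) (closure U))
    (d p p' : ℝ) (hd0 : 0 < d) (hdn : d < n) (hp : p = n / d) (hpp' : 1 / p + 1 / p' = 1)
    (hM : 0 < supShiftedSum p' a g (closure U) Ω') :
    -- `T` is well defined on `L^p(Ω)`
    (∀ f : EuclideanSpace ℝ (Fin n) → ℝ, MemLp f (ENNReal.ofReal p) (volume.restrict Ω) →
      (∀ᵐ x ∂(volume.restrict Ω'), IntegrableOn (fun y => potentialKernel d a g x y * f y) Ω) ∧
      AEMeasurable (potentialOp d a g Ω f) (volume.restrict Ω')) ∧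
    -- the exponential inequality
    (∃ C : ℝ, ∀ f : EuclideanSpace ℝ (Fin n) → ℝ,
      MemLp f (ENNReal.ofReal p) (volume.restrict Ω) →
      expIntegral d p p' (n / (sphereArea n * supShiftedSum p' a g (closure U) Ω')) a g Ω Ω' f
        ≤ ENNReal.ofReal C) ∧
    -- sharpness of the constant
    ((starSet a Ω Ω').Nonempty →
      (∃ x ∈ starSet a Ω Ω',
        shiftedSum p' a g (closure U) x = supShiftedSum p' a g (closure U) Ω') →
      ∀ α : ℝ, n / (sphereArea n * supShiftedSum p' a g (closure U) Ω') < α →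
        ¬ ∃ C : ℝ, ∀ f : EuclideanSpace ℝ (Fin n) → ℝ,
          MemLp f (ENNReal.ofReal p) (volume.restrict Ω) →
          expIntegral d p p' α a g Ω Ω' f ≤ ENNReal.ofReal C) := by
  have hn' : (0 : ℝ) < n := hd0.trans hdn
  have hn : 0 < n := by exact_mod_cast hn'
  have hp1 : 1 < p := by rw [hp, one_lt_div hd0]; exact hdn
  have hpq : p.HolderConjugate p' := by
    rw [Real.holderConjugate_iff]
    exact ⟨hp1, by simpa using hpp'⟩
  have hdp : d / n = 1 / p := by rw [hp, one_div_div]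
  have hdp' : d * p = n := by rw [hp]; field_simp
  -- The p'-th power of the Riesz kernel has exactly the critical exponent -n.
  have hdq : (d - n) * p' = -n := by
    have h2 : (n : ℝ) = d * p := hdp'.symm
    rw [h2]
    have h3 : p * p' = p + p' := hpq.mul_eq_add
    linear_combination (-d) * h3
  obtain ⟨Γ, L, ε, δ, hε, hloc⟩ := exists_isLocalData ha hΩb hΩb' hU.1 hUb hsub
    (fun j => (hσ j).1) hg (sub_pos.2 hdn)
  have hcont : ∀ j, ContinuousOn (g j) (closure U) := fun j => by
    obtain ⟨l, hl⟩ := hg j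
    exact hl.continuousOn (hσ j).1
  have hgm : ∀ j, Measurable ((Ω' ×ˢ Ω).indicator (g j)) := fun j =>
    measurable_indicator_of_continuousOn (hΩ'.1.prod hΩ.1).measurableSet
      ((hcont j).mono hloc.sub)
  have hΩf : volume Ω ≠ ∞ := hΩb.measure_lt_top.ne
  have hΩf' : volume Ω' ≠ ∞ := hΩb'.measure_lt_top.ne
  have : IsFiniteMeasure (volume.restrict Ω) := ⟨by simpa using hΩf.lt_top⟩
  refine ⟨fun f hf => ?_, ?_, ?_⟩
  · exact hloc.operator_wellDefined hn hd0 hdn hΩ.1.measurableSet hΩ'.1.measurableSet hgm hΩf'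
      (hf.integrable (by simpa using hp1.le))
  · exact hloc.exists_expIntegral_le hn hd0 hdn hε hpq hdp hdq hΩ.1.measurableSet
      hΩ'.1.measurableSet hgm hΩf hΩf' hM
  · rintro - ⟨z, ⟨hz, hzs⟩, hzM⟩ α hα
    have hza : ∀ j, z + a j ∈ Ω := fun j => by
      obtain ⟨y, hy, hyz⟩ := mem_iInter.1 hzs j
      have : y = z + a j := by rw [← hyz]; simp
      rwa [← this]
    rw [← hzM] at hα hM
    exact hloc.not_exists_expIntegral_le ha hn hd0 hdn hpq hdp' hΩ.1 hΩ'.1 hgm hΩf hΩf' hz hza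
      (fun j => (hcont j).continuousAt (Filter.mem_of_superset
        (hU.1.mem_nhds (hsub (subset_closure ⟨hz, hza j⟩))) subset_closure)) hM hα
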